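/- **Setting.** Let $\nu\in[-1/2,1)$, $\tau>0$, and for $f=f(x,v)\ge 0$, $x\in[0,1]$, $v\in\mathbb R^3$, put $$\rho=\int f\,dv,\quad \rho U=\int fv\,dv,\quad 3\rho T=\int f|v-U|^2dv,\quad \rho\Theta=\int f(v-U)\otimes(v-U)\,dv,$$ $$\mathcal T_\nu=(1-\nu)T\,\mathbb I_3+\nu\Theta,\qquad \mathcal M_\nu(f)=\frac{\rho}{\sqrt{\det(2\pi\mathcal T_\nu)}}\exp\Big(-\tfrac12(v-U)^\top\mathcal T_\nu^{-1}(v-U)\Big),\qquad \mathcal R(f)=\mathcal M_\nu(f)-f .$$ Let $T_w(0),T_w(1)>0$ and let $M_w(i,v)=c_ie^{-|v|^2/(2T_w(i))}$, where $c_i$ is chosen so that $\int_{v_1>0}M_w(i,v)|v_1|dv=1$. Put $M_w(v)=M_w(0,v)1_{v_1>0}+M_w(1,v)1_{v_1<0}$, $f_{LR}=f_L1_{v_1>0}+f_R1_{v_1<0}$ and $Rv=(-v_1,v_2,v_3)$. Let $\delta_1,\delta_2,\delta_3\ge0$ with $\delta_1+\delta_2+\delta_3=1$. Property $(P_1)$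 says that $f_{LR}\ge0$, $f_{LR}\not\equiv0$ and $\int f_{LR}(1+|v|^2)dv<\infty$. A *mild solution* is a measurable $f$ with $\sup_{x\in[0,1]}\int|f(x,v)|(1+|v|^2)dv<\infty$ (the traces at $x=0,1$ included) such that, for all $x\in[0,1]$ and almost every $v$, $$f(x,v)=e^{-\frac{x}{\tau|v_1|}}f(0,v)+\frac1{\tau|v_1|}\int_0^xe^{-\frac{x-y}{\tau|v_1|}}\mathcal M_\nu(f)(y,v)\,dy\quad(v_1>0),$$ $$f(x,v)=e^{-\frac{1-x}{\tau|v_1|}}f(1,v)+\frac1{\tau|v_1|}\int_x^1e^{-\frac{y-x}{\tau|v_1|}}\mathcal M_\nu(f)(y,v)\,dy\quad(v_1<0),\tag{1}$$ with the boundary condition $$f(0,v)=\delta_1f_L+\delta_2\mathcal S_L(f)M_w(0,v)+\delta_3f(0,Rv)\ (v_1>0),\qquad f(1,v)=\delta_1f_R+\delta_2\mathcal S_R(f)M_w(1,v)+\delta_3f(1,Rv)\ (v_1<0),$$ $$\mathcal S_L(f)=\frac{1-\delta_1}{2-\delta_1}+\frac{\delta_1}{2-\delta_1}\int_{v_1<0}f_R|v_1|dv-\frac1{\tau(2-\delta_1)}\int_{v_1>0}\int_0^1\mathcal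 R(f)(y,v)\,dy\,dv,$$ $$\mathcal S_R(f)=\frac{1-\delta_1}{2-\delta_1}+\frac{\delta_1}{2-\delta_1}\int_{v_1>0}f_L|v_1|dv-\frac1{\tau(2-\delta_1)}\int_{v_1<0}\int_0^1\mathcal R(f)(y,v)\,dy\,dv.$$ This is the form that the mixed boundary condition $$\begin{aligned}f(0,v)&=\delta_1f_L+\delta_2\Big(\int_{v_1<0}f(0,w)|w_1|dw\Big)M_w(0,v)+\delta_3f(0,Rv)&&(v_1>0),\\ f(1,v)&=\delta_1f_R+\delta_2\Big(\int_{v_1>0}f(1,w)|w_1|dw\Big)M_w(1,v)+\delta_3f(1,Rv)&&(v_1<0)\end{aligned}\tag{2}$$ takes under the flux normalization $$\int_{v_1<0}f(0,v)|v_1|dv+\int_{v_1>0}f(1,v)|v_1|dv=1.\tag{3}$$ **Constants.** $C_{LR,2}=2\int f_{LR}|v_1|dv+2\int M_w(1+|v|^2)dv$, $\;a_{\ell,2}=\frac12\int e^{-1/|v_1|}M_w\,dv$, $\;C^1_\nu=\min\{1-\nu,1+2\nu\}$, $\;C^2_\nu=\max\{1-\nu,1+2\nu\}$, $$\gamma_{\ell,2}=\Big(\int_{v_1>0}e^{-\frac1{|v_1|}}M_w(0,v)|v_1|dv\Big)\Big(\int_{v_1<0}e^{-\frac1{|v_1|}}M_w(1,v)|v_1|dv\Big),\quad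 a_{-1/2,2}=\inf_{|\kappa|=1}\int e^{-\frac1{|v_1|}}M_w\{|v|^2-(v\cdot\kappa)^2\}dv .$$ **Theorem.** Let $f_{LR}$ satisfy $(P_1)$ and let $d>0$. (1) Then $\gamma_{\ell,2}>0$. For $-1/2<\nu<1$ there are $K_1>0$ and $\epsilon>0$ (depending on $\nu,f_L,f_R,T_w,d$) such that, whenever $\tau>K_1$, $\delta_1<\epsilon$ and $\delta_2\ge d$, there is a unique mild solution $f\ge0$ satisfying, for all $x\in[0,1]$ and all $|\kappa|=1$, $$\int f\,dv\ge a_{\ell,2},\qquad\int f(1+|v|^2)dv\le2C_{LR,2},\qquad C^1_\nu\delta_2^2\frac{\gamma_{\ell,2}}{27C_{LR,2}^2}\le\kappa^\top\mathcal T_\nu\kappa\le\frac{2}{3a_{\ell,2}}C^2_\nu C_{LR,2}.$$ (2) Also $a_{-1/2,2}>0$. For $\nu=-1/2$ there are $K_1>0$ and $\epsilon_1>0$ (depending on $f_L,f_R,T_w,d$) such that, whenever $\tau>K_1$, $\delta_1<\epsilon_1$ and $\delta_2\ge d$, there is a unique mild solution $f\ge0$ satisfying, for all $x\in[0,1]$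 and all $|\kappa|=1$, $$\int f\,dv\ge a_{\ell,2},\qquad\int f|v|^2dv\le2C_{LR,2},\qquad\delta_2\frac{a_{-1/2,2}}{4C_{LR,2}}\le\kappa^\top\mathcal T_{-1/2}\kappa\le\frac{3}{2a_{\ell,2}}C_{LR,2}.$$ In this critical case no smallness of $\big|\int_{v_1>0}f_L|v_1|dv-\int_{v_1<0}f_R|v_1|dv\big|$ is required. In both cases, if $\delta_1\big(\int_{v_1>0}f_L|v_1|dv+\int_{v_1<0}f_R|v_1|dv-1\big)=0$, then $f$ also satisfies (2) and (3); and every nonnegative measurable $g$ with $\sup_{x\in[0,1]}\int|g(x,v)|(1+|v|^2)dv<\infty$ that satisfies (1), (2), (3) and the respective bounds equals $f$. Uniqueness and equality are meant for every $x\in[0,1]$ and almost every $v$. -/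

import Mathlib

open MeasureTheory Set
open scoped Matrix

noncomputable section

namespace ESBGK

/-- The velocity space `ℝ³`. The paper's component `v₁` is `v 0`. -/
abbrev Vel : Type := EuclideanSpace ℝ (Fin 3)

/-- The half space `v₁ > 0`. -/
def posHalf : Set Vel := {v | 0 < v 0}

/-- The half space `v₁ < 0`. -/
def negHalf : Set Vel := {v | v 0 < 0}

/-- The reflection `(v₁, v₂, v₃) ↦ (-v₁, v₂, v₃)`. -/
def reflect (v : Vel) : Vel := !₂[-v 0, v 1, v 2]

/-! ### Macroscopic fields and the ellipsoidal Gaussian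

A distribution function is `f : ℝ → Vel → ℝ`, used only for positions in `[0, 1]`. -/

/-- Local density `ρ(x) = ∫ f dv`. -/
def density (f : ℝ → Vel → ℝ) (x : ℝ) : ℝ := ∫ v, f x v

/-- Bulk velocity `U(x)`, given by `ρ U = ∫ f v dv`. -/
def bulkVelocity (f : ℝ → Vel → ℝ) (x : ℝ) : Vel := (density f x)⁻¹ • ∫ v, f x v • v

/-- Temperature `T(x)`, given by `3 ρ T = ∫ f |v - U|² dv`. -/
def temperature (f : ℝ → Vel → ℝ) (x : ℝ) : ℝ :=
  (3 * density f x)⁻¹ * ∫ v, f x v * ‖v - bulkVelocity f x‖ ^ 2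

/-- Stress tensor `Θ(x)`, given by `ρ Θ = ∫ f (v - U) ⊗ (v - U) dv`. -/
def stress (f : ℝ → Vel → ℝ) (x : ℝ) : Matrix (Fin 3) (Fin 3) ℝ :=
  Matrix.of fun i j =>
    (density f x)⁻¹ * ∫ v, f x v * ((v - bulkVelocity f x) i * (v - bulkVelocity f x) j)

/-- Temperature tensor `𝒯_ν = (1 - ν) T I + ν Θ`. -/
def tempTensor (ν : ℝ) (f : ℝ → Vel → ℝ) (x : ℝ) : Matrix (Fin 3) (Fin 3) ℝ :=
  ((1 - ν) * temperature f x) • (1 : Matrix (Fin 3) (Fin 3) ℝ) + ν • stress f x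

/-- The quadratic form `κᵀ A κ`. -/
def quadForm (A : Matrix (Fin 3) (Fin 3) ℝ) (κ : Vel) : ℝ := κ.ofLp ⬝ᵥ (A *ᵥ κ.ofLp)

/-- The ellipsoidal Gaussian
`ℳ_ν(f) = ρ / √det(2π 𝒯_ν) · exp(-½ (v - U)ᵀ 𝒯_ν⁻¹ (v - U))`. -/
def gaussianES (ν : ℝ) (f : ℝ → Vel → ℝ) (x : ℝ) (v : Vel) : ℝ :=
  density f x / Real.sqrt (((2 * Real.pi) • tempTensor ν f x).det) *
    Real.exp (-(1 / 2) * quadForm (tempTensor ν f x)⁻¹ (v - bulkVelocity f x))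

/-! ### Boundary data -/

/-- The wall Maxwellian of temperature `T`: the multiple of `exp(-|v|² / (2T))` whose flux
`∫_{v₁ > 0} M |v₁| dv` through the wall is one. -/
def wallMaxwellian (T : ℝ) (v : Vel) : ℝ :=
  Real.exp (-(‖v‖ ^ 2 / (2 * T))) / ∫ w in posHalf, Real.exp (-(‖w‖ ^ 2 / (2 * T))) * |w 0|

/-- `g_L 1_{v₁ > 0} + g_R 1_{v₁ < 0}`. -/
def glue (gL gR : Vel → ℝ) (v : Vel) : ℝ := posHalf.indicator gL v + negHalf.indicator gR v

/-- `M_w(v) = M_w(0, v) 1_{v₁ > 0} + M_w(1, v) 1_{v₁ < 0}`, for wall temperatures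
`Tw 0` at `x = 0` and `Tw 1` at `x = 1`. -/
def wallMw (Tw : Fin 2 → ℝ) : Vel → ℝ := glue (wallMaxwellian (Tw 0)) (wallMaxwellian (Tw 1))

/-- The trace norm with weight `w` of a function with boundary values `g₀` at `x = 0` and `g₁` at
`x = 1`: the outward part plus the inward part. -/
def traceNorm (w : Vel → ℝ) (g₀ g₁ : Vel → ℝ) : ℝ :=
  ((∫ v in negHalf, |g₀ v| * w v) + ∫ v in posHalf, |g₁ v| * w v) +
  ((∫ v in posHalf, |g₀ v| * w v) + ∫ v in negHalf, |g₁ v| * w v)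

/-- Property (P₁): `f_LR` is nonnegative, not identically zero, and has a finite trace norm with
weight `1 + |v|²`. -/
def PropP1 (fL fR : Vel → ℝ) : Prop :=
  (∀ᵐ v, 0 ≤ glue fL fR v) ∧ ¬ (∀ᵐ v, glue fL fR v = 0) ∧
    Integrable (fun v : Vel => glue fL fR v * (1 + ‖v‖ ^ 2))

/-- `C_{LR,2} = ‖f_LR‖_{L¹_{γ,|v₁|}} + ‖M_w‖_{L¹_{γ,⟨v⟩}}`. -/
def constC (fL fR : Vel → ℝ) (Tw : Fin 2 → ℝ) : ℝ :=
  traceNorm (fun v => |v 0|) (glue fL fR) (glue fL fR) +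
    traceNorm (fun v => 1 + ‖v‖ ^ 2) (wallMw Tw) (wallMw Tw)

/-- `a_{ℓ,2} = ½ ∫ exp(-1/|v₁|) M_w dv`. -/
def constA (Tw : Fin 2 → ℝ) : ℝ := 1 / 2 * ∫ v : Vel, Real.exp (-(1 / |v 0|)) * wallMw Tw v

/-- `γ_{ℓ,2}`. -/
def constGamma (Tw : Fin 2 → ℝ) : ℝ :=
  (∫ v in posHalf, Real.exp (-(1 / |v 0|)) * wallMaxwellian (Tw 0) v * |v 0|) *
    ∫ v in negHalf, Real.exp (-(1 / |v 0|)) * wallMaxwellian (Tw 1) v * |v 0|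

/-- `a_{-1/2,2} = inf_{|κ| = 1} ∫ exp(-1/|v₁|) M_w (|v|² - (v · κ)²) dv`. -/
def constACrit (Tw : Fin 2 → ℝ) : ℝ :=
  ⨅ κ : Metric.sphere (0 : Vel) 1,
    ∫ v : Vel, Real.exp (-(1 / |v 0|)) * wallMw Tw v * (‖v‖ ^ 2 - inner ℝ v (κ : Vel) ^ 2)

/-! ### Mild solutions -/

/-- `f ∈ L^∞([0,1]; L¹₂(ℝ³)) ∩ L¹_{γ,⟨v⟩}`: `f` is jointly measurable and `f(x, ·)(1 + |v|²)` is
integrable with a bound uniform in `x ∈ [0,1]`, the end points (the traces) included. -/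
def InClass (f : ℝ → Vel → ℝ) : Prop :=
  AEStronglyMeasurable (fun p : ℝ × Vel => f p.1 p.2)
    ((volume.restrict (Icc (0 : ℝ) 1)).prod volume) ∧
  (∀ x ∈ Icc (0 : ℝ) 1, Integrable (fun v : Vel => f x v * (1 + ‖v‖ ^ 2))) ∧
  ∃ B : ℝ, ∀ x ∈ Icc (0 : ℝ) 1, ∫ v : Vel, |f x v| * (1 + ‖v‖ ^ 2) ≤ B

/-- The integral form of `v₁ ∂ₓ f = τ⁻¹ (ℳ_ν(f) - f)` along characteristics, which enter at
`x = 0` for `v₁ > 0` and at `x = 1` for `v₁ < 0`. -/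
def MildEquation (ν τ : ℝ) (f : ℝ → Vel → ℝ) : Prop :=
  ∀ x ∈ Icc (0 : ℝ) 1, ∀ᵐ v : Vel,
    (0 < v 0 → f x v = Real.exp (-(x / (τ * |v 0|))) * f 0 v +
      1 / (τ * |v 0|) *
        ∫ y in (0 : ℝ)..x, Real.exp (-((x - y) / (τ * |v 0|))) * gaussianES ν f y v) ∧
    (v 0 < 0 → f x v = Real.exp (-((1 - x) / (τ * |v 0|))) * f 1 v +
      1 / (τ * |v 0|) *
        ∫ y in x..(1 : ℝ), Real.exp (-((y - x) / (τ * |v 0|))) * gaussianES ν f y v)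

/-- `ℛ(f) = ℳ_ν(f) - f`. -/
def relaxation (ν : ℝ) (f : ℝ → Vel → ℝ) (x : ℝ) (v : Vel) : ℝ := gaussianES ν f x v - f x v

/-- `𝒮_L(f)`. -/
def fluxL (ν τ δ₁ : ℝ) (fR : Vel → ℝ) (f : ℝ → Vel → ℝ) : ℝ :=
  (1 - δ₁) / (2 - δ₁) + δ₁ / (2 - δ₁) * (∫ v in negHalf, fR v * |v 0|) -
    1 / (τ * (2 - δ₁)) * ∫ v in posHalf, ∫ y in (0 : ℝ)..1, relaxation ν f y v

/-- `𝒮_R(f)`. -/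
def fluxR (ν τ δ₁ : ℝ) (fL : Vel → ℝ) (f : ℝ → Vel → ℝ) : ℝ :=
  (1 - δ₁) / (2 - δ₁) + δ₁ / (2 - δ₁) * (∫ v in posHalf, fL v * |v 0|) -
    1 / (τ * (2 - δ₁)) * ∫ v in negHalf, ∫ y in (0 : ℝ)..1, relaxation ν f y v

/-- The boundary condition in which the diffusive reflection has coefficients `cL` at `x = 0` and
`cR` at `x = 1`:
`f(0,v) = δ₁ f_L + δ₂ cL M_w(0) + δ₃ f(0,Rv)` for `v₁ > 0` and
`f(1,v) = δ₁ f_R + δ₂ cR M_w(1) + δ₃ f(1,Rv)` for `v₁ < 0`. -/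
def BoundaryRelation (δ₁ δ₂ δ₃ : ℝ) (fL fR : Vel → ℝ) (Tw : Fin 2 → ℝ) (cL cR : ℝ)
    (f : ℝ → Vel → ℝ) : Prop :=
  (∀ᵐ v : Vel, 0 < v 0 →
    f 0 v = δ₁ * fL v + δ₂ * cL * wallMaxwellian (Tw 0) v + δ₃ * f 0 (reflect v)) ∧
  (∀ᵐ v : Vel, v 0 < 0 →
    f 1 v = δ₁ * fR v + δ₂ * cR * wallMaxwellian (Tw 1) v + δ₃ * f 1 (reflect v))

/-- A mild solution of the diffusive dominant problem: the boundary condition is the one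
reformulated through `𝒮_L(f)` and `𝒮_R(f)`. -/
def IsMildSolution (ν τ δ₁ δ₂ δ₃ : ℝ) (fL fR : Vel → ℝ) (Tw : Fin 2 → ℝ)
    (f : ℝ → Vel → ℝ) : Prop :=
  InClass f ∧ MildEquation ν τ f ∧
    BoundaryRelation δ₁ δ₂ δ₃ fL fR Tw (fluxL ν τ δ₁ fR f) (fluxR ν τ δ₁ fL f) f

/-- The mixed boundary condition before the reformulation: the diffusive coefficients are the
outgoing fluxes at the two walls. -/
def MixedBoundary (δ₁ δ₂ δ₃ : ℝ) (fL fR : Vel → ℝ) (Tw : Fin 2 → ℝ) (f : ℝ → Vel → ℝ) : Prop :=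
  BoundaryRelation δ₁ δ₂ δ₃ fL fR Tw (∫ v in negHalf, f 0 v * |v 0|)
    (∫ v in posHalf, f 1 v * |v 0|) f

/-- The flux normalization `∫_{v₁ < 0} f(0,v)|v₁| dv + ∫_{v₁ > 0} f(1,v)|v₁| dv = 1`. -/
def FluxNormalized (f : ℝ → Vel → ℝ) : Prop :=
  (∫ v in negHalf, f 0 v * |v 0|) + (∫ v in posHalf, f 1 v * |v 0|) = 1

/-- `f ≥ 0` on `[0,1] × ℝ³`. -/
def Nonneg (f : ℝ → Vel → ℝ) : Prop := ∀ x ∈ Icc (0 : ℝ) 1, ∀ᵐ v : Vel, 0 ≤ f x v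

/-- The bounds on density, energy and temperature tensor for `-1/2 < ν < 1`, with
`C¹_ν = min(1 - ν, 1 + 2ν)` and `C²_ν = max(1 - ν, 1 + 2ν)`. -/
def NoncriticalBounds (ν δ₂ : ℝ) (fL fR : Vel → ℝ) (Tw : Fin 2 → ℝ) (f : ℝ → Vel → ℝ) : Prop :=
  ∀ x ∈ Icc (0 : ℝ) 1,
    constA Tw ≤ ∫ v : Vel, f x v ∧
    ∫ v : Vel, f x v * (1 + ‖v‖ ^ 2) ≤ 2 * constC fL fR Tw ∧
    ∀ κ : Vel, ‖κ‖ = 1 →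
      min (1 - ν) (1 + 2 * ν) * δ₂ ^ 2 * (constGamma Tw / (27 * constC fL fR Tw ^ 2)) ≤
        quadForm (tempTensor ν f x) κ ∧
      quadForm (tempTensor ν f x) κ ≤
        2 / (3 * constA Tw) * max (1 - ν) (1 + 2 * ν) * constC fL fR Tw

/-- The bounds on density, energy and temperature tensor for `ν = -1/2`. -/
def CriticalBounds (δ₂ : ℝ) (fL fR : Vel → ℝ) (Tw : Fin 2 → ℝ) (f : ℝ → Vel → ℝ) : Prop :=
  ∀ x ∈ Icc (0 : ℝ) 1,
    constA Tw ≤ ∫ v : Vel, f x v ∧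
    ∫ v : Vel, f x v * ‖v‖ ^ 2 ≤ 2 * constC fL fR Tw ∧
    ∀ κ : Vel, ‖κ‖ = 1 →
      δ₂ * (constACrit Tw / (4 * constC fL fR Tw)) ≤ quadForm (tempTensor (-1 / 2) f x) κ ∧
      quadForm (tempTensor (-1 / 2) f x) κ ≤ 3 / (2 * constA Tw) * constC fL fR Tw

/-- Unique solvability in the set of nonnegative functions with the bounds `P`.
* There is a mild solution `f`, and every mild solution in that set equals `f`.
* If `δ₁ (∫_{v₁ > 0} f_L |v₁| + ∫_{v₁ < 0} f_R |v₁| - 1) = 0`, then `f` satisfies the mixed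
  boundary condition and the flux normalization.
* Every function in that set which solves the equation in mild form with the mixed boundary
  condition and the flux normalization equals `f`.

Equality is that of `L^∞([0,1]; L¹₂)`: for every `x`, for almost every `v`. -/
def UniquelySolvable (ν τ δ₁ δ₂ δ₃ : ℝ) (fL fR : Vel → ℝ) (Tw : Fin 2 → ℝ)
    (P : (ℝ → Vel → ℝ) → Prop) : Prop :=
  ∃ f : ℝ → Vel → ℝ,
    (IsMildSolution ν τ δ₁ δ₂ δ₃ fL fR Tw f ∧ Nonneg f ∧ P f) ∧
    (∀ g : ℝ → Vel → ℝ, IsMildSolution ν τ δ₁ δ₂ δ₃ fL fR Tw g → Nonneg g → P g →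
      ∀ x ∈ Icc (0 : ℝ) 1, g x =ᵐ[volume] f x) ∧
    (δ₁ * ((∫ v in posHalf, fL v * |v 0|) + (∫ v in negHalf, fR v * |v 0|) - 1) = 0 →
      MixedBoundary δ₁ δ₂ δ₃ fL fR Tw f ∧ FluxNormalized f) ∧
    (∀ g : ℝ → Vel → ℝ, InClass g → MildEquation ν τ g →
      MixedBoundary δ₁ δ₂ δ₃ fL fR Tw g → FluxNormalized g → Nonneg g → P g →
      ∀ x ∈ Icc (0 : ℝ) 1, g x =ᵐ[volume] f x)

end ESBGK

end

namespace ESBGK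

/-! For weak inflow and weak collisions the problem is a small perturbation of free flight between
the walls. With δ₁ = 0, no collisions and wall coefficients 1/2, the boundary condition has the
explicit solution `limitProfile`. Its moments up to order two are those of M_w/2, whatever δ₃ is
(`moments_limitProfile`): the unit fluxes of the two wall Maxwellians make the mean of v₁ vanish,
and reflections kill the other odd moments. At these moments all asserted bounds hold with a strict
margin, hence also in a neighbourhood (`exists_noncritical_bounds`, `exists_critical_bounds`).

The Gaussian sees f only through its moments of order at most two. So the unknown becomes a pair: a
continuous field m of moments on [0,1] and the pair s of wall coefficients. Given (m, s), the
transport equation with specular reflection is solved explicitly by `profile`; the incoming traces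
at v and Rv are coupled by a 2×2 system with determinant at least d. On the compact set `admissible`
the Gaussian is dominated by a fixed radial one and is Lipschitz in the moments
(`exists_gaussM_bounds`). The singular factor 1/(τ|v₁|) is tamed by 1 - e^{-z} ≤ √z
(`one_sub_exp_le_sqrt`): collisions contribute O(τ^{-1/2}), because |v₁|^{-1/2} is integrable
against Gaussians.

The moments depend on s with a constant that is not small, but the new s depends on the old data
only with a factor τ^{-1/2}. Updating s first and then computing m from the new s therefore gives a
contraction near the limit (`exists_solutionPair`).

Uniqueness holds in the whole class. The bounds put the moments of any solution into `admissible`;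
the solution is the profile of its own source (`ae_eq_profile`), so its moments are continuous
(`exists_moments_of_solution`) and form a fixed point. The contraction estimate holds for any two
fields with admissible values, near the limit or not.

The passage between the two boundary conditions is mass conservation. The Gaussian has the mass of f
(`integral_gaussM`), so the collision terms of the two half spaces cancel (`balance_add_balance`),
and linear algebra on the outgoing fluxes does the rest (`IsSolutionPair.fluxes`,
`isMildSolution_of_mixedBoundary`). -/

/-! ### Reflections of velocity space and the two half spaces. -/

/-- The isometry of velocity space which changes the sign of the component `i`. -/
noncomputable def flip (i : Fin 3) : Vel ≃ₗᵢ[ℝ] Vel :=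
  LinearIsometryEquiv.piLpCongrRight 2
    (fun j => if j = i then LinearIsometryEquiv.neg ℝ else LinearIsometryEquiv.refl ℝ ℝ)

theorem flip_apply (i j : Fin 3) (v : Vel) : flip i v j = if j = i then -v j else v j := by
  simp only [flip, LinearIsometryEquiv.piLpCongrRight_apply]
  split_ifs <;> simp [*]

theorem flip_flip (i : Fin 3) (v : Vel) : flip i (flip i v) = v := by
  ext j
  simp only [flip_apply]
  split_ifs <;> simp

theorem norm_flip (i : Fin 3) (v : Vel) : ‖flip i v‖ = ‖v‖ := (flip i).norm_map v

theorem reflect_eq_flip (v : Vel) : reflect v = flip 0 v := by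
  ext j
  rw [flip_apply]
  fin_cases j <;> simp [reflect]

theorem reflect_apply_zero (v : Vel) : reflect v 0 = -v 0 := by
  rw [reflect_eq_flip, flip_apply]; simp

theorem reflect_reflect (v : Vel) : reflect (reflect v) = v := by
  rw [reflect_eq_flip, reflect_eq_flip, flip_flip]

theorem norm_reflect (v : Vel) : ‖reflect v‖ = ‖v‖ := by
  rw [reflect_eq_flip, norm_flip]

theorem measurePreserving_flip (i : Fin 3) : MeasurePreserving (flip i) :=
  (flip i).measurePreserving

theorem measurePreserving_reflect : MeasurePreserving reflect := by
  have : reflect = flip 0 := funext reflect_eq_flip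
  rw [this]; exact measurePreserving_flip 0

theorem integral_comp_flip (i : Fin 3) (g : Vel → ℝ) : ∫ v, g (flip i v) = ∫ v, g v :=
  (measurePreserving_flip i).integral_comp (flip i).toHomeomorph.measurableEmbedding g

theorem integral_comp_reflect (g : Vel → ℝ) : ∫ v, g (reflect v) = ∫ v, g v := by
  simp_rw [reflect_eq_flip]; exact integral_comp_flip 0 g

theorem integrable_comp_reflect {g : Vel → ℝ} (hg : Integrable g) :
    Integrable (fun v => g (reflect v)) :=
  measurePreserving_reflect.integrable_comp_of_integrable hg

@[fun_prop]
theorem measurable_reflect : Measurable reflect := measurePreserving_reflect.measurable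

theorem ae_comp_reflect {p : Vel → Prop} (h : ∀ᵐ v, p v) : ∀ᵐ v, p (reflect v) :=
  measurePreserving_reflect.quasiMeasurePreserving.ae h

theorem continuous_coord (i : Fin 3) : Continuous (fun v : Vel => v i) := by fun_prop

theorem measurableSet_posHalf : MeasurableSet posHalf :=
  measurableSet_lt measurable_const (continuous_coord 0).measurable

theorem measurableSet_negHalf : MeasurableSet negHalf :=
  measurableSet_lt (continuous_coord 0).measurable measurable_const

/-- The exceptional set is a proper linear subspace. Grazing velocities are not covered by the mild
equation, so they must be negligible. -/
theorem ae_coord_ne_zero : ∀ᵐ v : Vel, v 0 ≠ 0 := by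
  let L : Vel →ₗ[ℝ] ℝ := (EuclideanSpace.proj (0 : Fin 3) : Vel →L[ℝ] ℝ).toLinearMap
  have h := Measure.addHaar_submodule (volume : Measure Vel) (LinearMap.ker L) (by
    intro h
    have h1 : EuclideanSpace.single (0 : Fin 3) (1 : ℝ) ∈ LinearMap.ker L := by rw [h]; trivial
    simp [L] at h1)
  have h2 : {v : Vel | ¬ v 0 ≠ 0} = (LinearMap.ker L : Set Vel) := by
    ext v; simp [L]
  rw [ae_iff, h2, h]

theorem abs_coord_le_norm (v : Vel) (i : Fin 3) : |v i| ≤ ‖v‖ := by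
  simpa using PiLp.norm_apply_le v i

/-! ### Quadratic and Gaussian weights. -/

/-- The weight `1 + |v|²`. -/
noncomputable def wt (v : Vel) : ℝ := 1 + ‖v‖ ^ 2

theorem wt_pos (v : Vel) : 0 < wt v := by unfold wt; positivity

theorem one_le_wt (v : Vel) : 1 ≤ wt v := by unfold wt; nlinarith [sq_nonneg ‖v‖]

theorem abs_coord_le_wt (v : Vel) (i : Fin 3) : |v i| ≤ wt v := by
  have := abs_coord_le_norm v i
  unfold wt; nlinarith [sq_nonneg (‖v‖ - 1), sq_nonneg ‖v‖]

theorem wt_reflect (v : Vel) : wt (reflect v) = wt v := by simp [wt, norm_reflect]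

@[fun_prop]
theorem continuous_wt : Continuous wt := by unfold wt; fun_prop

/-- The radial Gaussian weight `exp(-c |v|²)`. -/
noncomputable def gw (c : ℝ) (v : Vel) : ℝ := Real.exp (-c * ‖v‖ ^ 2)

theorem gw_pos (c : ℝ) (v : Vel) : 0 < gw c v := Real.exp_pos _

@[fun_prop]
theorem continuous_gw (c : ℝ) : Continuous (gw c) := by unfold gw; fun_prop

theorem gw_reflect (c : ℝ) (v : Vel) : gw c (reflect v) = gw c v := by simp [gw, norm_reflect]

theorem gw_anti {c c' : ℝ} (h : c ≤ c') (v : Vel) : gw c' v ≤ gw c v := by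
  unfold gw
  apply Real.exp_le_exp.2
  nlinarith [sq_nonneg ‖v‖]

theorem integrable_gw {c : ℝ} (hc : 0 < c) : Integrable (gw c) := by
  have := (GaussianFourier.integrable_cexp_neg_mul_sq_norm_add (V := Vel) (b := (c : ℂ))
    (by simpa using hc) 0 0).norm
  refine this.congr (Filter.Eventually.of_forall fun v => ?_)
  simp only [gw, Complex.norm_exp]
  simp [← Complex.ofReal_pow]

/-- Half of the Gaussian absorbs the quadratic weight, by e^t ≥ 1 + t. -/
theorem wt_mul_gw_le {c : ℝ} (hc : 0 < c) (v : Vel) :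
    wt v * gw c v ≤ (1 + 2 / c) * gw (c / 2) v := by
  have h1 : gw c v = gw (c / 2) v * gw (c / 2) v := by
    unfold gw; rw [← Real.exp_add]; ring_nf
  have h2 : wt v * gw (c / 2) v ≤ 1 + 2 / c := by
    have h3 : gw (c / 2) v = (Real.exp (c / 2 * ‖v‖ ^ 2))⁻¹ := by
      unfold gw; rw [← Real.exp_neg]; ring_nf
    have h4 := Real.add_one_le_exp (c / 2 * ‖v‖ ^ 2)
    have h5 : (0 : ℝ) ≤ ‖v‖ ^ 2 := by positivity
    rw [h3, ← div_eq_mul_inv, div_le_iff₀ (Real.exp_pos _)]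
    have h6 : 1 + ‖v‖ ^ 2 ≤ (1 + 2 / c) * (c / 2 * ‖v‖ ^ 2 + 1) := by
      have : (1 + 2 / c) * (c / 2 * ‖v‖ ^ 2 + 1)
        = 1 + ‖v‖ ^ 2 + (2 / c + c / 2 * ‖v‖ ^ 2) := by field_simp; ring
      rw [this]
      have : 0 ≤ 2 / c + c / 2 * ‖v‖ ^ 2 := by positivity
      linarith
    calc wt v = 1 + ‖v‖ ^ 2 := rfl
      _ ≤ _ := h6
      _ ≤ _ := by gcongr
  rw [h1, ← mul_assoc]
  exact mul_le_mul_of_nonneg_right h2 (gw_pos _ _).le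

/-- The function is a product over the coordinates, and |t|^{-1/2} is integrable at 0. This is the
singularity that remains after integrating along characteristics; |v₁|^{-1} would not be integrable.
-/
theorem integrable_sqrt_inv_mul_gw {c : ℝ} (hc : 0 < c) :
    Integrable (fun v : Vel => (Real.sqrt |v 0|)⁻¹ * gw c v) := by
  have h1 : Integrable (fun t : ℝ => (Real.sqrt |t|)⁻¹ * Real.exp (-c * t ^ 2)) := by
    have hI : IntegrableOn (fun t : ℝ => (Real.sqrt |t|)⁻¹ * Real.exp (-c * t ^ 2)) (Ioi 0) := by
      refine (integrableOn_rpow_mul_exp_neg_mul_sq hc (s := -(1 / 2)) (by norm_num)).congr_fun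
        (fun t ht => ?_) measurableSet_Ioi
      have ht' : (0 : ℝ) < t := ht
      simp only [abs_of_pos ht']
      rw [Real.rpow_neg ht'.le, ← Real.sqrt_eq_rpow]
    have hI' : IntegrableOn (fun t : ℝ => (Real.sqrt |t|)⁻¹ * Real.exp (-c * t ^ 2)) (Iio 0) := by
      have hI0 : IntegrableOn (fun t : ℝ => (Real.sqrt |t|)⁻¹ * Real.exp (-c * t ^ 2)) (Ioi (-0)) := by
        simpa using hI
      simpa using hI0.comp_neg_Iio
    have : (univ : Set ℝ) = Iic 0 ∪ Ioi 0 := by simp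
    rw [← integrableOn_univ, this]
    exact ((integrableOn_Iic_iff_integrableOn_Iio).2 hI').union hI
  have h2 : Integrable (fun t : ℝ => Real.exp (-c * t ^ 2)) := integrable_exp_neg_mul_sq hc
  have h3 : Integrable (fun w : Fin 3 → ℝ => ∏ i, (if i = 0 then
      (fun t : ℝ => (Real.sqrt |t|)⁻¹ * Real.exp (-c * t ^ 2)) else
      (fun t : ℝ => Real.exp (-c * t ^ 2))) (w i)) := by
    apply Integrable.fintype_prod
    intro i
    split_ifs
    exacts [h1, h2]
  have h4 := ((EuclideanSpace.volume_preserving_symm_measurableEquiv_toLp (Fin 3)).symm).symm.integrable_comp_of_integrable h3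
  refine h4.congr (Filter.Eventually.of_forall fun v => ?_)
  simp only [Function.comp, Fin.prod_univ_three, gw, EuclideanSpace.norm_sq_eq, Fin.sum_univ_three]
  simp [mul_add, Real.exp_add]
  ring

theorem integrable_wt_mul_gw {c : ℝ} (hc : 0 < c) : Integrable (fun v => wt v * gw c v) := by
  refine ((integrable_gw (half_pos hc)).const_mul (1 + 2 / c)).mono'
    (by fun_prop) (Filter.Eventually.of_forall fun v => ?_)
  rw [Real.norm_of_nonneg (mul_nonneg (wt_pos v).le (gw_pos c v).le)]
  exact wt_mul_gw_le hc v

theorem integrable_sqrt_inv_mul_wt_mul_gw {c : ℝ} (hc : 0 < c) :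
    Integrable (fun v : Vel => (Real.sqrt |v 0|)⁻¹ * (wt v * gw c v)) := by
  refine ((integrable_sqrt_inv_mul_gw (half_pos hc)).const_mul (1 + 2 / c)).mono'
    (Measurable.aestronglyMeasurable ?_) (Filter.Eventually.of_forall fun v => ?_)
  · have : Measurable (fun v : Vel => v 0) := (continuous_coord 0).measurable
    have h2 : Measurable wt := continuous_wt.measurable
    have h3 : Measurable (gw c) := (continuous_gw c).measurable
    fun_prop
  · have h0 : 0 ≤ (Real.sqrt |v 0|)⁻¹ := by positivity
    rw [Real.norm_of_nonneg (mul_nonneg h0 (mul_nonneg (wt_pos v).le (gw_pos c v).le))]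
    calc _ ≤ (Real.sqrt |v 0|)⁻¹ * ((1 + 2 / c) * gw (c / 2) v) :=
          mul_le_mul_of_nonneg_left (wt_mul_gw_le hc v) h0
      _ = _ := by ring

/-- A measurable function dominated by an integrable function is integrable. -/
theorem integrable_of_abs_le {f g : Vel → ℝ} (hg : Integrable g)
    (hf : AEStronglyMeasurable f volume) (h : ∀ᵐ v, |f v| ≤ g v) : Integrable f :=
  hg.mono' hf (by simpa using h)

/-! ### Wall Maxwellians and integrals over half spaces. -/

theorem wallMaxwellian_eq (T : ℝ) (v : Vel) : wallMaxwellian T v =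
    gw (1 / (2 * T)) v / ∫ w in posHalf, gw (1 / (2 * T)) w * |w 0| := by
  unfold wallMaxwellian gw
  have : ∀ w : Vel, -(‖w‖ ^ 2 / (2 * T)) = -(1 / (2 * T)) * ‖w‖ ^ 2 := fun w => by ring
  simp_rw [this]

theorem integrable_gw_mul_abs {c : ℝ} (hc : 0 < c) :
    Integrable (fun v : Vel => gw c v * |v 0|) := by
  refine integrable_of_abs_le (integrable_wt_mul_gw hc) (by fun_prop)
    (Filter.Eventually.of_forall fun v => ?_)
  rw [abs_mul, abs_abs, abs_of_pos (gw_pos c v), mul_comm]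
  exact mul_le_mul_of_nonneg_right (abs_coord_le_wt v 0) (gw_pos c v).le

theorem mem_posHalf {v : Vel} : v ∈ posHalf ↔ 0 < v 0 := Iff.rfl

theorem mem_negHalf {v : Vel} : v ∈ negHalf ↔ v 0 < 0 := Iff.rfl

theorem isOpen_posHalf : IsOpen posHalf := isOpen_lt continuous_const (continuous_coord 0)

theorem volume_posHalf_pos : 0 < volume posHalf :=
  isOpen_posHalf.measure_pos _ ⟨EuclideanSpace.single 0 1, by simp [posHalf]⟩

theorem setIntegral_negHalf_eq (g : Vel → ℝ) :
    ∫ v in negHalf, g v = ∫ v in posHalf, g (reflect v) := by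
  rw [← integral_indicator measurableSet_negHalf, ← integral_indicator measurableSet_posHalf,
    ← integral_comp_reflect]
  congr 1; ext v
  by_cases h : v ∈ posHalf
  · rw [indicator_of_mem h, indicator_of_mem (by
      rw [mem_negHalf, reflect_apply_zero]; exact neg_neg_of_pos (mem_posHalf.1 h))]
  · rw [indicator_of_notMem h, indicator_of_notMem (by
      rw [mem_negHalf, reflect_apply_zero, neg_lt_zero]; exact h)]

theorem setIntegral_posHalf_eq (g : Vel → ℝ) :
    ∫ v in posHalf, g v = ∫ v in negHalf, g (reflect v) := by
  rw [setIntegral_negHalf_eq]; simp_rw [reflect_reflect]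

/-- Splitting an integral into the two half spaces. -/
theorem integral_eq_half_add_half {g : Vel → ℝ} (hg : Integrable g) :
    ∫ v, g v = (∫ v in posHalf, g v) + ∫ v in negHalf, g v := by
  rw [← setIntegral_union (by
      rw [Set.disjoint_left]; intro v (h1 : 0 < v 0) (h2 : v 0 < 0); linarith)
    measurableSet_negHalf hg.integrableOn hg.integrableOn, ← setIntegral_univ]
  apply setIntegral_congr_set
  filter_upwards [ae_coord_ne_zero] with v hv
  have : (v ∈ (univ : Set Vel)) ↔ v ∈ posHalf ∪ negHalf := by
    simp only [mem_univ, true_iff, mem_union]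
    rcases lt_or_gt_of_ne hv with h | h
    exacts [Or.inr h, Or.inl h]
  exact propext this

theorem setIntegral_posHalf_pos {g : Vel → ℝ} (hg : Integrable g)
    (hpos : ∀ v ∈ posHalf, 0 < g v) : 0 < ∫ v in posHalf, g v := by
  rw [setIntegral_pos_iff_support_of_nonneg_ae]
  · have : Function.support g ∩ posHalf = posHalf := by
      ext v; simp only [mem_inter_iff, Function.mem_support, and_iff_right_iff_imp]
      exact fun h => (hpos v h).ne'
    rw [this]; exact volume_posHalf_pos
  · exact (ae_restrict_mem measurableSet_posHalf).mono fun v hv => (hpos v hv).le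
  · exact hg.integrableOn

theorem setIntegral_negHalf_pos {g : Vel → ℝ} (hg : Integrable g)
    (hpos : ∀ v ∈ negHalf, 0 < g v) : 0 < ∫ v in negHalf, g v := by
  rw [setIntegral_negHalf_eq]
  refine setIntegral_posHalf_pos (integrable_comp_reflect hg) fun v hv => hpos _ ?_
  rw [mem_negHalf, reflect_apply_zero, neg_lt_zero]; exact hv

theorem wallMaxwellian_norm_pos {T : ℝ} (hT : 0 < T) :
    0 < ∫ w in posHalf, gw (1 / (2 * T)) w * |w 0| :=
  setIntegral_posHalf_pos (integrable_gw_mul_abs (by positivity)) fun v (hv : 0 < v 0) =>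
    mul_pos (gw_pos _ _) (abs_pos.2 hv.ne')

theorem wallMaxwellian_pos {T : ℝ} (hT : 0 < T) (v : Vel) : 0 < wallMaxwellian T v := by
  rw [wallMaxwellian_eq]; exact div_pos (gw_pos _ _) (wallMaxwellian_norm_pos hT)

theorem wallMaxwellian_congr {v w : Vel} (T : ℝ) (h : ‖v‖ = ‖w‖) :
    wallMaxwellian T v = wallMaxwellian T w := by simp [wallMaxwellian, h]

theorem continuous_wallMaxwellian (T : ℝ) : Continuous (wallMaxwellian T) := by
  unfold wallMaxwellian; fun_prop

theorem integrable_wallMaxwellian_mul_abs {T : ℝ} (hT : 0 < T) :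
    Integrable (fun v : Vel => wallMaxwellian T v * |v 0|) := by
  refine ((integrable_gw_mul_abs (c := 1 / (2 * T)) (by positivity)).div_const
    (∫ w in posHalf, gw (1 / (2 * T)) w * |w 0|)).congr (Filter.Eventually.of_forall fun v => ?_)
  simp only [wallMaxwellian_eq]; ring

theorem wallMaxwellian_flux_pos {T : ℝ} (hT : 0 < T) :
    ∫ v in posHalf, wallMaxwellian T v * |v 0| = 1 := by
  simp_rw [wallMaxwellian_eq, div_mul_eq_mul_div]
  rw [integral_div, div_self (wallMaxwellian_norm_pos hT).ne']

theorem wallMaxwellian_flux_neg {T : ℝ} (hT : 0 < T) :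
    ∫ v in negHalf, wallMaxwellian T v * |v 0| = 1 := by
  rw [setIntegral_negHalf_eq, ← wallMaxwellian_flux_pos hT]
  simp_rw [wallMaxwellian_congr T (norm_reflect _), reflect_apply_zero, abs_neg]

theorem glue_of_pos (gL gR : Vel → ℝ) {v : Vel} (h : 0 < v 0) : glue gL gR v = gL v := by
  rw [glue, indicator_of_mem (mem_posHalf.2 h), indicator_of_notMem (fun h' => by
    rw [mem_negHalf] at h'; linarith), add_zero]

theorem glue_of_neg (gL gR : Vel → ℝ) {v : Vel} (h : v 0 < 0) : glue gL gR v = gR v := by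
  rw [glue, indicator_of_mem (mem_negHalf.2 h), indicator_of_notMem (fun h' => by
    rw [mem_posHalf] at h'; linarith), zero_add]

theorem glue_of_zero (gL gR : Vel → ℝ) {v : Vel} (h : v 0 = 0) : glue gL gR v = 0 := by
  rw [glue, indicator_of_notMem (fun h' => by rw [mem_posHalf] at h'; linarith),
    indicator_of_notMem (fun h' => by rw [mem_negHalf] at h'; linarith), add_zero]

section wall

variable {Tw : Fin 2 → ℝ}

theorem wallMw_pos (hTw : ∀ i, 0 < Tw i) {v : Vel} (hv : v 0 ≠ 0) : 0 < wallMw Tw v := by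
  rcases lt_or_gt_of_ne hv with h | h
  · rw [wallMw, glue_of_neg _ _ h]; exact wallMaxwellian_pos (hTw 1) v
  · rw [wallMw, glue_of_pos _ _ h]; exact wallMaxwellian_pos (hTw 0) v

theorem wallMw_nonneg (hTw : ∀ i, 0 < Tw i) (v : Vel) : 0 ≤ wallMw Tw v := by
  by_cases hv : v 0 = 0
  · rw [wallMw, glue_of_zero _ _ hv]
  · exact (wallMw_pos hTw hv).le

theorem measurable_wallMw (Tw : Fin 2 → ℝ) : Measurable (wallMw Tw) := by
  unfold wallMw glue
  exact ((continuous_wallMaxwellian _).measurable.indicator measurableSet_posHalf).add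
    ((continuous_wallMaxwellian _).measurable.indicator measurableSet_negHalf)

theorem exists_wallMw_le (hTw : ∀ i, 0 < Tw i) :
    ∃ c > 0, ∃ C > 0, ∀ v, wallMw Tw v ≤ C * gw c v := by
  have h0 := hTw 0
  have h1 := hTw 1
  have hZ0 := wallMaxwellian_norm_pos h0
  have hZ1 := wallMaxwellian_norm_pos h1
  set Z0 := ∫ w in posHalf, gw (1 / (2 * Tw 0)) w * |w 0|
  set Z1 := ∫ w in posHalf, gw (1 / (2 * Tw 1)) w * |w 0|
  refine ⟨min (1 / (2 * Tw 0)) (1 / (2 * Tw 1)), by positivity, 1 / Z0 + 1 / Z1, by positivity,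
    fun v => ?_⟩
  set c := min (1 / (2 * Tw 0)) (1 / (2 * Tw 1))
  have hg := gw_pos c v
  rw [add_mul]
  have e0 : 0 ≤ 1 / Z0 * gw c v := by positivity
  have e1 : 0 ≤ 1 / Z1 * gw c v := by positivity
  rcases lt_trichotomy (v 0) 0 with h | h | h
  · rw [wallMw, glue_of_neg _ _ h, wallMaxwellian_eq]
    have := gw_anti (min_le_right (1 / (2 * Tw 0)) (1 / (2 * Tw 1))) v
    have : gw (1 / (2 * Tw 1)) v / Z1 ≤ 1 / Z1 * gw c v := by
      rw [div_eq_inv_mul, ← one_div]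
      exact mul_le_mul_of_nonneg_left this (one_div_pos.2 hZ1).le
    linarith
  · rw [wallMw, glue_of_zero _ _ h]; linarith
  · rw [wallMw, glue_of_pos _ _ h, wallMaxwellian_eq]
    have := gw_anti (min_le_left (1 / (2 * Tw 0)) (1 / (2 * Tw 1))) v
    have : gw (1 / (2 * Tw 0)) v / Z0 ≤ 1 / Z0 * gw c v := by
      rw [div_eq_inv_mul, ← one_div]
      exact mul_le_mul_of_nonneg_left this (one_div_pos.2 hZ0).le
    linarith

theorem wallMw_flip {i : Fin 3} (hi : i ≠ 0) (v : Vel) : wallMw Tw (flip i v) = wallMw Tw v := by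
  have h0 : flip i v 0 = v 0 := by rw [flip_apply]; simp [hi.symm]
  have h (T : ℝ) := wallMaxwellian_congr T (norm_flip i v)
  rcases lt_trichotomy (v 0) 0 with hv | hv | hv
  · rw [wallMw, glue_of_neg _ _ hv, glue_of_neg _ _ (h0 ▸ hv), h]
  · rw [wallMw, glue_of_zero _ _ hv, glue_of_zero _ _ (h0 ▸ hv)]
  · rw [wallMw, glue_of_pos _ _ hv, glue_of_pos _ _ (h0 ▸ hv), h]

/-- Functions with at most quadratic growth are integrable against the wall Maxwellian. -/
theorem integrable_wallMw_mul (hTw : ∀ i, 0 < Tw i) {φ : Vel → ℝ} (hφ : Measurable φ)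
    (h : ∀ v, |φ v| ≤ wt v) : Integrable (fun v => wallMw Tw v * φ v) := by
  obtain ⟨c, hc, C, hC, hle⟩ := exists_wallMw_le hTw
  refine integrable_of_abs_le ((integrable_wt_mul_gw hc).const_mul C)
    ((measurable_wallMw Tw).mul hφ).aestronglyMeasurable (Filter.Eventually.of_forall fun v => ?_)
  rw [abs_mul, abs_of_nonneg (wallMw_nonneg hTw v)]
  calc _ ≤ (C * gw c v) * wt v :=
        mul_le_mul (hle v) (h v) (abs_nonneg _) (mul_nonneg hC.le (gw_pos _ _).le)
    _ = _ := by ring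

/-- No parity is available here, as the wall temperatures may differ. The integral vanishes because
both halves are normalized to flux one and enter with opposite signs. -/
theorem integral_wallMw_mul_coord_zero (hTw : ∀ i, 0 < Tw i) :
    ∫ v : Vel, wallMw Tw v * v 0 = 0 := by
  rw [integral_eq_half_add_half (integrable_wallMw_mul hTw (continuous_coord 0).measurable
    fun v => abs_coord_le_wt v 0)]
  have h1 : ∫ v in posHalf, wallMw Tw v * v 0 = ∫ v in posHalf, wallMaxwellian (Tw 0) v * |v 0| :=
    setIntegral_congr_fun measurableSet_posHalf fun v (hv : 0 < v 0) => by
      simp only [wallMw, glue_of_pos _ _ hv, abs_of_pos hv]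
  have h2 : ∫ v in negHalf, wallMw Tw v * v 0
      = ∫ v in negHalf, -(wallMaxwellian (Tw 1) v * |v 0|) :=
    setIntegral_congr_fun measurableSet_negHalf fun v (hv : v 0 < 0) => by
      simp only [wallMw, glue_of_neg _ _ hv, abs_of_neg hv]; ring
  rw [h1, h2, integral_neg, wallMaxwellian_flux_pos (hTw 0), wallMaxwellian_flux_neg (hTw 1)]
  simp

theorem integral_wallMw_mul_abs (hTw : ∀ i, 0 < Tw i) :
    ∫ v : Vel, wallMw Tw v * |v 0| = 2 := by
  rw [integral_eq_half_add_half (integrable_wallMw_mul hTw (continuous_coord 0).measurable.abs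
    fun v => by rw [abs_abs]; exact abs_coord_le_wt v 0)]
  have h1 : ∫ v in posHalf, wallMw Tw v * |v 0| = ∫ v in posHalf, wallMaxwellian (Tw 0) v * |v 0| :=
    setIntegral_congr_fun measurableSet_posHalf fun v (hv : 0 < v 0) => by
      simp only [wallMw, glue_of_pos _ _ hv]
  have h2 : ∫ v in negHalf, wallMw Tw v * |v 0|
      = ∫ v in negHalf, wallMaxwellian (Tw 1) v * |v 0| :=
    setIntegral_congr_fun measurableSet_negHalf fun v (hv : v 0 < 0) => by
      simp only [wallMw, glue_of_neg _ _ hv]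
  rw [h1, h2, wallMaxwellian_flux_pos (hTw 0), wallMaxwellian_flux_neg (hTw 1)]
  norm_num

/-- Integrals that are odd under a flip of a component vanish. -/
theorem integral_eq_zero_of_flip {g : Vel → ℝ} (i : Fin 3) (h : ∀ v, g (flip i v) = -g v) :
    ∫ v, g v = 0 := by
  have h1 := integral_comp_flip i g
  simp_rw [h] at h1
  rw [integral_neg] at h1
  linarith

end wall

/-! ### Moments up to order two. -/

/-- The vector of moments `∫ g v̂ ⊗ v̂` is indexed by pairs, where `v̂ = (1, v₁, v₂, v₃)`. -/
abbrev Moments : Type := Fin 4 → Fin 4 → ℝ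

/-- The extended velocity `v̂ = (1, v₁, v₂, v₃)`. -/
def hat (v : Vel) : Fin 4 → ℝ := Fin.cons 1 v.ofLp

@[simp] theorem hat_zero (v : Vel) : hat v 0 = 1 := rfl

@[simp] theorem hat_succ (v : Vel) (i : Fin 3) : hat v i.succ = v i := rfl

@[fun_prop]
theorem continuous_hat (k : Fin 4) : Continuous (fun v => hat v k) := by
  refine Fin.cases ?_ (fun i => ?_) k
  · simpa using continuous_const
  · simpa using continuous_coord i

theorem abs_hat_mul_hat_le (v : Vel) (k l : Fin 4) : |hat v k * hat v l| ≤ wt v := by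
  have h (i : Fin 3) := abs_coord_le_norm v i
  rw [abs_mul]
  refine Fin.cases ?_ (fun i => ?_) k <;> refine Fin.cases ?_ (fun j => ?_) l
  · simpa using one_le_wt v
  · simpa using abs_coord_le_wt v j
  · simpa using abs_coord_le_wt v i
  · simp only [hat_succ]
    have := mul_le_mul (h i) (h j) (abs_nonneg _) (norm_nonneg _)
    unfold wt; nlinarith

/-- The moments `∫ g v̂ ⊗ v̂` of a distribution function. -/
noncomputable def moments (g : Vel → ℝ) : Moments := fun k l => ∫ v, g v * (hat v k * hat v l)

theorem moments_symm (g : Vel → ℝ) (k l : Fin 4) : moments g k l = moments g l k := by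
  simp only [moments, mul_comm (hat _ k)]

theorem moments_congr {g h : Vel → ℝ} (H : g =ᵐ[volume] h) : moments g = moments h := by
  funext k l
  exact integral_congr_ae (H.mono fun v hv => by simp only [hv])

theorem aestronglyMeasurable_of_mul_wt {g : Vel → ℝ} (hg : Integrable (fun v => g v * wt v)) :
    AEStronglyMeasurable g volume := by
  have h : g = fun v => (g v * wt v) * (wt v)⁻¹ := by
    funext v; rw [mul_inv_cancel_right₀ (wt_pos v).ne']
  rw [h]
  exact hg.aestronglyMeasurable.mul
    (continuous_wt.inv₀ fun v => (wt_pos v).ne').aestronglyMeasurable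

theorem integrable_mul_of_wt {g φ : Vel → ℝ} (hg : Integrable (fun v => g v * wt v))
    (hφ : Measurable φ) {K : ℝ} (h : ∀ v, |φ v| ≤ K * wt v) :
    Integrable (fun v => g v * φ v) := by
  refine integrable_of_abs_le (hg.abs.const_mul K)
    ((aestronglyMeasurable_of_mul_wt hg).mul hφ.aestronglyMeasurable)
    (Filter.Eventually.of_forall fun v => ?_)
  rw [abs_mul, abs_mul, abs_of_pos (wt_pos v)]
  calc _ ≤ |g v| * (K * wt v) := mul_le_mul_of_nonneg_left (h v) (abs_nonneg _)
    _ = _ := by ring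

theorem integrable_mul_hat {g : Vel → ℝ} (hg : Integrable (fun v => g v * wt v)) (k l : Fin 4) :
    Integrable (fun v => g v * (hat v k * hat v l)) :=
  integrable_mul_of_wt hg (by fun_prop : Continuous _).measurable (K := 1)
    fun v => by simpa using abs_hat_mul_hat_le v k l

theorem abs_moments_le {g : Vel → ℝ} (hg : Integrable (fun v => g v * wt v)) (k l : Fin 4) :
    |moments g k l| ≤ ∫ v, |g v| * wt v := by
  refine (abs_integral_le_integral_abs).trans
    (integral_mono_of_nonneg (Filter.Eventually.of_forall fun v => abs_nonneg _) ?_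
      (Filter.Eventually.of_forall fun v => ?_))
  · refine hg.abs.congr (Filter.Eventually.of_forall fun v => ?_)
    simp only [abs_mul, abs_of_pos (wt_pos v)]
  · simp only
    rw [abs_mul]
    exact mul_le_mul_of_nonneg_left (abs_hat_mul_hat_le v k l) (abs_nonneg _)

theorem moments_sub {g h : Vel → ℝ} (hg : Integrable (fun v => g v * wt v))
    (hh : Integrable (fun v => h v * wt v)) :
    moments (fun v => g v - h v) = moments g - moments h := by
  funext k l
  simp only [moments, Pi.sub_apply, sub_mul]
  exact integral_sub (integrable_mul_hat hg k l) (integrable_mul_hat hh k l)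

theorem norm_moments_le {g : Vel → ℝ} (hg : Integrable (fun v => g v * wt v)) :
    ‖moments g‖ ≤ ∫ v, |g v| * wt v := by
  have h0 : 0 ≤ ∫ v, |g v| * wt v :=
    integral_nonneg fun v => mul_nonneg (abs_nonneg _) (wt_pos v).le
  refine (pi_norm_le_iff_of_nonneg h0).2 fun k => (pi_norm_le_iff_of_nonneg h0).2 fun l => ?_
  exact abs_moments_le hg k l

/-! ### Fields as functions of the moments -/

/-- Bulk velocity. -/
noncomputable def momU (m : Moments) (i : Fin 3) : ℝ := m 0 i.succ / m 0 0

/-- Stress tensor. -/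
noncomputable def momCov (m : Moments) (i j : Fin 3) : ℝ :=
  m i.succ j.succ / m 0 0 - momU m i * momU m j

/-- Temperature tensor. -/
noncomputable def momTensor (ν : ℝ) (m : Moments) : Matrix (Fin 3) (Fin 3) ℝ :=
  ((1 - ν) * ((∑ i, momCov m i i) / 3)) • (1 : Matrix (Fin 3) (Fin 3) ℝ) +
    ν • Matrix.of (momCov m)

/-- The ellipsoidal Gaussian with given moments. -/
noncomputable def gaussM (ν : ℝ) (m : Moments) (v : Vel) : ℝ :=
  m 0 0 / Real.sqrt (((2 * Real.pi) • momTensor ν m).det) *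
    Real.exp (-(1 / 2) * quadForm (momTensor ν m)⁻¹ (v - WithLp.toLp 2 (momU m)))

section link

variable {f : ℝ → Vel → ℝ} {x : ℝ}

theorem density_eq : density f x = moments (f x) 0 0 := by simp [density, moments]

theorem bulkVelocity_eq (hf : Integrable (fun v => f x v * wt v)) :
    bulkVelocity f x = WithLp.toLp 2 (momU (moments (f x))) := by
  have hint : Integrable (fun v => f x v • v) := by
    refine (integrable_norm_iff ((aestronglyMeasurable_of_mul_wt hf).smul
      aestronglyMeasurable_id)).1 ?_
    refine (integrable_mul_of_wt hf (φ := fun v => ‖v‖) continuous_norm.measurable (K := 1)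
      fun v => ?_).abs.congr (Filter.Eventually.of_forall fun v => ?_)
    · rw [abs_norm, one_mul]; unfold wt; nlinarith [sq_nonneg (‖v‖ - 1), sq_nonneg ‖v‖]
    · simp [norm_smul, abs_mul]
  ext i
  have h := (EuclideanSpace.proj i : Vel →L[ℝ] ℝ).integral_comp_comm hint
  have h' : (∫ v, f x v • v) i = ∫ v, f x v * v i := by
    simpa using h.symm
  simp only [bulkVelocity, PiLp.smul_apply, smul_eq_mul, momU, density_eq, moments, h', hat_zero,
    hat_succ, one_mul]
  ring

theorem stress_eq (hf : Integrable (fun v => f x v * wt v)) (h0 : density f x ≠ 0) :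
    stress f x = Matrix.of (momCov (moments (f x))) := by
  ext i j
  have hU := bulkVelocity_eq hf
  have hρ := density_eq (f := f) (x := x)
  set m := moments (f x) with hm
  have hi (k : Fin 3) : m 0 k.succ = ∫ v, f x v * v k := by simp [hm, moments]
  have hij : m i.succ j.succ = ∫ v, f x v * (v i * v j) := by simp [hm, moments]
  have h00 : m 0 0 = ∫ v, f x v := by simp [hm, moments]
  have i1 (k : Fin 3) : Integrable (fun v => f x v * v k) := by
    simpa using integrable_mul_hat hf 0 k.succ
  have i2 : Integrable (fun v => f x v * (v i * v j)) := by
    simpa using integrable_mul_hat hf i.succ j.succ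
  have i0 : Integrable (fun v => f x v) := by simpa using integrable_mul_hat hf 0 0
  have e : ∀ v : Vel, f x v * ((v - bulkVelocity f x) i * (v - bulkVelocity f x) j) =
      f x v * (v i * v j) - momU m j * (f x v * v i) - momU m i * (f x v * v j)
        + momU m i * momU m j * f x v := by
    intro v; rw [hU]; simp only [PiLp.sub_apply]; ring
  simp only [stress, Matrix.of_apply, momCov]
  simp_rw [e]
  have ia : Integrable (fun v => f x v * (v i * v j) - momU m j * (f x v * v i)) :=
    i2.sub ((i1 i).const_mul _)
  have ib : Integrable (fun v => f x v * (v i * v j) - momU m j * (f x v * v i)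
      - momU m i * (f x v * v j)) := ia.sub ((i1 j).const_mul _)
  rw [integral_add ib (i0.const_mul _), integral_sub ia ((i1 j).const_mul _),
    integral_sub i2 ((i1 i).const_mul _)]
  simp only [integral_const_mul]
  rw [← hi, ← hi, ← hij, ← h00, hρ]
  rw [hρ] at h0
  simp only [momU]
  field_simp
  ring

theorem temperature_eq (hf : Integrable (fun v => f x v * wt v)) (h0 : density f x ≠ 0) :
    temperature f x = (∑ i, momCov (moments (f x)) i i) / 3 := by
  have hs := stress_eq hf h0
  have h (i : Fin 3) : momCov (moments (f x)) i i = stress f x i i := by rw [hs]; rfl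
  have hint (i : Fin 3) : Integrable (fun v =>
      f x v * ((v - bulkVelocity f x) i * (v - bulkVelocity f x) i)) := by
    refine integrable_mul_of_wt hf (by fun_prop : Continuous _).measurable
      (K := 2 * wt (bulkVelocity f x)) fun v => ?_
    have h1 := abs_coord_le_norm v i
    have h2 := abs_coord_le_norm (bulkVelocity f x) i
    have h3 : v i ^ 2 ≤ ‖v‖ ^ 2 := by rw [← sq_abs]; gcongr
    have h4 : (bulkVelocity f x) i ^ 2 ≤ ‖bulkVelocity f x‖ ^ 2 := by rw [← sq_abs]; gcongr
    rw [abs_mul_self, PiLp.sub_apply]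
    unfold wt
    nlinarith [sq_nonneg (v i + bulkVelocity f x i),
      mul_nonneg (sq_nonneg ‖v‖) (sq_nonneg ‖bulkVelocity f x‖)]
  simp_rw [h, stress, Matrix.of_apply]
  rw [← Finset.mul_sum, ← integral_finsetSum _ fun i _ => hint i, temperature]
  have : ∀ v : Vel, f x v * ‖v - bulkVelocity f x‖ ^ 2 =
      ∑ i, f x v * ((v - bulkVelocity f x) i * (v - bulkVelocity f x) i) := by
    intro v
    rw [EuclideanSpace.norm_sq_eq, ← Finset.mul_sum]
    simp [pow_two]
  simp_rw [this]
  rw [mul_inv]; ring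

theorem tempTensor_eq (ν : ℝ) (hf : Integrable (fun v => f x v * wt v)) (h0 : density f x ≠ 0) :
    tempTensor ν f x = momTensor ν (moments (f x)) := by
  rw [tempTensor, momTensor, stress_eq hf h0, temperature_eq hf h0]

theorem gaussianES_eq (ν : ℝ) (hf : Integrable (fun v => f x v * wt v)) (h0 : density f x ≠ 0)
    (v : Vel) : gaussianES ν f x v = gaussM ν (moments (f x)) v := by
  rw [gaussianES, gaussM, tempTensor_eq ν hf h0, bulkVelocity_eq hf, density_eq]

end link

/-! ### Admissible moments and smoothness of the parameters of the Gaussian. -/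

theorem quadForm_eq_sum (A : Matrix (Fin 3) (Fin 3) ℝ) (κ : Vel) :
    quadForm A κ = ∑ i, ∑ j, κ i * A i j * κ j := by
  simp only [quadForm, dotProduct, Matrix.mulVec, Finset.mul_sum, mul_assoc]

theorem quadForm_smul_vec (A : Matrix (Fin 3) (Fin 3) ℝ) (t : ℝ) (κ : Vel) :
    quadForm A (t • κ) = t ^ 2 * quadForm A κ := by
  simp only [quadForm_eq_sum, Finset.mul_sum, PiLp.smul_apply, smul_eq_mul]
  refine Finset.sum_congr rfl fun i _ => Finset.sum_congr rfl fun j _ => by ring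

/-- Moments with density at least `a`, entries at most `B` and temperature tensor at least `c`. -/
def admissible (ν a B c : ℝ) : Set Moments :=
  {m | (∀ k l, m k l = m l k) ∧ a ≤ m 0 0 ∧ (∀ k l, |m k l| ≤ B) ∧
    ∀ κ : Vel, ‖κ‖ = 1 → c ≤ quadForm (momTensor ν m) κ}

section tensor

variable {ν a B c : ℝ} {m : Moments}

theorem contDiffAt_entry (k l : Fin 4) : ContDiffAt ℝ 1 (fun m : Moments => m k l) m := by
  fun_prop

theorem contDiffAt_momU (h : m 0 0 ≠ 0) (i : Fin 3) : ContDiffAt ℝ 1 (fun m => momU m i) m := by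
  unfold momU
  exact (contDiffAt_entry 0 i.succ).div (contDiffAt_entry 0 0) h

theorem contDiffAt_momCov (h : m 0 0 ≠ 0) (i j : Fin 3) :
    ContDiffAt ℝ 1 (fun m => momCov m i j) m := by
  unfold momCov
  exact ((contDiffAt_entry i.succ j.succ).div (contDiffAt_entry 0 0) h).sub
    ((contDiffAt_momU h i).mul (contDiffAt_momU h j))

theorem contDiffAt_momTensor (ν : ℝ) (h : m 0 0 ≠ 0) (i j : Fin 3) :
    ContDiffAt ℝ 1 (fun m => momTensor ν m i j) m := by
  simp only [momTensor, Matrix.add_apply, Matrix.smul_apply, Matrix.of_apply, smul_eq_mul]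
  have h1 := contDiffAt_momCov h i j
  have h2 : ContDiffAt ℝ 1 (fun m : Moments => ∑ i, momCov m i i) m :=
    ContDiffAt.sum fun i _ => contDiffAt_momCov h i i
  exact ((contDiffAt_const.mul (h2.div_const 3)).mul contDiffAt_const).add
    (contDiffAt_const.mul h1)

theorem contDiffAt_quadForm (ν : ℝ) (h : m 0 0 ≠ 0) (κ : Vel) :
    ContDiffAt ℝ 1 (fun m => quadForm (momTensor ν m) κ) m := by
  simp only [quadForm_eq_sum]
  exact ContDiffAt.sum fun i _ => ContDiffAt.sum fun j _ =>
    (contDiffAt_const.mul (contDiffAt_momTensor ν h i j)).mul contDiffAt_const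

theorem momTensor_symm (ν : ℝ) (hm : ∀ k l, m k l = m l k) (i j : Fin 3) :
    momTensor ν m i j = momTensor ν m j i := by
  simp only [momTensor, Matrix.add_apply, Matrix.smul_apply, Matrix.of_apply, smul_eq_mul, momCov,
    Matrix.one_apply, hm i.succ j.succ, mul_comm (momU m i), eq_comm]

theorem le_quadForm_of_unit {A : Matrix (Fin 3) (Fin 3) ℝ}
    (h : ∀ κ : Vel, ‖κ‖ = 1 → c ≤ quadForm A κ) (w : Vel) : c * ‖w‖ ^ 2 ≤ quadForm A w := by
  by_cases hw : w = 0
  · subst hw; simp [quadForm_eq_sum]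
  · have hn : 0 < ‖w‖ := norm_pos_iff.2 hw
    have h1 := h (‖w‖⁻¹ • w) (by rw [norm_smul, norm_inv, norm_norm, inv_mul_cancel₀ hn.ne'])
    rw [quadForm_smul_vec] at h1
    have h2 := mul_le_mul_of_nonneg_right h1 (sq_nonneg ‖w‖)
    have h3 : (‖w‖⁻¹ ^ 2 * quadForm A w) * ‖w‖ ^ 2 = quadForm A w := by field_simp
    linarith

theorem posDef_of_admissible (hc : 0 < c) (hm : m ∈ admissible ν a B c) :
    (momTensor ν m).PosDef := by
  obtain ⟨hs, -, -, hq⟩ := hm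
  refine Matrix.PosDef.of_dotProduct_mulVec_pos ?_ fun x hx => ?_
  · ext i j; simpa using momTensor_symm ν hs j i
  · have h := le_quadForm_of_unit hq (WithLp.toLp 2 x)
    have hn : 0 < ‖(WithLp.toLp 2 x : Vel)‖ := norm_pos_iff.2 (by simpa using hx)
    have : 0 < quadForm (momTensor ν m) (WithLp.toLp 2 x) := lt_of_lt_of_le (by positivity) h
    simpa [quadForm] using this

/-- The inverse of a positive matrix bounded by `Λ` is bounded below by `Λ⁻¹`. -/
theorem quadForm_inv_ge {A : Matrix (Fin 3) (Fin 3) ℝ} (hA : A.PosDef) {Λ : ℝ} (hΛ : 0 < Λ)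
    (hle : ∀ w : Vel, quadForm A w ≤ Λ * ‖w‖ ^ 2) (w : Vel) :
    ‖w‖ ^ 2 / Λ ≤ quadForm A⁻¹ w := by
  have hdet : IsUnit A.det := hA.det_pos.ne'.isUnit
  have hsymm : Aᵀ = A := by simpa using hA.isHermitian.eq
  set y : Fin 3 → ℝ := A⁻¹ *ᵥ w.ofLp with hy
  have hAy : A *ᵥ y = w.ofLp := by
    rw [hy, Matrix.mulVec_mulVec, Matrix.mul_nonsing_inv _ hdet, Matrix.one_mulVec]
  -- Test vector: expanding (y - u)·A(y - u) ≥ 0 with Ay = w gives y·w ≥ 2 u·w - u·Au, and u = w/Λ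
  -- makes the right side at least |w|²/Λ.
  set u : Fin 3 → ℝ := Λ⁻¹ • w.ofLp with hu
  have h1 : 0 ≤ (y - u) ⬝ᵥ (A *ᵥ (y - u)) := by
    simpa using hA.posSemidef.dotProduct_mulVec_nonneg (y - u)
  have h2 : (y - u) ⬝ᵥ (A *ᵥ (y - u)) =
      y ⬝ᵥ w.ofLp - 2 * (u ⬝ᵥ w.ofLp) + u ⬝ᵥ (A *ᵥ u) := by
    have h3 : y ⬝ᵥ (A *ᵥ u) = u ⬝ᵥ w.ofLp := by
      rw [Matrix.dotProduct_mulVec, ← Matrix.mulVec_transpose, hsymm, hAy, dotProduct_comm]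
    rw [Matrix.mulVec_sub, sub_dotProduct, dotProduct_sub, dotProduct_sub, hAy, h3]; ring
  have h4 : quadForm A⁻¹ w = y ⬝ᵥ w.ofLp := by rw [quadForm, ← hy, dotProduct_comm]
  have h5 : u ⬝ᵥ w.ofLp = ‖w‖ ^ 2 / Λ := by
    rw [hu, smul_dotProduct, EuclideanSpace.norm_sq_eq, dotProduct, smul_eq_mul]
    simp only [Real.norm_eq_abs, sq_abs, ← pow_two]; ring
  have h6 : u ⬝ᵥ (A *ᵥ u) ≤ ‖w‖ ^ 2 / Λ := by
    have h7 := hle (Λ⁻¹ • w)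
    have h8 : quadForm A (Λ⁻¹ • w) = u ⬝ᵥ (A *ᵥ u) := rfl
    rw [h8, norm_smul, mul_pow, norm_inv, Real.norm_of_nonneg hΛ.le] at h7
    calc _ ≤ _ := h7
      _ = _ := by field_simp
  rw [h4]; linarith

/-- The temperature tensor is continuous only where the density does not vanish. The condition on it
is therefore closed relative to the closed set defined by the other conditions, on which the density
is at least a. -/
theorem isClosed_admissible (ha : 0 < a) : IsClosed (admissible ν a B c) := by
  have h1 : IsClosed {m : Moments | (∀ k l, m k l = m l k) ∧ a ≤ m 0 0 ∧ ∀ k l, |m k l| ≤ B} := by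
    simp only [ofPred_and, ofPred_forall]
    refine IsClosed.inter ?_ (IsClosed.inter ?_ ?_)
    · exact isClosed_iInter fun k => isClosed_iInter fun l =>
        isClosed_eq (by fun_prop) (by fun_prop)
    · exact isClosed_le continuous_const (by fun_prop)
    · exact isClosed_iInter fun k => isClosed_iInter fun l =>
        isClosed_le (by fun_prop) continuous_const
  have h2 : admissible ν a B c = ⋂ κ : {κ : Vel // ‖κ‖ = 1},
      ({m : Moments | (∀ k l, m k l = m l k) ∧ a ≤ m 0 0 ∧ ∀ k l, |m k l| ≤ B} ∩
        (fun m => quadForm (momTensor ν m) κ) ⁻¹' Ici c) := by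
    ext m
    simp only [admissible, mem_ofPred_eq, mem_iInter, mem_inter_iff, mem_preimage, mem_Ici]
    constructor
    · rintro ⟨h1, h2, h3, h4⟩ κ
      exact ⟨⟨h1, h2, h3⟩, h4 κ κ.2⟩
    · intro h
      -- The intersection over unit vectors recovers the conditions free of κ only because a unit
      -- vector exists.
      have h0 := (h ⟨EuclideanSpace.single 0 1, by simp⟩).1
      exact ⟨h0.1, h0.2.1, h0.2.2, fun κ hκ => (h ⟨κ, hκ⟩).2⟩
  rw [h2]
  refine isClosed_iInter fun κ => ContinuousOn.preimage_isClosed_of_isClosed ?_ h1 isClosed_Ici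
  intro m hm
  have h0 : m 0 0 ≠ 0 := (ha.trans_le hm.2.1).ne'
  exact (contDiffAt_quadForm ν h0 κ).continuousAt.continuousWithinAt

theorem isCompact_admissible (ha : 0 < a) : IsCompact (admissible ν a B c) := by
  refine Metric.isCompact_of_isClosed_isBounded (isClosed_admissible ha) ?_
  refine (Metric.isBounded_closedBall (x := (0 : Moments)) (r := |B|)).subset fun m hm => ?_
  rw [mem_closedBall_zero_iff]
  exact (pi_norm_le_iff_of_nonneg (abs_nonneg _)).2 fun k =>
    (pi_norm_le_iff_of_nonneg (abs_nonneg _)).2 fun l => (hm.2.2.1 k l).trans (le_abs_self _)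

/-- The prefactor of the ellipsoidal Gaussian. -/
noncomputable def momPre (ν : ℝ) (m : Moments) : ℝ :=
  m 0 0 / Real.sqrt (((2 * Real.pi) • momTensor ν m).det)

theorem contDiffAt_det (ν : ℝ) (h : m 0 0 ≠ 0) :
    ContDiffAt ℝ 1 (fun m => (momTensor ν m).det) m := by
  have e (i j : Fin 3) := contDiffAt_momTensor ν h i j
  simp only [Matrix.det_fin_three]
  have (i j k l p q : Fin 3) : ContDiffAt ℝ 1
      (fun m => momTensor ν m i j * momTensor ν m k l * momTensor ν m p q) m :=
    ((e i j).mul (e k l)).mul (e p q)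
  exact (((((this _ _ _ _ _ _).sub (this _ _ _ _ _ _)).sub (this _ _ _ _ _ _)).add
    (this _ _ _ _ _ _)).add (this _ _ _ _ _ _)).sub (this _ _ _ _ _ _)

theorem contDiffAt_inv (ν : ℝ) (h : m 0 0 ≠ 0) (hd : (momTensor ν m).det ≠ 0) (i j : Fin 3) :
    ContDiffAt ℝ 1 (fun m => (momTensor ν m)⁻¹ i j) m := by
  have e (i j : Fin 3) := contDiffAt_momTensor ν h i j
  simp only [Matrix.inv_def, Ring.inverse_eq_inv', Matrix.smul_apply, smul_eq_mul]
  refine ((contDiffAt_det ν h).inv hd).mul ?_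
  have h2 (i j k l p q r s : Fin 3) : ContDiffAt ℝ 1 (fun m =>
      momTensor ν m i j * momTensor ν m k l - momTensor ν m p q * momTensor ν m r s) m :=
    ((e _ _).mul (e _ _)).sub ((e _ _).mul (e _ _))
  have h3 (i j k l p q r s : Fin 3) : ContDiffAt ℝ 1 (fun m =>
      -(momTensor ν m i j * momTensor ν m k l) + momTensor ν m p q * momTensor ν m r s) m :=
    ((e _ _).mul (e _ _)).neg.add ((e _ _).mul (e _ _))
  simp only [Matrix.adjugate_fin_three]
  fin_cases i <;> fin_cases j <;> first | exact h2 _ _ _ _ _ _ _ _ | exact h3 _ _ _ _ _ _ _ _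

theorem contDiffAt_momPre (ν : ℝ) (h : m 0 0 ≠ 0) (hd : 0 < (momTensor ν m).det) :
    ContDiffAt ℝ 1 (momPre ν) m := by
  unfold momPre
  simp only [Matrix.det_smul, Fintype.card_fin]
  have hp : 0 < (2 * Real.pi) ^ 3 * (momTensor ν m).det := by positivity
  refine (contDiffAt_entry 0 0).div ?_ (Real.sqrt_pos.2 hp).ne'
  exact (contDiffAt_const.mul (contDiffAt_det ν h)).sqrt hp.ne'

/-- Prefactor, mean and inverse covariance of the ellipsoidal Gaussian. -/
noncomputable def gaussParam (ν : ℝ) (m : Moments) :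
    ℝ × (Fin 3 → ℝ) × (Fin 3 → Fin 3 → ℝ) :=
  (momPre ν m, momU m, fun i j => (momTensor ν m)⁻¹ i j)

theorem contDiffAt_gaussParam (ha : 0 < a) (hc : 0 < c) (hm : m ∈ admissible ν a B c) :
    ContDiffAt ℝ 1 (gaussParam ν) m := by
  have h0 : m 0 0 ≠ 0 := (ha.trans_le hm.2.1).ne'
  have hd := (posDef_of_admissible hc hm).det_pos
  exact (contDiffAt_momPre ν h0 hd).prodMk ((contDiffAt_pi.2 fun i => contDiffAt_momU h0 i).prodMk
    (contDiffAt_pi.2 fun i => contDiffAt_pi.2 fun j => contDiffAt_inv ν h0 hd.ne' i j))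

/-- The set of admissible moments need not be convex, so the mean value inequality is not at hand.
Local Lipschitz bounds from C¹ regularity become a global one by compactness. -/
theorem exists_lipschitz_gaussParam (ha : 0 < a) (hc : 0 < c) :
    ∃ K, LipschitzOnWith K (gaussParam ν) (admissible ν a B c) := by
  refine LocallyLipschitzOn.exists_lipschitzOnWith_of_compact (isCompact_admissible ha) ?_
  intro m hm
  obtain ⟨K, t, ht, hK⟩ := (contDiffAt_gaussParam ha hc hm).exists_lipschitzOnWith
  exact ⟨K, t, mem_nhdsWithin_of_mem_nhds ht, hK⟩

end tensor

/-! ### Domination and Lipschitz dependence of the Gaussian. -/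

/-- `|e^{-s} - e^{-t}| ≤ |s - t| e^{-r}` when `s, t ≥ r`. -/
theorem abs_exp_neg_sub_le {s t r : ℝ} (hs : r ≤ s) (ht : r ≤ t) :
    |Real.exp (-s) - Real.exp (-t)| ≤ |s - t| * Real.exp (-r) := by
  wlog h : s ≤ t generalizing s t
  · rw [abs_sub_comm, abs_sub_comm s]; exact this ht hs (le_of_not_ge h)
  have h1 : Real.exp (-t) ≤ Real.exp (-s) := Real.exp_le_exp.2 (by linarith)
  have h2 : Real.exp (-t) = Real.exp (-s) * Real.exp (-(t - s)) := by
    rw [← Real.exp_add]; ring_nf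
  have h3 := Real.add_one_le_exp (-(t - s))
  have h4 : Real.exp (-s) ≤ Real.exp (-r) := Real.exp_le_exp.2 (by linarith)
  rw [abs_of_nonneg (by linarith), abs_sub_comm, abs_of_nonneg (by linarith : 0 ≤ t - s)]
  calc Real.exp (-s) - Real.exp (-t) = Real.exp (-s) * (1 - Real.exp (-(t - s))) := by rw [h2]; ring
    _ ≤ Real.exp (-s) * (t - s) :=
        mul_le_mul_of_nonneg_left (by linarith) (Real.exp_pos _).le
    _ ≤ Real.exp (-r) * (t - s) := mul_le_mul_of_nonneg_right h4 (by linarith)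
    _ = _ := by ring

section gauss

variable {ν a B c : ℝ}

theorem gaussM_eq (ν : ℝ) (m : Moments) (v : Vel) : gaussM ν m v = momPre ν m *
    Real.exp (-(1 / 2 * quadForm (momTensor ν m)⁻¹ (v - WithLp.toLp 2 (momU m)))) := by
  rw [gaussM, momPre, neg_mul]

theorem gaussM_nonneg {m : Moments} (h : 0 ≤ m 0 0) (v : Vel) : 0 ≤ gaussM ν m v := by
  unfold gaussM; positivity

/-- Bounds for the parameters of the Gaussian on the admissible set. -/
theorem exists_gaussParam_bound (ha : 0 < a) (hc : 0 < c) :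
    ∃ M : ℝ, 0 < M ∧ ∀ m ∈ admissible ν a B c, |momPre ν m| ≤ M ∧ (∀ i, |momU m i| ≤ M) ∧
      (∀ i j, |(momTensor ν m)⁻¹ i j| ≤ M) ∧ ∀ i j, |momTensor ν m i j| ≤ M := by
  obtain ⟨M1, hM1⟩ := (isCompact_admissible (ν := ν) (B := B) (c := c) ha).exists_bound_of_continuousOn
    (f := gaussParam ν) fun m hm =>
      (contDiffAt_gaussParam ha hc hm).continuousAt.continuousWithinAt
  obtain ⟨M2, hM2⟩ := (isCompact_admissible (ν := ν) (B := B) (c := c) ha).exists_bound_of_continuousOn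
    (f := fun m => (fun i j => momTensor ν m i j : Fin 3 → Fin 3 → ℝ)) fun m hm =>
      (contDiffAt_pi.2 fun i => contDiffAt_pi.2 fun j =>
        contDiffAt_momTensor ν (ha.trans_le hm.2.1).ne' i j).continuousAt.continuousWithinAt
  refine ⟨max 1 (max M1 M2), by positivity, fun m hm => ?_⟩
  have h1 := hM1 m hm
  have h2 := hM2 m hm
  have l1 : M1 ≤ max 1 (max M1 M2) := (le_max_left _ _).trans (le_max_right _ _)
  have l2 : M2 ≤ max 1 (max M1 M2) := (le_max_right _ _).trans (le_max_right _ _)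
  have h3 := (norm_fst_le (gaussParam ν m)).trans h1
  have h4 := (norm_snd_le (gaussParam ν m)).trans h1
  have h5 := (norm_fst_le (gaussParam ν m).2).trans h4
  have h6 := (norm_snd_le (gaussParam ν m).2).trans h4
  refine ⟨h3.trans l1, fun i => ((norm_le_pi_norm _ i).trans h5).trans l1,
    fun i j => (((norm_le_pi_norm ((gaussParam ν m).2.2 i) j).trans
      (norm_le_pi_norm (gaussParam ν m).2.2 i)).trans h6).trans l1,
    fun i j => ?_⟩
  exact (((norm_le_pi_norm (fun j => momTensor ν m i j) j).trans
    (norm_le_pi_norm (fun i j => momTensor ν m i j) i)).trans h2).trans l2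

theorem quadForm_le_of_abs_le {A : Matrix (Fin 3) (Fin 3) ℝ} {M : ℝ} (h : ∀ i j, |A i j| ≤ M)
    (w : Vel) : |quadForm A w| ≤ 9 * M * ‖w‖ ^ 2 := by
  rw [quadForm_eq_sum]
  have h1 (i j : Fin 3) : |w i * A i j * w j| ≤ M * ‖w‖ ^ 2 := by
    rw [abs_mul, abs_mul]
    have h2 := abs_coord_le_norm w i
    have h3 := abs_coord_le_norm w j
    have hM : 0 ≤ M := (abs_nonneg _).trans (h 0 0)
    calc _ ≤ ‖w‖ * M * ‖w‖ := by gcongr; exact h i j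
      _ = _ := by ring
  calc _ ≤ ∑ i, ∑ j, |w i * A i j * w j| :=
        (Finset.abs_sum_le_sum_abs _ _).trans
          (Finset.sum_le_sum fun i _ => Finset.abs_sum_le_sum_abs _ _)
    _ ≤ ∑ i : Fin 3, ∑ j : Fin 3, M * ‖w‖ ^ 2 :=
        Finset.sum_le_sum fun i _ => Finset.sum_le_sum fun j _ => h1 i j
    _ = _ := by simp; ring

/-- Lipschitz dependence of `(v - U) ⬝ Q (v - U)` on `U` and `Q`. -/
theorem abs_quadForm_sub_le {Q Q' : Matrix (Fin 3) (Fin 3) ℝ} {U U' : Fin 3 → ℝ} {M δ : ℝ}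
    (hM : 0 < M) (hQ : ∀ i j, |Q i j| ≤ M) (hQ' : ∀ i j, |Q' i j| ≤ M)
    (hU : ∀ i, |U i| ≤ M) (hU' : ∀ i, |U' i| ≤ M)
    (dU : ∀ i, |U i - U' i| ≤ δ) (dQ : ∀ i j, |Q i j - Q' i j| ≤ δ) (v : Vel) :
    |quadForm Q (v - WithLp.toLp 2 U) - quadForm Q' (v - WithLp.toLp 2 U')| ≤
      9 * (4 * (M + 1) ^ 2) * δ * wt v := by
  have hδ : 0 ≤ δ := (abs_nonneg _).trans (dU 0)
  rw [quadForm_eq_sum, quadForm_eq_sum, ← Finset.sum_sub_distrib]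
  simp_rw [← Finset.sum_sub_distrib]
  have hw : wt v = 1 + ‖v‖ ^ 2 := rfl
  have hn := norm_nonneg v
  have key (i j : Fin 3) :
      |(v - WithLp.toLp 2 U) i * Q i j * (v - WithLp.toLp 2 U) j -
        (v - WithLp.toLp 2 U') i * Q' i j * (v - WithLp.toLp 2 U') j| ≤
        4 * (M + 1) ^ 2 * δ * wt v := by
    simp only [PiLp.sub_apply]
    set s := ‖v‖ + M
    have b (i : Fin 3) : |v i - U i| ≤ s :=
      (abs_sub _ _).trans (add_le_add (abs_coord_le_norm v i) (hU i))
    have b' (i : Fin 3) : |v i - U' i| ≤ s :=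
      (abs_sub _ _).trans (add_le_add (abs_coord_le_norm v i) (hU' i))
    have hs : 0 ≤ s := by positivity
    -- Telescoping: the three factors are exchanged one at a time.
    have e : (v i - U i) * Q i j * (v j - U j) - (v i - U' i) * Q' i j * (v j - U' j) =
        -(U i - U' i) * Q i j * (v j - U j) + (v i - U' i) * (Q i j - Q' i j) * (v j - U j)
          + (v i - U' i) * Q' i j * (-(U j - U' j)) := by ring
    rw [e]
    have t1 : |-(U i - U' i) * Q i j * (v j - U j)| ≤ δ * M * s := by
      rw [abs_mul, abs_mul, abs_neg]
      exact mul_le_mul (mul_le_mul (dU i) (hQ i j) (abs_nonneg _) hδ) (b j) (abs_nonneg _)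
        (by positivity)
    have t2 : |(v i - U' i) * (Q i j - Q' i j) * (v j - U j)| ≤ s * δ * s := by
      rw [abs_mul, abs_mul]
      exact mul_le_mul (mul_le_mul (b' i) (dQ i j) (abs_nonneg _) hs) (b j) (abs_nonneg _)
        (by positivity)
    have t3 : |(v i - U' i) * Q' i j * (-(U j - U' j))| ≤ s * M * δ := by
      rw [abs_mul, abs_mul, abs_neg]
      exact mul_le_mul (mul_le_mul (b' i) (hQ' i j) (abs_nonneg _) hs) (dU j) (abs_nonneg _)
        (by positivity)
    have t4 := (abs_add_le (-(U i - U' i) * Q i j * (v j - U j) +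
      (v i - U' i) * (Q i j - Q' i j) * (v j - U j)) ((v i - U' i) * Q' i j * (-(U j - U' j))))
    have t5 := (abs_add_le (-(U i - U' i) * Q i j * (v j - U j))
      ((v i - U' i) * (Q i j - Q' i j) * (v j - U j)))
    have t6 : s ^ 2 + 2 * M * s ≤ 4 * (M + 1) ^ 2 * wt v := by
      rw [hw]
      have e1 : (s : ℝ) = ‖v‖ + M := rfl
      rw [e1]
      nlinarith [sq_nonneg (‖v‖ - 1), mul_nonneg hM.le (sq_nonneg (‖v‖ - 1)),
        mul_nonneg hM.le hn, mul_nonneg hM.le (sq_nonneg ‖v‖),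
        mul_nonneg (mul_nonneg hM.le hM.le) (sq_nonneg ‖v‖)]
    calc _ ≤ δ * M * s + s * δ * s + s * M * δ := by linarith
      _ = δ * (s ^ 2 + 2 * M * s) := by ring
      _ ≤ δ * (4 * (M + 1) ^ 2 * wt v) := mul_le_mul_of_nonneg_left t6 hδ
      _ = _ := by ring
  calc _ ≤ ∑ i : Fin 3, ∑ j : Fin 3, 4 * (M + 1) ^ 2 * δ * wt v :=
        (Finset.abs_sum_le_sum_abs _ _).trans
          (Finset.sum_le_sum fun i _ => (Finset.abs_sum_le_sum_abs _ _).trans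
            (Finset.sum_le_sum fun j _ => key i j))
    _ = _ := by simp; ring

/-- On the admissible set the ellipsoidal Gaussian is bounded by a fixed radial Gaussian and
depends on the moments in a Lipschitz way, with a radial Gaussian as Lipschitz constant. -/
theorem exists_gaussM_bounds (ν B : ℝ) (ha : 0 < a) (hc : 0 < c) :
    ∃ c' > 0, ∃ C > 0, (∀ m ∈ admissible ν a B c, ∀ v, gaussM ν m v ≤ C * gw c' v) ∧
      ∀ m ∈ admissible ν a B c, ∀ m' ∈ admissible ν a B c, ∀ v,
        |gaussM ν m v - gaussM ν m' v| ≤ C * ‖m - m'‖ * gw c' v := by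
  obtain ⟨M, hM, hb⟩ := exists_gaussParam_bound (ν := ν) (B := B) ha hc
  obtain ⟨K, hK⟩ := exists_lipschitz_gaussParam (ν := ν) (B := B) ha hc
  -- Nine entries of size at most M bound the quadratic form of the temperature tensor by 9M|w|².
  set Λ := 9 * M with hΛ
  have hΛ0 : 0 < Λ := by positivity
  -- The exponent is controlled uniformly in m: the inverse tensor is at least 1/Λ, and |v - U|² ≥
  -- |v|²/2 - |U|² with |U|² ≤ 3M² removes the dependence on the mean.
  have lower : ∀ m ∈ admissible ν a B c, ∀ v : Vel, 1 / (4 * Λ) * ‖v‖ ^ 2 - 3 * M ^ 2 / (2 * Λ) ≤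
      1 / 2 * quadForm (momTensor ν m)⁻¹ (v - WithLp.toLp 2 (momU m)) := by
    intro m hm v
    obtain ⟨-, hU, -, hA⟩ := hb m hm
    have h1 := quadForm_inv_ge (posDef_of_admissible hc hm) hΛ0
      (fun w => (le_abs_self _).trans (quadForm_le_of_abs_le hA w)) (v - WithLp.toLp 2 (momU m))
    have h2 : ‖(WithLp.toLp 2 (momU m) : Vel)‖ ^ 2 ≤ 3 * M ^ 2 := by
      rw [EuclideanSpace.norm_sq_eq]
      calc _ ≤ ∑ i : Fin 3, M ^ 2 := Finset.sum_le_sum fun i _ => by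
            have := hU i
            simp only [Real.norm_eq_abs]; gcongr
        _ = _ := by simp
    have h3 : ‖v‖ ^ 2 / 2 - 3 * M ^ 2 ≤ ‖v - WithLp.toLp 2 (momU m)‖ ^ 2 := by
      have h4 : ‖v‖ ≤ ‖v - WithLp.toLp 2 (momU m)‖ + ‖(WithLp.toLp 2 (momU m) : Vel)‖ := by
        simpa using norm_add_le (v - WithLp.toLp 2 (momU m)) (WithLp.toLp 2 (momU m))
      have h5 := pow_le_pow_left₀ (norm_nonneg v) h4 2
      nlinarith [sq_nonneg (‖v - WithLp.toLp 2 (momU m)‖ - ‖(WithLp.toLp 2 (momU m) : Vel)‖)]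
    have h6 : (‖v‖ ^ 2 / 2 - 3 * M ^ 2) / Λ ≤ ‖v - WithLp.toLp 2 (momU m)‖ ^ 2 / Λ := by gcongr
    calc _ = 1 / 2 * ((‖v‖ ^ 2 / 2 - 3 * M ^ 2) / Λ) := by field_simp; ring
      _ ≤ _ := by linarith
  set c1 := 1 / (4 * Λ) with hc1
  have hc1p : 0 < c1 := by positivity
  set E := Real.exp (3 * M ^ 2 / (2 * Λ)) with hE
  have hE1 : ∀ v : Vel, Real.exp (-(c1 * ‖v‖ ^ 2 - 3 * M ^ 2 / (2 * Λ))) = E * gw c1 v := by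
    intro v; rw [hE, gw, ← Real.exp_add]; ring_nf
  have hE0 : 0 < E := Real.exp_pos _
  set N := 18 * (M + 1) ^ 2 with hN
  set W := 1 + 2 / c1 with hW
  have hW0 : 0 < W := by positivity
  have hg2 : ∀ v : Vel, gw c1 v ≤ gw (c1 / 2) v := fun v => gw_anti (by linarith) v
  -- The three summands of the constant come from the size of the Gaussian, the change of its
  -- prefactor and the change of its exponent. The last produces a quadratic weight, whose
  -- absorption costs half the decay rate and the factor W.
  refine ⟨c1 / 2, by positivity, M * E + (K + 1) * E + M * N * (K + 1) * E * W, by positivity,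
    fun m hm v => ?_, fun m hm m' hm' v => ?_⟩
  · have hp := (hb m hm).1
    have h1 : gaussM ν m v ≤ M * (E * gw c1 v) := by
      rw [gaussM_eq, ← hE1]
      refine mul_le_mul ((le_abs_self _).trans hp) (Real.exp_le_exp.2 ?_) (Real.exp_pos _).le hM.le
      have := lower m hm v
      linarith
    calc _ ≤ _ := h1
      _ ≤ M * (E * gw (c1 / 2) v) := by gcongr; exact hg2 v
      _ = (M * E) * gw (c1 / 2) v := by ring
      _ ≤ _ := by
        have := gw_pos (c1 / 2) v
        gcongr
        have : 0 ≤ (K + 1 : ℝ) * E + M * N * (K + 1) * E * W := by positivity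
        linarith
  · obtain ⟨hp, hU, hQ, -⟩ := hb m hm
    obtain ⟨hp', hU', hQ', -⟩ := hb m' hm'
    have hd := hK.dist_le_mul m hm m' hm'
    rw [dist_eq_norm, dist_eq_norm] at hd
    set δ := (K + 1 : ℝ) * ‖m - m'‖ with hδ
    have hδ0 : 0 ≤ δ := by positivity
    have hd' : ‖gaussParam ν m - gaussParam ν m'‖ ≤ δ := by
      rw [hδ]; nlinarith [norm_nonneg (m - m')]
    have d1 : |momPre ν m - momPre ν m'| ≤ δ := (norm_fst_le (gaussParam ν m - gaussParam ν m')).trans hd'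
    have d2 := (norm_snd_le (gaussParam ν m - gaussParam ν m')).trans hd'
    have d3 := (norm_fst_le (gaussParam ν m - gaussParam ν m').2).trans d2
    have d4 := (norm_snd_le (gaussParam ν m - gaussParam ν m').2).trans d2
    have dU (i) : |momU m i - momU m' i| ≤ δ :=
      (norm_le_pi_norm (gaussParam ν m - gaussParam ν m').2.1 i).trans d3
    have dQ (i j) : |(momTensor ν m)⁻¹ i j - (momTensor ν m')⁻¹ i j| ≤ δ :=
      ((norm_le_pi_norm ((gaussParam ν m - gaussParam ν m').2.2 i) j).trans
        (norm_le_pi_norm (gaussParam ν m - gaussParam ν m').2.2 i)).trans d4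
    have hq := abs_quadForm_sub_le hM hQ hQ' hU hU' dU dQ v
    have l1 := lower m hm v
    have l2 := lower m' hm' v
    rw [gaussM_eq, gaussM_eq]
    set q := quadForm (momTensor ν m)⁻¹ (v - WithLp.toLp 2 (momU m))
    set q' := quadForm (momTensor ν m')⁻¹ (v - WithLp.toLp 2 (momU m'))
    set p := momPre ν m
    set p' := momPre ν m'
    have e1 := abs_exp_neg_sub_le l1 l2
    rw [hE1] at e1
    have e2 : Real.exp (-(1 / 2 * q)) ≤ E * gw c1 v := by
      rw [← hE1]; exact Real.exp_le_exp.2 (by linarith)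
    have e3 : |1 / 2 * q - 1 / 2 * q'| ≤ N * δ * wt v := by
      rw [← mul_sub, abs_mul, abs_of_pos (by norm_num : (0 : ℝ) < 1 / 2), hN]
      linarith
    have hg := gw_pos c1 v
    have e4 : |p * Real.exp (-(1 / 2 * q)) - p' * Real.exp (-(1 / 2 * q'))| ≤
        δ * (E * gw c1 v) + M * (N * δ * wt v * (E * gw c1 v)) := by
      have : p * Real.exp (-(1 / 2 * q)) - p' * Real.exp (-(1 / 2 * q')) =
        (p - p') * Real.exp (-(1 / 2 * q)) +
          p' * (Real.exp (-(1 / 2 * q)) - Real.exp (-(1 / 2 * q'))) := by ring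
      rw [this]
      refine (abs_add_le _ _).trans (add_le_add ?_ ?_)
      · rw [abs_mul, Real.abs_exp]
        exact mul_le_mul d1 e2 (Real.exp_pos _).le hδ0
      · rw [abs_mul]
        refine mul_le_mul hp' (e1.trans ?_) (abs_nonneg _) hM.le
        exact mul_le_mul_of_nonneg_right e3 (by positivity)
    have e5 := wt_mul_gw_le hc1p v
    have hg' := gw_pos (c1 / 2) v
    calc _ ≤ _ := e4
      _ = δ * E * gw c1 v + M * N * δ * E * (wt v * gw c1 v) := by ring
      _ ≤ δ * E * gw (c1 / 2) v + M * N * δ * E * (W * gw (c1 / 2) v) := by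
          have := hg2 v
          gcongr
      _ = ((K + 1) * E + M * N * (K + 1) * E * W) * ‖m - m'‖ * gw (c1 / 2) v := by
          rw [hδ]; ring
      _ ≤ _ := by
          gcongr
          have : 0 ≤ M * E := by positivity
          linarith

/-- The Gaussian is one explicit continuous expression in v and its parameters, and the parameters
are C¹ in the moments. Both the measurability of the truncated source and its continuity along
characteristics rest on this. -/
theorem continuousOn_gaussM (ha : 0 < a) (hc : 0 < c) :
    ContinuousOn (fun p : Moments × Vel => gaussM ν p.1 p.2) (admissible ν a B c ×ˢ univ) := by
  have h : ∀ p : Moments × Vel, gaussM ν p.1 p.2 = (gaussParam ν p.1).1 *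
      Real.exp (-(1 / 2 * ∑ i, ∑ j, (p.2 i - (gaussParam ν p.1).2.1 i) *
        (gaussParam ν p.1).2.2 i j * (p.2 j - (gaussParam ν p.1).2.1 j))) := by
    intro p
    rw [gaussM_eq, quadForm_eq_sum]; rfl
  simp_rw [h]
  have h2 : ContinuousOn (fun p : Moments × Vel => gaussParam ν p.1)
      (admissible ν a B c ×ˢ univ) := by
    refine ContinuousOn.comp (t := admissible ν a B c) (g := gaussParam ν) (fun m hm =>
      (contDiffAt_gaussParam ha hc hm).continuousAt.continuousWithinAt) continuousOn_fst
      (fun p hp => hp.1)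
  have key (G : Moments × Vel → ℝ × (Fin 3 → ℝ) × (Fin 3 → Fin 3 → ℝ)) (s : Set (Moments × Vel))
      (hG : ContinuousOn G s) : ContinuousOn (fun p => (G p).1 *
      Real.exp (-(1 / 2 * ∑ i, ∑ j, (p.2 i - (G p).2.1 i) * (G p).2.2 i j *
        (p.2 j - (G p).2.1 j)))) s := by fun_prop
  exact key _ _ h2

end gauss

/-! ### Mass of the ellipsoidal Gaussian. -/

open scoped MatrixOrder in
/-- The ellipsoidal Gaussian integral. -/
theorem integral_exp_quadForm_inv {A : Matrix (Fin 3) (Fin 3) ℝ} (hA : A.PosDef) :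
    ∫ v : Vel, Real.exp (-(1 / 2) * quadForm A⁻¹ v) =
      Real.sqrt (((2 * Real.pi) • A).det) := by
  -- With this factorization the substitution w = Sv makes the integrand radial, with Jacobian |det
  -- S|⁻¹ = √(det A).
  obtain ⟨S, hS⟩ : ∃ S : Matrix (Fin 3) (Fin 3) ℝ, A⁻¹ = Sᵀ * S := by
    obtain ⟨S, hS⟩ := CStarAlgebra.nonneg_iff_eq_star_mul_self.1 hA.inv.posSemidef.nonneg
    exact ⟨S, by simpa [Matrix.star_eq_conjTranspose] using hS⟩
  have hdet : S.det ^ 2 = A.det⁻¹ := by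
    have := congrArg Matrix.det hS
    rw [Matrix.det_mul, Matrix.det_transpose, Matrix.det_nonsing_inv, Ring.inverse_eq_inv'] at this
    rw [this, pow_two]
  have hA0 := hA.det_pos
  have hS0 : S.det ≠ 0 := by
    intro h
    rw [h] at hdet
    have : 0 < A.det⁻¹ := inv_pos.2 hA0
    simp at hdet; linarith [hdet]
  set L : Vel →ₗ[ℝ] Vel := Matrix.toLpLin 2 2 S with hL
  have hLdet : LinearMap.det L = S.det := LinearMap.det_toLpLin 2 S
  have hq : ∀ v : Vel, quadForm A⁻¹ v = ‖L v‖ ^ 2 := by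
    intro v
    rw [quadForm, hS, ← Matrix.mulVec_mulVec, Matrix.dotProduct_mulVec, Matrix.vecMul_transpose,
      EuclideanSpace.norm_sq_eq, dotProduct]
    simp [hL, Matrix.toLpLin_apply, pow_two]
  have hmap := Measure.map_linearMap_addHaar_eq_smul_addHaar (volume : Measure Vel) (f := L)
    (by rw [hLdet]; exact hS0)
  have hLc : Continuous L := L.continuous_of_finiteDimensional
  have h1 : ∫ v : Vel, Real.exp (-(1 / 2) * quadForm A⁻¹ v) =
      ∫ w, Real.exp (-(1 / 2) * ‖w‖ ^ 2) ∂(Measure.map L volume) := by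
    rw [integral_map hLc.measurable.aemeasurable (by fun_prop)]
    simp_rw [hq]
  rw [h1, hmap, integral_smul_measure, GaussianFourier.integral_rexp_neg_mul_sq_norm (by norm_num),
    hLdet, ENNReal.toReal_ofReal (abs_nonneg _), Matrix.det_smul]
  simp only [finrank_euclideanSpace, Fintype.card_fin, smul_eq_mul]
  have h2 : |S.det⁻¹| = Real.sqrt A.det := by
    rw [← Real.sqrt_sq_eq_abs, inv_pow, hdet, inv_inv]
  have h3 : (Real.pi / (1 / 2)) ^ (((3 : ℕ) : ℝ) / 2) = Real.sqrt ((2 * Real.pi) ^ 3) := by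
    rw [Real.sqrt_eq_rpow, ← Real.rpow_natCast, ← Real.rpow_mul (by positivity)]
    congr 1
    · ring
    · norm_num
  rw [h2, h3, mul_comm, Real.sqrt_mul (by positivity)]

/-- The ellipsoidal Gaussian carries the prescribed mass. -/
theorem integral_gaussM {ν a B c : ℝ} (hc : 0 < c) {m : Moments} (hm : m ∈ admissible ν a B c) :
    ∫ v, gaussM ν m v = m 0 0 := by
  have hA := posDef_of_admissible hc hm
  simp only [gaussM]
  rw [integral_const_mul, integral_sub_right_eq_self
    (fun v => Real.exp (-(1 / 2) * quadForm (momTensor ν m)⁻¹ v)), integral_exp_quadForm_inv hA]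
  refine div_mul_cancel₀ _ (Real.sqrt_pos.2 ?_).ne'
  rw [Matrix.det_smul]
  have := hA.det_pos
  positivity

/-! ### Scalar relaxation along one characteristic. -/

/-- The solution at `x` of `u' = z (q - u)`, `u(0) = b`. -/
noncomputable def core (z b : ℝ) (q : ℝ → ℝ) (x : ℝ) : ℝ :=
  Real.exp (-(x * z)) * b + z * ∫ y in (0 : ℝ)..x, Real.exp (-((x - y) * z)) * q y

section core

variable {z b G : ℝ} {q : ℝ → ℝ} {x : ℝ}

theorem intervalIntegrable_exp_mul (z : ℝ) (hq : Measurable q) (hG : ∀ y, |q y| ≤ G)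
    (x s t : ℝ) :
    IntervalIntegrable (fun y => Real.exp (-((x - y) * z)) * q y) volume s t := by
  have hqi : IntervalIntegrable q volume s t :=
    (intervalIntegrable_const (c := G)).mono_fun hq.aestronglyMeasurable
      (Filter.Eventually.of_forall fun y => by
        simpa using (hG y).trans (le_abs_self G))
  exact hqi.continuousOn_mul (by fun_prop)

theorem core_zero_right : core z b q 0 = b := by simp [core]

theorem core_split (z b : ℝ) (q : ℝ → ℝ) (x : ℝ) :
    core z b q x = Real.exp (-(x * z)) * b + core z 0 q x := by simp [core]

theorem core_sub {b' G' : ℝ} {q' : ℝ → ℝ} (hq : Measurable q) (hG : ∀ y, |q y| ≤ G)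
    (hq' : Measurable q') (hG' : ∀ y, |q' y| ≤ G') :
    core z (b - b') (fun y => q y - q' y) x = core z b q x - core z b' q' x := by
  simp only [core, mul_sub]
  rw [intervalIntegral.integral_sub (intervalIntegrable_exp_mul z hq hG x 0 x)
    (intervalIntegrable_exp_mul z hq' hG' x 0 x)]
  ring

theorem core_nonneg (hz : 0 ≤ z) (hb : 0 ≤ b) (hq : ∀ y, 0 ≤ q y) (hx : 0 ≤ x) :
    0 ≤ core z b q x := by
  refine add_nonneg (by positivity) (mul_nonneg hz (intervalIntegral.integral_nonneg hx ?_))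
  intro y _
  have := hq y
  positivity

theorem mul_integral_exp (z x : ℝ) :
    z * ∫ y in (0 : ℝ)..x, Real.exp (-((x - y) * z)) = 1 - Real.exp (-(x * z)) := by
  have h (y : ℝ) : HasDerivAt (fun y => Real.exp (-((x - y) * z)))
      (z * Real.exp (-((x - y) * z))) y := by
    have h1 : HasDerivAt (fun y : ℝ => -((x - y) * z)) z y := by
      have := (((hasDerivAt_id' y).const_sub x).mul_const z).fun_neg
      simpa using this
    simpa [mul_comm] using h1.exp
  rw [← intervalIntegral.integral_const_mul]
  rw [intervalIntegral.integral_eq_sub_of_hasDerivAt (fun y _ => h y)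
    ((by fun_prop : Continuous fun y => z * Real.exp (-((x - y) * z))).intervalIntegrable _ _)]
  simp

theorem core_const (z b x : ℝ) : core z b (fun _ => b) x = b := by
  rw [core, intervalIntegral.integral_mul_const, ← mul_assoc, mul_integral_exp]; ring

/-- If z ≥ 1 the left side is below 1 ≤ √z; otherwise 1 - e^{-xz} ≤ xz ≤ z ≤ √z. With z = 1/(τ|v₁|)
the linear bound would give a non-integrable singularity, while the square root is integrable and
still yields a factor τ^{-1/2}. -/
theorem one_sub_exp_le_sqrt (hz : 0 ≤ z) (hx : x ∈ Icc (0 : ℝ) 1) :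
    1 - Real.exp (-(x * z)) ≤ Real.sqrt z := by
  by_cases h : 1 ≤ z
  · have := Real.exp_pos (-(x * z))
    have : 1 ≤ Real.sqrt z := Real.one_le_sqrt.2 h
    linarith
  · have h1 := Real.add_one_le_exp (-(x * z))
    have h2 : x * z ≤ z := by nlinarith [hx.2]
    have h3 : z ≤ Real.sqrt z := by
      apply Real.le_sqrt_of_sq_le; nlinarith
    linarith

theorem abs_core_zero_le (hz : 0 ≤ z) (hG : ∀ y, |q y| ≤ G) (hx : x ∈ Icc (0 : ℝ) 1) :
    |core z 0 q x| ≤ Real.sqrt z * G := by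
  have hG0 : 0 ≤ G := (abs_nonneg _).trans (hG 0)
  have h1 : |∫ y in (0 : ℝ)..x, Real.exp (-((x - y) * z)) * q y| ≤
      ∫ y in (0 : ℝ)..x, Real.exp (-((x - y) * z)) * G := by
    rw [← Real.norm_eq_abs]
    refine intervalIntegral.norm_integral_le_of_norm_le hx.1
      (Filter.Eventually.of_forall fun y _ => ?_)
      ((by fun_prop : Continuous fun y => Real.exp (-((x - y) * z)) * G).intervalIntegrable _ _)
    rw [norm_mul, Real.norm_eq_abs, Real.norm_eq_abs, Real.abs_exp]
    exact mul_le_mul_of_nonneg_left (hG y) (Real.exp_pos _).le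
  rw [core, mul_zero, zero_add, abs_mul, abs_of_nonneg hz]
  calc _ ≤ z * ∫ y in (0 : ℝ)..x, Real.exp (-((x - y) * z)) * G := by gcongr
    _ = (1 - Real.exp (-(x * z))) * G := by
      rw [intervalIntegral.integral_mul_const, ← mul_assoc, mul_integral_exp]
    _ ≤ _ := mul_le_mul_of_nonneg_right (one_sub_exp_le_sqrt hz hx) hG0

theorem abs_core_le (hz : 0 ≤ z) (hG : ∀ y, |q y| ≤ G) (hx : x ∈ Icc (0 : ℝ) 1) :
    |core z b q x| ≤ |b| + Real.sqrt z * G := by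
  rw [core_split]
  refine (abs_add_le _ _).trans (add_le_add ?_ (abs_core_zero_le hz hG hx))
  rw [abs_mul, Real.abs_exp]
  have : Real.exp (-(x * z)) ≤ 1 := by
    rw [Real.exp_le_one_iff]; nlinarith [hx.1]
  exact mul_le_of_le_one_left (abs_nonneg _) this

/-- Pulling out e^{-xz} frees the integrand from x, so that continuity and differentiability in x
follow from those of a primitive. -/
theorem core_eq_primitive (z b : ℝ) (q : ℝ → ℝ) (x : ℝ) : core z b q x =
    Real.exp (-(x * z)) * (b + z * ∫ y in (0 : ℝ)..x, Real.exp (-((0 - y) * z)) * q y) := by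
  have : ∀ y, Real.exp (-((x - y) * z)) * q y
      = Real.exp (-(x * z)) * (Real.exp (-((0 - y) * z)) * q y) := by
    intro y; rw [← mul_assoc, ← Real.exp_add]; ring_nf
  simp_rw [core, this]
  rw [intervalIntegral.integral_const_mul]; ring

theorem continuous_core (hq : Measurable q) (hG : ∀ y, |q y| ≤ G) : Continuous (core z b q) := by
  have h : core z b q = fun x => Real.exp (-(x * z)) *
      (b + z * ∫ y in (0 : ℝ)..x, Real.exp (-((0 - y) * z)) * q y) :=
    funext fun x => core_eq_primitive z b q x
  rw [h]
  have h2 : Continuous (fun x => ∫ y in (0 : ℝ)..x, Real.exp (-((0 - y) * z)) * q y) :=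
    intervalIntegral.continuous_primitive
      (fun s t => intervalIntegrable_exp_mul z hq hG 0 s t) 0
  fun_prop

/-- This is u' = z(q - u) integrated over [0,1]. It expresses the exit value through the collision
term and leads to the flux balances. -/
theorem core_balance (z b : ℝ) (hq : Continuous q) :
    core z b q 1 = b + z * ∫ y in (0 : ℝ)..1, (q y - core z b q y) := by
  have hc : Continuous fun y => Real.exp (-((0 - y) * z)) * q y := by fun_prop
  have hd (x : ℝ) : HasDerivAt (core z b q) (z * (q x - core z b q x)) x := by
    have h : core z b q = fun x => Real.exp (-(x * z)) *
        (b + z * ∫ y in (0 : ℝ)..x, Real.exp (-((0 - y) * z)) * q y) :=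
      funext fun x => core_eq_primitive z b q x
    have h1 : HasDerivAt (fun x => ∫ y in (0 : ℝ)..x, Real.exp (-((0 - y) * z)) * q y)
        (Real.exp (-((0 - x) * z)) * q x) x := hc.integral_hasStrictDerivAt 0 x |>.hasDerivAt
    have h2 : HasDerivAt (fun x => Real.exp (-(x * z))) (Real.exp (-(x * z)) * (-z)) x := by
      have := ((hasDerivAt_id' x).mul_const z).fun_neg
      simpa using this.exp
    have h3 := h2.mul ((h1.const_mul z).const_add b)
    rw [core_eq_primitive, h]
    refine h3.congr_deriv ?_
    have : Real.exp (-(x * z)) * Real.exp (-((0 - x) * z)) = 1 := by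
      rw [← Real.exp_add]; simp
    linear_combination (z * q x) * this
  have hcont : Continuous (core z b q) := continuous_iff_continuousAt.2 fun x => (hd x).continuousAt
  have := intervalIntegral.integral_eq_sub_of_hasDerivAt (a := (0 : ℝ)) (b := 1)
    (fun x _ => hd x) ((continuous_const.mul (hq.sub hcont)).intervalIntegrable _ _)
  rw [intervalIntegral.integral_const_mul, core_zero_right] at this
  linarith

end core

/-- An integral with variable endpoints is an integral over the whole line of a jointly measurable
indicator, to which measurability of parameter integrals applies. -/
theorem measurable_core_param {α : Type*} [MeasurableSpace α] {z p : α → ℝ} {q : α → ℝ → ℝ}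
    (hz : Measurable z) (hp : Measurable p) (hq : Measurable (Function.uncurry q)) :
    Measurable (fun a => core (z a) 0 (q a) (p a)) := by
  have key (s t : α → ℝ) (hs : Measurable s) (ht : Measurable t) : Measurable
      (fun a => ∫ y in Ioc (s a) (t a), Real.exp (-((p a - y) * z a)) * q a y) := by
    have h : ∀ a, ∫ y in Ioc (s a) (t a), Real.exp (-((p a - y) * z a)) * q a y =
        ∫ y, {r : α × ℝ | s r.1 < r.2 ∧ r.2 ≤ t r.1}.indicator
          (fun r => Real.exp (-((p r.1 - r.2) * z r.1)) * q r.1 r.2) (a, y) := by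
      intro a
      rw [← integral_indicator measurableSet_Ioc]
      rfl
    simp_rw [h]
    refine StronglyMeasurable.measurable (StronglyMeasurable.integral_prod_right'
      (f := {r : α × ℝ | s r.1 < r.2 ∧ r.2 ≤ t r.1}.indicator
          (fun r => Real.exp (-((p r.1 - r.2) * z r.1)) * q r.1 r.2)) (ν := volume) ?_)
    refine (Measurable.indicator ?_ ?_).stronglyMeasurable
    · exact (((hp.comp measurable_fst).sub measurable_snd).mul
        (hz.comp measurable_fst)).neg.exp.mul hq
    · exact (measurableSet_lt (hs.comp measurable_fst) measurable_snd).inter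
        (measurableSet_le measurable_snd (ht.comp measurable_fst))
  simp only [core, mul_zero, zero_add, intervalIntegral]
  exact hz.mul ((key _ _ measurable_const hp).sub (key _ _ hp measurable_const))

/-! ### The transport problem with given source -/

/-- The inverse Knudsen length `1 / (τ |v₁|)` of a characteristic. -/
noncomputable def rate (τ : ℝ) (v : Vel) : ℝ := 1 / (τ * |v 0|)

/-- The source along the characteristic, from its entrance. -/
noncomputable def orient (Q : ℝ → Vel → ℝ) (v : Vel) (y : ℝ) : ℝ :=
  if 0 < v 0 then Q y v else Q (1 - y) v

/-- The distance to the entrance. -/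
noncomputable def depth (x : ℝ) (v : Vel) : ℝ := if 0 < v 0 then x else 1 - x

/-- The contribution of the source at the exit. -/
noncomputable def exitSource (τ : ℝ) (Q : ℝ → Vel → ℝ) (v : Vel) : ℝ :=
  core (rate τ v) 0 (orient Q v) 1

/-- The incoming trace, for the boundary condition `f_in = h + δ₃ (f_out ∘ reflect)`. -/
noncomputable def inflow (τ δ₃ : ℝ) (h : Vel → ℝ) (Q : ℝ → Vel → ℝ) (v : Vel) : ℝ :=
  (h v + δ₃ * exitSource τ Q (reflect v) +
    δ₃ * Real.exp (-rate τ v) * (h (reflect v) + δ₃ * exitSource τ Q v)) /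
    (1 - (δ₃ * Real.exp (-rate τ v)) ^ 2)

/-- The solution of `τ v₁ ∂ₓ f = Q - f` with boundary condition `f_in = h + δ₃ (f_out ∘ reflect)`. -/
noncomputable def profile (τ δ₃ : ℝ) (h : Vel → ℝ) (Q : ℝ → Vel → ℝ) (x : ℝ) (v : Vel) : ℝ :=
  core (rate τ v) (inflow τ δ₃ h Q v) (orient Q v) (depth x v)

section profile

variable {τ δ₃ : ℝ} {h : Vel → ℝ} {Q : ℝ → Vel → ℝ}

theorem rate_reflect (τ : ℝ) (v : Vel) : rate τ (reflect v) = rate τ v := by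
  simp [rate, reflect_apply_zero]

theorem rate_nonneg (hτ : 0 < τ) (v : Vel) : 0 ≤ rate τ v := by unfold rate; positivity

theorem sqrt_rate (hτ : 0 < τ) (v : Vel) :
    Real.sqrt (rate τ v) = (Real.sqrt τ)⁻¹ * (Real.sqrt |v 0|)⁻¹ := by
  rw [rate, one_div, Real.sqrt_inv, Real.sqrt_mul hτ.le, mul_inv]

theorem depth_mem {x : ℝ} (hx : x ∈ Icc (0 : ℝ) 1) (v : Vel) : depth x v ∈ Icc (0 : ℝ) 1 := by
  unfold depth
  split_ifs
  · exact hx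
  · exact ⟨by linarith [hx.2], by linarith [hx.1]⟩

theorem measurable_orient (hQ : Measurable (Function.uncurry Q)) (v : Vel) :
    Measurable (orient Q v) := by
  unfold orient
  split_ifs
  · exact hQ.comp (measurable_id.prodMk measurable_const)
  · exact hQ.comp ((measurable_const.sub measurable_id).prodMk measurable_const)

theorem abs_orient_le {G : Vel → ℝ} (hG : ∀ y v, |Q y v| ≤ G v) (v : Vel) (y : ℝ) :
    |orient Q v y| ≤ G v := by
  unfold orient; split_ifs <;> exact hG _ _

/-- The right side is the determinant of the 2×2 system linking the incoming traces at v and at its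
reflection, e being the attenuation of one crossing. Keeping δ₃ away from 1 makes the system
invertible uniformly in τ and v. -/
theorem denom_pos {e : ℝ} {d : ℝ} (hd : 0 < d) (h0 : 0 ≤ δ₃) (h1 : δ₃ ≤ 1 - d) (he0 : 0 ≤ e)
    (he1 : e ≤ 1) : d ≤ 1 - (δ₃ * e) ^ 2 := by
  have h2 : δ₃ * e ≤ 1 - d := by nlinarith
  have h3 : 0 ≤ δ₃ * e := by positivity
  nlinarith

theorem exp_neg_rate_le (hτ : 0 < τ) (v : Vel) : Real.exp (-rate τ v) ≤ 1 := by
  rw [Real.exp_le_one_iff]; linarith [rate_nonneg hτ v]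

/-- The reflection relation satisfied by the incoming trace. -/
theorem inflow_eq {d : ℝ} (hτ : 0 < τ) (hd : 0 < d) (h0 : 0 ≤ δ₃) (h1 : δ₃ ≤ 1 - d) (v : Vel) :
    inflow τ δ₃ h Q v = h v + δ₃ * (Real.exp (-rate τ v) * inflow τ δ₃ h Q (reflect v) +
      exitSource τ Q (reflect v)) := by
  have hD := denom_pos hd h0 h1 (Real.exp_pos (-rate τ v)).le (exp_neg_rate_le hτ v)
  have hD' : 1 - (δ₃ * Real.exp (-rate τ v)) ^ 2 ≠ 0 := by linarith
  simp only [inflow, rate_reflect, reflect_reflect]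
  rw [div_eq_iff hD']
  linear_combination (-(δ₃ * Real.exp (-rate τ v))) * div_mul_cancel₀ (h (reflect v) +
    δ₃ * exitSource τ Q v + δ₃ * Real.exp (-rate τ v) * (h v + δ₃ * exitSource τ Q (reflect v))) hD'

/-- The reflection relation determines the incoming trace. -/
theorem eq_inflow {d : ℝ} (hτ : 0 < τ) (hd : 0 < d) (h0 : 0 ≤ δ₃) (h1 : δ₃ ≤ 1 - d) {v : Vel}
    {b b' : ℝ} (hb : b = h v + δ₃ * (Real.exp (-rate τ v) * b' + exitSource τ Q (reflect v)))
    (hb' : b' = h (reflect v) + δ₃ * (Real.exp (-rate τ v) * b + exitSource τ Q v)) :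
    b = inflow τ δ₃ h Q v := by
  have hD := denom_pos hd h0 h1 (Real.exp_pos (-rate τ v)).le (exp_neg_rate_le hτ v)
  have hD' : 1 - (δ₃ * Real.exp (-rate τ v)) ^ 2 ≠ 0 := by linarith
  rw [inflow, eq_div_iff hD']
  subst hb'
  linear_combination hb

theorem inflow_sub {h' : Vel → ℝ} {Q' : ℝ → Vel → ℝ} {G G' : Vel → ℝ}
    (hQ : Measurable (Function.uncurry Q)) (hG : ∀ y v, |Q y v| ≤ G v)
    (hQ' : Measurable (Function.uncurry Q')) (hG' : ∀ y v, |Q' y v| ≤ G' v) (v : Vel) :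
    inflow τ δ₃ (fun v => h v - h' v) (fun y v => Q y v - Q' y v) v =
      inflow τ δ₃ h Q v - inflow τ δ₃ h' Q' v := by
  have e (w : Vel) : exitSource τ (fun y v => Q y v - Q' y v) w =
      exitSource τ Q w - exitSource τ Q' w := by
    have : orient (fun y v => Q y v - Q' y v) w = fun y => orient Q w y - orient Q' w y := by
      funext y; unfold orient; split_ifs <;> rfl
    have h2 := core_sub (z := rate τ w) (b := 0) (b' := 0) (x := 1) (measurable_orient hQ w)
      (abs_orient_le hG w) (measurable_orient hQ' w) (abs_orient_le hG' w)
    rw [sub_zero] at h2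
    rw [exitSource, this, h2]; rfl
  simp only [inflow, e]
  ring

/-- The transport problem is linear in wall term and source, so differences of solutions obey the
same size estimates as solutions. The bounds on the sources make the integrals along characteristics
exist. -/
theorem profile_sub {h' : Vel → ℝ} {Q' : ℝ → Vel → ℝ} {G G' : Vel → ℝ}
    (hQ : Measurable (Function.uncurry Q)) (hG : ∀ y v, |Q y v| ≤ G v)
    (hQ' : Measurable (Function.uncurry Q')) (hG' : ∀ y v, |Q' y v| ≤ G' v) (x : ℝ) (v : Vel) :
    profile τ δ₃ (fun v => h v - h' v) (fun y v => Q y v - Q' y v) x v =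
      profile τ δ₃ h Q x v - profile τ δ₃ h' Q' x v := by
  have : orient (fun y v => Q y v - Q' y v) v = fun y => orient Q v y - orient Q' v y := by
    funext y; unfold orient; split_ifs <;> rfl
  rw [profile, this, inflow_sub hQ hG hQ' hG', core_sub (measurable_orient hQ v)
    (abs_orient_le hG v) (measurable_orient hQ' v) (abs_orient_le hG' v)]
  rfl

theorem abs_exitSource_le {G : Vel → ℝ} (hτ : 0 < τ) (hG : ∀ y v, |Q y v| ≤ G v) (v : Vel) :
    |exitSource τ Q v| ≤ Real.sqrt (rate τ v) * G v :=
  abs_core_zero_le (rate_nonneg hτ v) (abs_orient_le hG v) ⟨zero_le_one, le_rfl⟩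

/-- Cramer's rule with determinant at least d and coefficients at most 1. A majorant invariant under
reflection lets the two exit sources share one bound. -/
theorem abs_inflow_le {G : Vel → ℝ} {d : ℝ} (hτ : 0 < τ) (hd : 0 < d) (h0 : 0 ≤ δ₃)
    (h1 : δ₃ ≤ 1 - d) (hG : ∀ y v, |Q y v| ≤ G v) (hGr : ∀ v, G (reflect v) = G v) (v : Vel) :
    |inflow τ δ₃ h Q v| ≤ d⁻¹ * (|h v| + |h (reflect v)| + 2 * (Real.sqrt (rate τ v) * G v)) := by
  have he0 := (Real.exp_pos (-rate τ v)).le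
  have he1 := exp_neg_rate_le hτ v
  have hD := denom_pos hd h0 h1 he0 he1
  have hδ : δ₃ ≤ 1 := by linarith
  have hδe : δ₃ * Real.exp (-rate τ v) ≤ 1 := mul_le_one₀ hδ he0 he1
  have hδe0 : 0 ≤ δ₃ * Real.exp (-rate τ v) := by positivity
  have j1 := abs_exitSource_le hτ hG v
  have j2 := abs_exitSource_le hτ hG (reflect v)
  rw [rate_reflect, hGr] at j2
  have hDpos : 0 < 1 - (δ₃ * Real.exp (-rate τ v)) ^ 2 := by linarith
  rw [inflow, abs_div, abs_of_pos hDpos, div_eq_inv_mul]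
  have n1 : |h v + δ₃ * exitSource τ Q (reflect v) +
    δ₃ * Real.exp (-rate τ v) * (h (reflect v) + δ₃ * exitSource τ Q v)| ≤
      |h v| + |h (reflect v)| + 2 * (Real.sqrt (rate τ v) * G v) := by
    have a1 : |δ₃ * exitSource τ Q (reflect v)| ≤ Real.sqrt (rate τ v) * G v := by
      rw [abs_mul, abs_of_nonneg h0]
      exact (mul_le_of_le_one_left (abs_nonneg _) hδ).trans j2
    have a2 : |δ₃ * exitSource τ Q v| ≤ Real.sqrt (rate τ v) * G v := by
      rw [abs_mul, abs_of_nonneg h0]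
      exact (mul_le_of_le_one_left (abs_nonneg _) hδ).trans j1
    have a3 : |δ₃ * Real.exp (-rate τ v) * (h (reflect v) + δ₃ * exitSource τ Q v)| ≤
        |h (reflect v)| + Real.sqrt (rate τ v) * G v := by
      rw [abs_mul, abs_of_nonneg hδe0]
      exact (mul_le_of_le_one_left (abs_nonneg _) hδe).trans
        ((abs_add_le _ _).trans (add_le_add_right a2 _))
    have := abs_add_le (h v + δ₃ * exitSource τ Q (reflect v))
      (δ₃ * Real.exp (-rate τ v) * (h (reflect v) + δ₃ * exitSource τ Q v))
    have := abs_add_le (h v) (δ₃ * exitSource τ Q (reflect v))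
    linarith
  exact mul_le_mul (inv_anti₀ hd hD) n1 (abs_nonneg _) (by positivity)

theorem abs_profile_le {G : Vel → ℝ} {d : ℝ} (hτ : 0 < τ) (hd : 0 < d) (h0 : 0 ≤ δ₃)
    (h1 : δ₃ ≤ 1 - d) (hG : ∀ y v, |Q y v| ≤ G v) (hGr : ∀ v, G (reflect v) = G v) {x : ℝ}
    (hx : x ∈ Icc (0 : ℝ) 1) (v : Vel) :
    |profile τ δ₃ h Q x v| ≤ d⁻¹ * (|h v| + |h (reflect v)|) +
      (2 * d⁻¹ + 1) * (Real.sqrt (rate τ v) * G v) := by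
  have h2 := abs_core_le (b := inflow τ δ₃ h Q v) (rate_nonneg hτ v) (abs_orient_le hG v)
    (depth_mem hx v)
  have h3 := abs_inflow_le (h := h) hτ hd h0 h1 hG hGr v
  unfold profile
  linarith

theorem profile_nonneg {d : ℝ} (hτ : 0 < τ) (hd : 0 < d) (h0 : 0 ≤ δ₃)
    (h1 : δ₃ ≤ 1 - d) (hQ : ∀ y v, 0 ≤ Q y v) {x : ℝ} (hx : x ∈ Icc (0 : ℝ) 1) {v : Vel}
    (hv : 0 ≤ h v) (hv' : 0 ≤ h (reflect v)) : 0 ≤ profile τ δ₃ h Q x v := by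
  have ho (w : Vel) (y : ℝ) : 0 ≤ orient Q w y := by unfold orient; split_ifs <;> exact hQ _ _
  have he (w : Vel) : 0 ≤ exitSource τ Q w :=
    core_nonneg (rate_nonneg hτ w) le_rfl (ho w) zero_le_one
  have hD := denom_pos hd h0 h1 (Real.exp_pos (-rate τ v)).le (exp_neg_rate_le hτ v)
  have e1 := he v
  have e2 := he (reflect v)
  refine core_nonneg (rate_nonneg hτ v) ?_ (ho v) (depth_mem hx v).1
  exact div_nonneg (by positivity) (by linarith)

/-- A function which satisfies the reflection relation is a solution for the source equal to
itself. -/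
theorem profile_const {d : ℝ} (hτ : 0 < τ) (hd : 0 < d) (h0 : 0 ≤ δ₃)
    (h1 : δ₃ ≤ 1 - d) {g : Vel → ℝ} (hg : ∀ v, g v = h v + δ₃ * g (reflect v)) (x : ℝ) (v : Vel) :
    profile τ δ₃ h (fun _ => g) x v = g v := by
  have ho (w : Vel) : orient (fun _ => g) w = fun _ => g w := by
    funext y; unfold orient; split_ifs <;> rfl
  have he (w : Vel) : Real.exp (-rate τ w) * g w + exitSource τ (fun _ => g) w = g w := by
    have := core_const (rate τ w) (g w) 1
    rw [core_split, one_mul] at this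
    rw [exitSource, ho]; exact this
  have e1 := he v
  have e2 := he (reflect v)
  rw [rate_reflect] at e2
  have hb : g v = inflow τ δ₃ h (fun _ => g) v := by
    refine eq_inflow (b' := g (reflect v)) hτ hd h0 h1 ?_ ?_
    · rw [e2]; exact hg v
    · rw [e1]; simpa [reflect_reflect] using hg (reflect v)
  rw [profile, ← hb, ho, core_const]

theorem continuous_profile {G : Vel → ℝ} (hQ : Measurable (Function.uncurry Q))
    (hG : ∀ y v, |Q y v| ≤ G v) (v : Vel) : Continuous (fun x => profile τ δ₃ h Q x v) := by
  have h2 := continuous_core (z := rate τ v) (b := inflow τ δ₃ h Q v) (measurable_orient hQ v)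
    (abs_orient_le hG v)
  have h3 : Continuous (fun x => depth x v) := by
    unfold depth; split_ifs <;> fun_prop
  exact h2.comp h3

theorem measurable_rate (τ : ℝ) : Measurable (rate τ) := by
  have : Measurable (fun v : Vel => v 0) := (continuous_coord 0).measurable
  unfold rate; fun_prop

theorem measurable_uncurry_orient (hQ : Measurable (Function.uncurry Q)) :
    Measurable (fun p : Vel × ℝ => orient Q p.1 p.2) := by
  unfold orient
  refine Measurable.ite (measurableSet_posHalf.preimage measurable_fst) ?_ ?_
  · exact hQ.comp (measurable_snd.prodMk measurable_fst)
  · exact hQ.comp ((measurable_const.sub measurable_snd).prodMk measurable_fst)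

theorem measurable_exitSource (hQ : Measurable (Function.uncurry Q)) :
    Measurable (exitSource τ Q) :=
  measurable_core_param (measurable_rate τ) measurable_const (measurable_uncurry_orient hQ)

theorem aestronglyMeasurable_inflow (hQ : Measurable (Function.uncurry Q))
    (hh : AEStronglyMeasurable h) : AEStronglyMeasurable (inflow τ δ₃ h Q) := by
  have m1 := (measurable_exitSource (τ := τ) hQ)
  have m2 := m1.comp measurable_reflect
  have m3 : AEStronglyMeasurable (fun v => h (reflect v)) :=
    hh.comp_measurePreserving measurePreserving_reflect
  have m4 : Measurable (fun v => Real.exp (-rate τ v)) := (measurable_rate τ).neg.exp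
  have m5 : Measurable (fun v => (1 - (δ₃ * Real.exp (-rate τ v)) ^ 2)⁻¹) := by fun_prop
  unfold inflow
  simp_rw [div_eq_mul_inv]
  refine AEStronglyMeasurable.mul ?_ m5.aestronglyMeasurable
  exact (hh.add (m2.const_mul δ₃).aestronglyMeasurable).add
    ((m4.const_mul δ₃).aestronglyMeasurable.mul (m3.add (m1.const_mul δ₃).aestronglyMeasurable))

theorem measurable_depth : Measurable (fun p : ℝ × Vel => depth p.1 p.2) := by
  unfold depth
  exact Measurable.ite (measurableSet_posHalf.preimage measurable_snd) measurable_fst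
    (measurable_const.sub measurable_fst)

/-- The wall data are only almost everywhere measurable and depend on v alone, whereas the source is
Borel. The two contributions are split and treated separately. -/
theorem aestronglyMeasurable_profile (hQ : Measurable (Function.uncurry Q))
    (hh : AEStronglyMeasurable h) (μ : Measure ℝ) [SFinite μ] :
    AEStronglyMeasurable (fun p : ℝ × Vel => profile τ δ₃ h Q p.1 p.2)
      (μ.prod volume) := by
  unfold profile
  have m1 : Measurable (fun p : ℝ × Vel => core (rate τ p.2) 0 (orient Q p.2) (depth p.1 p.2)) :=
    measurable_core_param ((measurable_rate τ).comp measurable_snd) measurable_depth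
      ((measurable_uncurry_orient hQ).comp
        ((measurable_snd.comp measurable_fst).prodMk measurable_snd))
  have m2 : Measurable (fun p : ℝ × Vel => Real.exp (-(depth p.1 p.2 * rate τ p.2))) :=
    (measurable_depth.mul ((measurable_rate τ).comp measurable_snd)).neg.exp
  simp_rw [fun p : ℝ × Vel => core_split (rate τ p.2) (inflow τ δ₃ h Q p.2)]
  exact (m2.aestronglyMeasurable.mul (aestronglyMeasurable_inflow hQ hh).comp_snd).add
    m1.aestronglyMeasurable

theorem aestronglyMeasurable_profile_slice (hQ : Measurable (Function.uncurry Q))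
    (hh : AEStronglyMeasurable h) (x : ℝ) :
    AEStronglyMeasurable (fun v => profile τ δ₃ h Q x v) := by
  have h1 : Measurable (fun v : Vel => depth x v) :=
    measurable_depth.comp (measurable_const.prodMk measurable_id)
  have m1 : Measurable (fun v : Vel => core (rate τ v) 0 (orient Q v) (depth x v)) :=
    measurable_core_param (measurable_rate τ) h1 (measurable_uncurry_orient hQ)
  have m2 : Measurable (fun v : Vel => Real.exp (-(depth x v * rate τ v))) :=
    (h1.mul (measurable_rate τ)).neg.exp
  unfold profile
  simp_rw [fun v : Vel => core_split (rate τ v) (inflow τ δ₃ h Q v)]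
  exact (m2.aestronglyMeasurable.mul (aestronglyMeasurable_inflow hQ hh)).add
    m1.aestronglyMeasurable

end profile

/-! ### Size and continuity estimates for the transport problem. -/

/-- Pointwise majorant of `profile`. -/
noncomputable def majorant (τ d c K : ℝ) (h : Vel → ℝ) (v : Vel) : ℝ :=
  d⁻¹ * (|h v| + |h (reflect v)|) +
    (2 * d⁻¹ + 1) * ((Real.sqrt τ)⁻¹ * (K * ((Real.sqrt |v 0|)⁻¹ * gw c v)))

/-- `∫ |v₁|^{-1/2} (1 + |v|²) exp(-c |v|²) dv`. -/
noncomputable def singMass (c : ℝ) : ℝ := ∫ v : Vel, (Real.sqrt |v 0|)⁻¹ * (wt v * gw c v)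

/-- `∫ (1 + |v|²) exp(-c |v|²) dv`. -/
noncomputable def gwMass (c : ℝ) : ℝ := ∫ v : Vel, wt v * gw c v

/-- The relaxation term integrated over a set of velocities. -/
noncomputable def balance (τ δ₃ : ℝ) (h : Vel → ℝ) (Q : ℝ → Vel → ℝ) (S : Set Vel) : ℝ :=
  ∫ v in S, ∫ y in (0 : ℝ)..1, (Q y v - profile τ δ₃ h Q y v)

theorem singMass_nonneg (c : ℝ) : 0 ≤ singMass c :=
  integral_nonneg fun v => mul_nonneg (by positivity) (mul_nonneg (wt_pos v).le (gw_pos c v).le)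

theorem gwMass_nonneg (c : ℝ) : 0 ≤ gwMass c :=
  integral_nonneg fun v => mul_nonneg (wt_pos v).le (gw_pos c v).le

section estimates

variable {τ δ₃ d c K : ℝ} {h : Vel → ℝ} {Q : ℝ → Vel → ℝ}

/-- The wall term and its reflection have equal weighted integrals, whence the factor 2/d. Only the
collision part carries τ^{-1/2}. -/
theorem integrable_majorant_wt (hc : 0 < c) (hh : Integrable (fun v => h v * wt v)) :
    Integrable (fun v => majorant τ d c K h v * wt v) ∧
    ∫ v, majorant τ d c K h v * wt v =
      2 * d⁻¹ * (∫ v, |h v| * wt v) + (2 * d⁻¹ + 1) * ((Real.sqrt τ)⁻¹ * (K * singMass c)) := by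
  have i1 : Integrable (fun v => |h v| * wt v) := by
    refine hh.abs.congr (Filter.Eventually.of_forall fun v => ?_)
    simp only [abs_mul, abs_of_pos (wt_pos v)]
  have i2 : Integrable (fun v => |h (reflect v)| * wt v) := by
    refine (integrable_comp_reflect i1).congr (Filter.Eventually.of_forall fun v => ?_)
    simp only [wt_reflect]
  have e2 : ∫ v, |h (reflect v)| * wt v = ∫ v, |h v| * wt v := by
    rw [← integral_comp_reflect (fun v => |h v| * wt v)]; simp only [wt_reflect]
  have i3 := integrable_sqrt_inv_mul_wt_mul_gw hc
  have i12 : Integrable (fun v => |h v| * wt v + |h (reflect v)| * wt v) := i1.add i2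
  have e : (fun v => majorant τ d c K h v * wt v) = fun v =>
      d⁻¹ * (|h v| * wt v + |h (reflect v)| * wt v) +
      ((2 * d⁻¹ + 1) * ((Real.sqrt τ)⁻¹ * K)) * ((Real.sqrt |v 0|)⁻¹ * (wt v * gw c v)) := by
    funext v; unfold majorant; ring
  rw [e]
  refine ⟨(i12.const_mul _).add (i3.const_mul _), ?_⟩
  rw [integral_add (i12.const_mul _) (i3.const_mul _), integral_const_mul, integral_const_mul,
    integral_add i1 i2, e2, singMass]
  ring

theorem majorant_nonneg (hd : 0 < d) (hK : 0 ≤ K) (v : Vel) : 0 ≤ majorant τ d c K h v := by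
  have := gw_pos c v
  unfold majorant; positivity

theorem abs_profile_le_majorant (hτ : 0 < τ) (hd : 0 < d) (h0 : 0 ≤ δ₃) (h1 : δ₃ ≤ 1 - d)
    (hQ : ∀ y v, |Q y v| ≤ K * gw c v) {x : ℝ} (hx : x ∈ Icc (0 : ℝ) 1) (v : Vel) :
    |profile τ δ₃ h Q x v| ≤ majorant τ d c K h v := by
  have := abs_profile_le (h := h) hτ hd h0 h1 hQ (fun v => by rw [gw_reflect]) hx v
  rw [sqrt_rate hτ] at this
  unfold majorant
  calc _ ≤ _ := this
    _ = _ := by ring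

theorem integrable_profile_wt (hτ : 0 < τ) (hd : 0 < d) (h0 : 0 ≤ δ₃) (h1 : δ₃ ≤ 1 - d)
    (hc : 0 < c) (hQm : Measurable (Function.uncurry Q)) (hQ : ∀ y v, |Q y v| ≤ K * gw c v)
    (hh : Integrable (fun v => h v * wt v)) {x : ℝ} (hx : x ∈ Icc (0 : ℝ) 1) :
    Integrable (fun v => profile τ δ₃ h Q x v * wt v) := by
  refine integrable_of_abs_le (integrable_majorant_wt (τ := τ) (d := d) (K := K) hc hh).1
    ((aestronglyMeasurable_profile_slice hQm (aestronglyMeasurable_of_mul_wt hh) x).mul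
      continuous_wt.aestronglyMeasurable) (Filter.Eventually.of_forall fun v => ?_)
  rw [abs_mul, abs_of_pos (wt_pos v)]
  exact mul_le_mul_of_nonneg_right (abs_profile_le_majorant hτ hd h0 h1 hQ hx v) (wt_pos v).le

theorem integral_abs_profile_wt_le (hτ : 0 < τ) (hd : 0 < d) (h0 : 0 ≤ δ₃) (h1 : δ₃ ≤ 1 - d)
    (hc : 0 < c) (hQ : ∀ y v, |Q y v| ≤ K * gw c v)
    (hh : Integrable (fun v => h v * wt v)) {x : ℝ} (hx : x ∈ Icc (0 : ℝ) 1) :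
    ∫ v, |profile τ δ₃ h Q x v| * wt v ≤
      2 * d⁻¹ * (∫ v, |h v| * wt v) + (2 * d⁻¹ + 1) * ((Real.sqrt τ)⁻¹ * (K * singMass c)) := by
  obtain ⟨i1, e1⟩ := integrable_majorant_wt (τ := τ) (d := d) (K := K) hc hh
  rw [← e1]
  refine integral_mono_of_nonneg (Filter.Eventually.of_forall fun v =>
    mul_nonneg (abs_nonneg _) (wt_pos v).le) i1 (Filter.Eventually.of_forall fun v => ?_)
  exact mul_le_mul_of_nonneg_right (abs_profile_le_majorant hτ hd h0 h1 hQ hx v) (wt_pos v).le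

theorem abs_relax_le (hτ : 0 < τ) (hd : 0 < d) (h0 : 0 ≤ δ₃) (h1 : δ₃ ≤ 1 - d)
    (hQ : ∀ y v, |Q y v| ≤ K * gw c v) (v : Vel) :
    |∫ y in (0 : ℝ)..1, (Q y v - profile τ δ₃ h Q y v)| ≤ K * gw c v + majorant τ d c K h v := by
  rw [← Real.norm_eq_abs]
  have := intervalIntegral.norm_integral_le_of_norm_le_const (a := (0 : ℝ)) (b := 1)
    (C := K * gw c v + majorant τ d c K h v) (f := fun y => Q y v - profile τ δ₃ h Q y v) ?_
  · simpa using this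
  · intro y hy
    rw [uIoc_of_le zero_le_one] at hy
    exact (abs_sub _ _).trans (add_le_add (hQ y v)
      (abs_profile_le_majorant hτ hd h0 h1 hQ ⟨hy.1.le, hy.2⟩ v))

theorem integrable_relax_majorant (hc : 0 < c)
    (hh : Integrable (fun v => h v * wt v)) :
    Integrable (fun v => (K * gw c v + majorant τ d c K h v) * wt v) ∧
    ∫ v, (K * gw c v + majorant τ d c K h v) * wt v = K * gwMass c +
      (2 * d⁻¹ * (∫ v, |h v| * wt v) + (2 * d⁻¹ + 1) * ((Real.sqrt τ)⁻¹ * (K * singMass c))) := by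
  obtain ⟨i1, e1⟩ := integrable_majorant_wt (τ := τ) (d := d) (K := K) hc hh
  have i2 := (integrable_wt_mul_gw hc).const_mul K
  have e : (fun v => (K * gw c v + majorant τ d c K h v) * wt v) =
      fun v => K * (wt v * gw c v) + majorant τ d c K h v * wt v := by funext v; ring
  rw [e]
  refine ⟨i2.add i1, ?_⟩
  rw [integral_add i2 i1, integral_const_mul, e1, gwMass]

theorem abs_balance_le (hτ : 0 < τ) (hd : 0 < d) (h0 : 0 ≤ δ₃) (h1 : δ₃ ≤ 1 - d)
    (hc : 0 < c) (hK : 0 ≤ K) (hQ : ∀ y v, |Q y v| ≤ K * gw c v)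
    (hh : Integrable (fun v => h v * wt v)) (S : Set Vel) :
    |balance τ δ₃ h Q S| ≤ K * gwMass c +
      (2 * d⁻¹ * (∫ v, |h v| * wt v) + (2 * d⁻¹ + 1) * ((Real.sqrt τ)⁻¹ * (K * singMass c))) := by
  obtain ⟨i1, e1⟩ := integrable_relax_majorant (τ := τ) (d := d) (K := K) hc hh
  have hnn (v : Vel) : 0 ≤ K * gw c v + majorant τ d c K h v :=
    add_nonneg (mul_nonneg hK (gw_pos c v).le) (majorant_nonneg hd hK v)
  rw [← e1]
  calc |balance τ δ₃ h Q S| ≤ ∫ v in S, (K * gw c v + majorant τ d c K h v) * wt v := by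
        rw [balance, ← Real.norm_eq_abs]
        refine norm_integral_le_of_norm_le i1.integrableOn (Filter.Eventually.of_forall fun v => ?_)
        exact (abs_relax_le hτ hd h0 h1 hQ v).trans
          (le_mul_of_one_le_right (hnn v) (one_le_wt v))
    _ ≤ _ := setIntegral_le_integral i1
        (Filter.Eventually.of_forall fun v => mul_nonneg (hnn v) (wt_pos v).le)

theorem intervalIntegrable_source (hQm : Measurable (Function.uncurry Q))
    (hQ : ∀ y v, |Q y v| ≤ K * gw c v) (v : Vel) (s t : ℝ) :
    IntervalIntegrable (fun y => Q y v) volume s t := by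
  refine (intervalIntegrable_const (c := K * gw c v)).mono_fun
    (hQm.comp (measurable_id.prodMk measurable_const)).aestronglyMeasurable
    (Filter.Eventually.of_forall fun y => ?_)
  simp only [Real.norm_eq_abs]
  exact (hQ y v).trans (le_abs_self _)

theorem intervalIntegrable_profile (hQm : Measurable (Function.uncurry Q))
    (hQ : ∀ y v, |Q y v| ≤ K * gw c v) (v : Vel) (s t : ℝ) :
    IntervalIntegrable (fun y => profile τ δ₃ h Q y v) volume s t :=
  (continuous_profile hQm hQ v).intervalIntegrable s t

theorem aestronglyMeasurable_relax (hQm : Measurable (Function.uncurry Q))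
    (hh : AEStronglyMeasurable h) :
    AEStronglyMeasurable (fun v => ∫ y in (0 : ℝ)..1, (Q y v - profile τ δ₃ h Q y v)) volume := by
  simp_rw [intervalIntegral.integral_of_le zero_le_one]
  have h1 : AEStronglyMeasurable (fun p : ℝ × Vel => Q p.1 p.2 - profile τ δ₃ h Q p.1 p.2)
      ((volume.restrict (Ioc (0 : ℝ) 1)).prod volume) :=
    hQm.aestronglyMeasurable.sub (aestronglyMeasurable_profile hQm hh _)
  exact h1.prod_swap.integral_prod_right'

theorem integrable_relax_wt (hτ : 0 < τ) (hd : 0 < d) (h0 : 0 ≤ δ₃) (h1 : δ₃ ≤ 1 - d)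
    (hc : 0 < c) (hK : 0 ≤ K) (hQm : Measurable (Function.uncurry Q))
    (hQ : ∀ y v, |Q y v| ≤ K * gw c v) (hh : Integrable (fun v => h v * wt v)) :
    Integrable (fun v => ∫ y in (0 : ℝ)..1, (Q y v - profile τ δ₃ h Q y v)) := by
  refine integrable_of_abs_le
    (integrable_relax_majorant (τ := τ) (d := d) (K := K) hc hh).1
    (aestronglyMeasurable_relax hQm (aestronglyMeasurable_of_mul_wt hh))
    (Filter.Eventually.of_forall fun v => ?_)
  have hnn : 0 ≤ K * gw c v + majorant τ d c K h v :=
    add_nonneg (mul_nonneg hK (gw_pos c v).le) (majorant_nonneg hd hK v)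
  exact (abs_relax_le hτ hd h0 h1 hQ v).trans (le_mul_of_one_le_right hnn (one_le_wt v))

theorem balance_sub {h' : Vel → ℝ} {Q' : ℝ → Vel → ℝ} (hτ : 0 < τ) (hd : 0 < d) (h0 : 0 ≤ δ₃)
    (h1 : δ₃ ≤ 1 - d) (hc : 0 < c) (hK : 0 ≤ K) (hQm : Measurable (Function.uncurry Q))
    (hQ : ∀ y v, |Q y v| ≤ K * gw c v) (hh : Integrable (fun v => h v * wt v))
    (hQm' : Measurable (Function.uncurry Q')) (hQ' : ∀ y v, |Q' y v| ≤ K * gw c v)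
    (hh' : Integrable (fun v => h' v * wt v)) (S : Set Vel) :
    balance τ δ₃ (fun v => h v - h' v) (fun y v => Q y v - Q' y v) S =
      balance τ δ₃ h Q S - balance τ δ₃ h' Q' S := by
  rw [balance, balance, balance, ← integral_sub
    (integrable_relax_wt hτ hd h0 h1 hc hK hQm hQ hh).integrableOn
    (integrable_relax_wt hτ hd h0 h1 hc hK hQm' hQ' hh').integrableOn]
  refine integral_congr_ae (Filter.Eventually.of_forall fun v => ?_)
  simp only
  rw [← intervalIntegral.integral_sub
    ((intervalIntegrable_source hQm hQ v 0 1).sub (intervalIntegrable_profile hQm hQ v 0 1))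
    ((intervalIntegrable_source hQm' hQ' v 0 1).sub (intervalIntegrable_profile hQm' hQ' v 0 1))]
  congr 1; funext y
  rw [profile_sub hQm hQ hQm' hQ']
  ring

/-- Dominated convergence: for fixed v the profile is continuous in x, and the majorant does not
depend on x. A merely measurable source suffices, so passing through the transport problem gains
continuity. -/
theorem continuous_moments_profile (hτ : 0 < τ) (hd : 0 < d) (h0 : 0 ≤ δ₃) (h1 : δ₃ ≤ 1 - d)
    (hc : 0 < c) (hQm : Measurable (Function.uncurry Q))
    (hQ : ∀ y v, |Q y v| ≤ K * gw c v) (hh : Integrable (fun v => h v * wt v)) :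
    Continuous (fun x : Icc (0 : ℝ) 1 => moments (profile τ δ₃ h Q x)) := by
  refine continuous_pi fun k => continuous_pi fun l => ?_
  refine continuous_of_dominated (bound := fun v => majorant τ d c K h v * wt v) (fun x => ?_)
    (fun x => Filter.Eventually.of_forall fun v => ?_)
    (integrable_majorant_wt hc hh).1 (Filter.Eventually.of_forall fun v => ?_)
  · exact (aestronglyMeasurable_profile_slice hQm (aestronglyMeasurable_of_mul_wt hh) x).mul
      (by fun_prop : Continuous _).aestronglyMeasurable
  · rw [Real.norm_eq_abs, abs_mul]
    have h2 := abs_profile_le_majorant (h := h) hτ hd h0 h1 hQ x.2 v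
    exact mul_le_mul h2 (abs_hat_mul_hat_le v k l) (abs_nonneg _) ((abs_nonneg _).trans h2)
  · exact ((continuous_profile hQm hQ v).comp continuous_subtype_val).mul continuous_const

end estimates

/-! ### Wall sources and the collisionless limit. -/

/-- The contribution `δ₁ f_LR + δ₂ s M_w` to the incoming trace. -/
noncomputable def wallSource (δ₁ δ₂ : ℝ) (fL fR : Vel → ℝ) (Tw : Fin 2 → ℝ) (s : ℝ × ℝ)
    (v : Vel) : ℝ :=
  δ₁ * glue fL fR v + δ₂ * glue (fun v => s.1 * wallMaxwellian (Tw 0) v)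
    (fun v => s.2 * wallMaxwellian (Tw 1) v) v

/-- The right-hand sides of the formulas for `𝒮_L` and `𝒮_R`. -/
noncomputable def newFlux (τ δ₁ δ₃ : ℝ) (fL fR : Vel → ℝ) (h : Vel → ℝ) (Q : ℝ → Vel → ℝ) :
    ℝ × ℝ :=
  ((1 - δ₁) / (2 - δ₁) + δ₁ / (2 - δ₁) * (∫ v in negHalf, fR v * |v 0|) -
      1 / (τ * (2 - δ₁)) * balance τ δ₃ h Q posHalf,
    (1 - δ₁) / (2 - δ₁) + δ₁ / (2 - δ₁) * (∫ v in posHalf, fL v * |v 0|) -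
      1 / (τ * (2 - δ₁)) * balance τ δ₃ h Q negHalf)

/-- The moments of `M_w / 2`, the limit for vanishing inflow and collisions. -/
noncomputable def limitMoments (Tw : Fin 2 → ℝ) : Moments := moments (fun v => 1 / 2 * wallMw Tw v)

/-- The distribution function in the limit of vanishing inflow and collisions. -/
noncomputable def limitProfile (δ₃ : ℝ) (Tw : Fin 2 → ℝ) (v : Vel) : ℝ :=
  1 / 2 * (wallMw Tw v + δ₃ * wallMw Tw (reflect v)) / (1 + δ₃)

/-- The ellipsoidal Gaussian, truncated to the admissible moments. -/
noncomputable def gaussD (ν a B c : ℝ) (m : Moments) (v : Vel) : ℝ :=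
  (admissible ν a B c).indicator (fun m => gaussM ν m v) m

section

variable {Tw : Fin 2 → ℝ} {fL fR : Vel → ℝ} {δ₁ δ₂ δ₃ τ d : ℝ}

theorem glue_smul_wall (s : ℝ × ℝ) (v : Vel) :
    glue (fun v => s.1 * wallMaxwellian (Tw 0) v) (fun v => s.2 * wallMaxwellian (Tw 1) v) v =
      (if 0 < v 0 then s.1 else s.2) * wallMw Tw v := by
  rcases lt_trichotomy (v 0) 0 with h | h | h
  · rw [glue_of_neg _ _ h, wallMw, glue_of_neg _ _ h, if_neg (not_lt.2 h.le)]
  · rw [glue_of_zero _ _ h, wallMw, glue_of_zero _ _ h, mul_zero]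
  · rw [glue_of_pos _ _ h, wallMw, glue_of_pos _ _ h, if_pos h]

theorem wallSource_eq (s : ℝ × ℝ) (v : Vel) : wallSource δ₁ δ₂ fL fR Tw s v =
    δ₁ * glue fL fR v + δ₂ * ((if 0 < v 0 then s.1 else s.2) * wallMw Tw v) := by
  rw [wallSource, glue_smul_wall]

theorem wallSource_nonneg (hTw : ∀ i, 0 < Tw i) (h1 : 0 ≤ δ₁) (h2 : 0 ≤ δ₂) {s : ℝ × ℝ}
    (hs1 : 0 ≤ s.1) (hs2 : 0 ≤ s.2) {v : Vel} (hv : 0 ≤ glue fL fR v) :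
    0 ≤ wallSource δ₁ δ₂ fL fR Tw s v := by
  rw [wallSource_eq]
  have := wallMw_nonneg hTw v
  split_ifs <;> positivity

theorem abs_ite_le_norm (s : ℝ × ℝ) (p : Prop) [Decidable p] : |if p then s.1 else s.2| ≤ ‖s‖ := by
  split_ifs
  exacts [norm_fst_le s, norm_snd_le s]

theorem abs_wallSource_sub_le (hTw : ∀ i, 0 < Tw i) (h2 : 0 ≤ δ₂) (h2' : δ₂ ≤ 1) (s s' : ℝ × ℝ)
    (v : Vel) : |wallSource δ₁ δ₂ fL fR Tw s v - wallSource δ₁ δ₂ fL fR Tw s' v| ≤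
      ‖s - s'‖ * wallMw Tw v := by
  have hM := wallMw_nonneg hTw v
  have e : wallSource δ₁ δ₂ fL fR Tw s v - wallSource δ₁ δ₂ fL fR Tw s' v =
      δ₂ * ((if 0 < v 0 then (s - s').1 else (s - s').2) * wallMw Tw v) := by
    rw [wallSource_eq, wallSource_eq]
    split_ifs <;> simp <;> ring
  rw [e, abs_mul, abs_mul, abs_of_nonneg h2, abs_of_nonneg hM]
  calc _ ≤ 1 * (‖s - s'‖ * wallMw Tw v) := by
        gcongr
        exact abs_ite_le_norm _ _
    _ = _ := one_mul _

/-- The limit wall term is written with 1 - δ₃ instead of δ₂. The two agree up to δ₁, and this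
choice makes the limit profile depend on δ₃ alone. -/
theorem abs_wallSource_sub_limit_le (hTw : ∀ i, 0 < Tw i) (h1 : 0 ≤ δ₁) (h2 : 0 ≤ δ₂)
    (h3 : 0 ≤ δ₃) (hsum : δ₁ + δ₂ + δ₃ = 1) (s : ℝ × ℝ) (v : Vel) :
    |wallSource δ₁ δ₂ fL fR Tw s v - 1 / 2 * (1 - δ₃) * wallMw Tw v| ≤
      δ₁ * |glue fL fR v| + (‖s - (1 / 2, 1 / 2)‖ + δ₁) * wallMw Tw v := by
  have hM := wallMw_nonneg hTw v
  have e : wallSource δ₁ δ₂ fL fR Tw s v - 1 / 2 * (1 - δ₃) * wallMw Tw v =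
      δ₁ * glue fL fR v + (δ₂ * ((if 0 < v 0 then (s - (1 / 2, 1 / 2)).1
        else (s - (1 / 2, 1 / 2)).2) * wallMw Tw v) - 1 / 2 * δ₁ * wallMw Tw v) := by
    rw [wallSource_eq, show 1 - δ₃ = δ₁ + δ₂ by linarith]
    split_ifs <;> simp <;> ring
  rw [e]
  refine (abs_add_le _ _).trans (add_le_add (by rw [abs_mul, abs_of_nonneg h1]) ?_)
  refine (abs_sub _ _).trans ?_
  rw [add_mul]
  refine add_le_add ?_ ?_
  · rw [abs_mul, abs_mul, abs_of_nonneg h2, abs_of_nonneg hM]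
    calc _ ≤ 1 * (‖s - (1 / 2, 1 / 2)‖ * wallMw Tw v) := by
          gcongr
          · linarith
          · exact abs_ite_le_norm _ _
      _ = _ := one_mul _
  · rw [abs_of_nonneg (by positivity)]
    nlinarith [mul_nonneg h1 hM]

theorem integrable_wallMw_wt (hTw : ∀ i, 0 < Tw i) : Integrable (fun v => wallMw Tw v * wt v) :=
  integrable_wallMw_mul hTw continuous_wt.measurable fun v => by rw [abs_of_pos (wt_pos v)]

theorem PropP1.integrable (hP : PropP1 fL fR) : Integrable (fun v => glue fL fR v * wt v) := hP.2.2

theorem integrable_abs_mul_wt {g : Vel → ℝ} (hg : Integrable (fun v => g v * wt v)) :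
    Integrable (fun v => |g v| * wt v) :=
  hg.abs.congr (Filter.Eventually.of_forall fun v => by simp only [abs_mul, abs_of_pos (wt_pos v)])

theorem integrable_wallSource_wt (hTw : ∀ i, 0 < Tw i) (hP : PropP1 fL fR) (s : ℝ × ℝ) :
    Integrable (fun v => wallSource δ₁ δ₂ fL fR Tw s v * wt v) := by
  have hm : Measurable (fun v : Vel => if 0 < v 0 then s.1 else s.2) :=
    Measurable.ite measurableSet_posHalf measurable_const measurable_const
  have i1 : Integrable (fun v : Vel => (if 0 < v 0 then s.1 else s.2) * (wallMw Tw v * wt v)) :=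
    (integrable_wallMw_wt hTw).bdd_mul (c := ‖s‖) hm.aestronglyMeasurable
      (Filter.Eventually.of_forall fun v => abs_ite_le_norm s _)
  refine ((hP.integrable.const_mul δ₁).add (i1.const_mul δ₂)).congr
    (Filter.Eventually.of_forall fun v => ?_)
  simp only [Pi.add_apply, wallSource_eq]; ring

/-- Solving the reflection relation at v and Rv gives the determinant 1 - δ₃²; the factor 1 - δ₃ of
the wall term cancels, which explains the denominator 1 + δ₃. -/
theorem limitProfile_eq (h3 : 0 ≤ δ₃) (v : Vel) : limitProfile δ₃ Tw v =
    1 / 2 * (1 - δ₃) * wallMw Tw v + δ₃ * limitProfile δ₃ Tw (reflect v) := by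
  have : 1 + δ₃ ≠ 0 := by positivity
  simp only [limitProfile, reflect_reflect]
  field_simp
  ring

theorem measurable_limitProfile : Measurable (limitProfile δ₃ Tw) := by
  have h1 := measurable_wallMw Tw
  have h2 : Measurable (fun v => wallMw Tw (reflect v)) := h1.comp measurable_reflect
  unfold limitProfile; fun_prop

theorem abs_limitProfile_le (hTw : ∀ i, 0 < Tw i) {c C : ℝ} (h3 : 0 ≤ δ₃)
    (hC : ∀ v, wallMw Tw v ≤ C * gw c v) (v : Vel) : |limitProfile δ₃ Tw v| ≤ C * gw c v := by
  have e1 := wallMw_nonneg hTw v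
  have e2 := wallMw_nonneg hTw (reflect v)
  have b1 := hC v
  have b2 := hC (reflect v)
  rw [gw_reflect] at b2
  rw [limitProfile, abs_of_nonneg (by positivity), div_le_iff₀ (by positivity)]
  nlinarith

/-- Tangential components vanish by symmetry, the normal one by the flux normalization. -/
theorem integral_wallMw_odd (hTw : ∀ i, 0 < Tw i) (i : Fin 3) :
    ∫ v : Vel, wallMw Tw v * v i = 0 := by
  by_cases hi : i = 0
  · subst hi; exact integral_wallMw_mul_coord_zero hTw
  · exact integral_eq_zero_of_flip i fun v => by
      simp [wallMw_flip hi, flip_apply]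

theorem integral_wallMw_zero_mul (i : Fin 3) (hi : i ≠ 0) :
    ∫ v : Vel, wallMw Tw v * (v 0 * v i) = 0 :=
  integral_eq_zero_of_flip i fun v => by
    simp [wallMw_flip hi, flip_apply, hi.symm]

/-- Reflection does not change the moments of the wall Maxwellian. -/
theorem integral_wallMw_reflect (hTw : ∀ i, 0 < Tw i) (k l : Fin 4) :
    ∫ v, wallMw Tw (reflect v) * (hat v k * hat v l) =
      ∫ v, wallMw Tw v * (hat v k * hat v l) := by
  have e : ∫ v, wallMw Tw (reflect v) * (hat v k * hat v l) =
      ∫ v, wallMw Tw v * (hat (reflect v) k * hat (reflect v) l) := by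
    rw [← integral_comp_reflect]; simp_rw [reflect_reflect]
  rw [e]
  have h0 (i : Fin 3) (v : Vel) : reflect v i = if i = 0 then -v 0 else v i := by
    rw [reflect_eq_flip, flip_apply]; split_ifs with h <;> simp [h]
  refine Fin.cases ?_ (fun i => ?_) k <;> refine Fin.cases ?_ (fun j => ?_) l
  · simp
  · simp only [hat_zero, hat_succ, one_mul, h0]
    split_ifs with hj
    · subst hj
      simp only [mul_neg, integral_neg, integral_wallMw_odd hTw, neg_zero]
    · rfl
  · simp only [hat_zero, hat_succ, mul_one, h0]
    split_ifs with hj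
    · subst hj
      simp only [mul_neg, integral_neg, integral_wallMw_odd hTw, neg_zero]
    · rfl
  · simp only [hat_succ, h0]
    split_ifs with hi hj hj
    · subst hi hj; simp
    · subst hi
      simp only [neg_mul, mul_neg, integral_neg, integral_wallMw_zero_mul j hj, neg_zero]
    · subst hj
      have : ∫ v : Vel, wallMw Tw v * (v i * v 0) = 0 := by
        rw [← integral_wallMw_zero_mul i hi]; congr 1; funext v; ring
      simp only [mul_neg, integral_neg, this, neg_zero]
    · rfl

theorem integrable_limitProfile_wt (hTw : ∀ i, 0 < Tw i) (h3 : 0 ≤ δ₃) :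
    Integrable (fun v => limitProfile δ₃ Tw v * wt v) := by
  obtain ⟨c, hc, C, -, hC⟩ := exists_wallMw_le hTw
  refine integrable_of_abs_le ((integrable_wt_mul_gw hc).const_mul C)
    (measurable_limitProfile.mul continuous_wt.measurable).aestronglyMeasurable
    (Filter.Eventually.of_forall fun v => ?_)
  rw [abs_mul, abs_of_pos (wt_pos v)]
  have := mul_le_mul_of_nonneg_right (abs_limitProfile_le hTw h3 hC v) (wt_pos v).le
  linarith

/-- M_w and its reflection have the same moments, so the weights 1 and δ₃ add up to the denominator
1 + δ₃. Since δ₃ disappears, one neighbourhood serves for all parameters. -/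
theorem moments_limitProfile (hTw : ∀ i, 0 < Tw i) (h3 : 0 ≤ δ₃) :
    moments (limitProfile δ₃ Tw) = limitMoments Tw := by
  funext k l
  have i1 := integrable_mul_hat (integrable_wallMw_wt hTw) k l
  have i2 : Integrable (fun v => wallMw Tw (reflect v) * (hat v k * hat v l)) := by
    refine integrable_mul_hat ?_ k l
    refine (integrable_comp_reflect (integrable_wallMw_wt hTw)).congr
      (Filter.Eventually.of_forall fun v => ?_)
    simp only [wt_reflect]
  have e : ∀ v, limitProfile δ₃ Tw v * (hat v k * hat v l) =
      (1 / 2 / (1 + δ₃)) * (wallMw Tw v * (hat v k * hat v l) +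
        δ₃ * (wallMw Tw (reflect v) * (hat v k * hat v l))) := by
    intro v; unfold limitProfile; ring
  have e' : ∀ v, 1 / 2 * wallMw Tw v * (hat v k * hat v l) =
      1 / 2 * (wallMw Tw v * (hat v k * hat v l)) := fun v => by ring
  simp only [moments, limitMoments]
  simp_rw [e, e']
  rw [integral_const_mul, integral_add i1 (i2.const_mul _), integral_const_mul,
    integral_wallMw_reflect hTw, integral_const_mul]
  have : 1 + δ₃ ≠ 0 := by positivity
  field_simp

theorem measurable_gaussD {ν a B c : ℝ} (ha : 0 < a) (hc : 0 < c) :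
    Measurable (fun p : Moments × Vel => gaussD ν a B c p.1 p.2) := by
  have hs : MeasurableSet (admissible ν a B c ×ˢ (univ : Set Vel)) :=
    (isClosed_admissible ha).measurableSet.prod MeasurableSet.univ
  have e : (fun p : Moments × Vel => gaussD ν a B c p.1 p.2) =
      (admissible ν a B c ×ˢ (univ : Set Vel)).indicator
        (fun p => gaussM ν p.1 p.2) := by
    funext p
    by_cases hp : p.1 ∈ admissible ν a B c
    · rw [gaussD, indicator_of_mem hp, indicator_of_mem (mk_mem_prod hp (mem_univ p.2))]
    · rw [gaussD, indicator_of_notMem hp, indicator_of_notMem fun h => hp h.1]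
  rw [e]
  have h := (continuousOn_gaussM (ν := ν) (B := B) ha hc)
  classical
  have h2 := h.measurable_piecewise (g := fun _ => (0 : ℝ)) continuousOn_const hs
  rw [← piecewise_eq_indicator]
  exact h2

/-- The smaller decay rate and the larger constant serve the Gaussian and M_w at once. A common
majorant allows the limit profile itself to be used as a source. -/
theorem exists_gaussD_bounds (hTw : ∀ i, 0 < Tw i) (ν B : ℝ) {a c : ℝ} (ha : 0 < a) (hc : 0 < c) :
    ∃ c' > 0, ∃ C > 0, (∀ m v, 0 ≤ gaussD ν a B c m v) ∧
      (∀ m v, |gaussD ν a B c m v| ≤ C * gw c' v) ∧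
      (∀ m ∈ admissible ν a B c, ∀ m' ∈ admissible ν a B c, ∀ v,
        |gaussD ν a B c m v - gaussD ν a B c m' v| ≤ (‖m - m'‖ * C) * gw c' v) ∧
      ∀ v, wallMw Tw v ≤ C * gw c' v := by
  obtain ⟨c1, hc1, C1, hC1, h1, h1'⟩ := exists_gaussM_bounds ν B ha hc
  obtain ⟨c2, hc2, C2, hC2, h2⟩ := exists_wallMw_le hTw
  have hnn : ∀ m v, 0 ≤ gaussD ν a B c m v := fun m v =>
    indicator_nonneg (fun m hm => gaussM_nonneg (ha.le.trans hm.2.1) v) m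
  have b1 (v : Vel) : C1 * gw c1 v ≤ max C1 C2 * gw (min c1 c2) v :=
    mul_le_mul (le_max_left _ _) (gw_anti (min_le_left _ _) v) (gw_pos _ _).le (by positivity)
  have b2 (v : Vel) : C2 * gw c2 v ≤ max C1 C2 * gw (min c1 c2) v :=
    mul_le_mul (le_max_right _ _) (gw_anti (min_le_right _ _) v) (gw_pos _ _).le (by positivity)
  refine ⟨min c1 c2, by positivity, max C1 C2, by positivity, hnn, fun m v => ?_,
    fun m hm m' hm' v => ?_, fun v => (h2 v).trans (b2 v)⟩
  · rw [abs_of_nonneg (hnn m v)]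
    by_cases hm : m ∈ admissible ν a B c
    · rw [gaussD, indicator_of_mem hm]; exact (h1 m hm v).trans (b1 v)
    · rw [gaussD, indicator_of_notMem hm]
      have := gw_pos (min c1 c2) v
      positivity
  · rw [gaussD, gaussD, indicator_of_mem hm, indicator_of_mem hm']
    calc _ ≤ _ := h1' m hm m' hm' v
      _ = ‖m - m'‖ * (C1 * gw c1 v) := by ring
      _ ≤ ‖m - m'‖ * (max C1 C2 * gw (min c1 c2) v) :=
          mul_le_mul_of_nonneg_left (b1 v) (norm_nonneg _)
      _ = _ := by ring

end

/-! ### Quantitative dependence on source and wall coefficients. -/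

/-- The admitted parameters of the problem. -/
structure ValidParams (d τ δ₁ δ₂ δ₃ : ℝ) : Prop where
  d_pos : 0 < d
  one_le : 1 ≤ τ
  nonneg₁ : 0 ≤ δ₁
  nonneg₂ : 0 ≤ δ₂
  nonneg₃ : 0 ≤ δ₃
  sum_eq : δ₁ + δ₂ + δ₃ = 1
  le₂ : d ≤ δ₂

namespace ValidParams

variable {d τ δ₁ δ₂ δ₃ : ℝ} (V : ValidParams d τ δ₁ δ₂ δ₃)
include V

theorem tau_pos : 0 < τ := zero_lt_one.trans_le V.one_le

theorem le₃ : δ₃ ≤ 1 - d := by linarith [V.sum_eq, V.le₂, V.nonneg₁]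

theorem le_one₁ : δ₁ ≤ 1 := by linarith [V.sum_eq, V.nonneg₂, V.nonneg₃]

theorem le_one₂ : δ₂ ≤ 1 := by linarith [V.sum_eq, V.nonneg₁, V.nonneg₃]

theorem inv_le : τ⁻¹ ≤ (Real.sqrt τ)⁻¹ := by
  refine inv_anti₀ (Real.sqrt_pos.2 V.tau_pos) ?_
  rw [Real.sqrt_le_left V.tau_pos.le]
  nlinarith [V.one_le]

theorem inv_sqrt_le_one : (Real.sqrt τ)⁻¹ ≤ 1 := inv_le_one_of_one_le₀ (Real.one_le_sqrt.2 V.one_le)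

theorem coeff_le : 1 / (τ * (2 - δ₁)) ≤ (Real.sqrt τ)⁻¹ := by
  refine le_trans ?_ V.inv_le
  rw [one_div]
  exact inv_anti₀ V.tau_pos (by nlinarith [V.tau_pos, V.le_one₁])

theorem coeff_nonneg : 0 ≤ 1 / (τ * (2 - δ₁)) := by
  have := V.tau_pos
  have : 0 < 2 - δ₁ := by linarith [V.le_one₁]
  positivity

end ValidParams

section

variable {Tw : Fin 2 → ℝ} {fL fR : Vel → ℝ} {δ₁ δ₂ δ₃ τ d c C : ℝ}

/-- `∫ |g| (1 + |v|²) dv`. -/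
noncomputable def wtNorm (g : Vel → ℝ) : ℝ := ∫ v, |g v| * wt v

theorem wtNorm_nonneg (g : Vel → ℝ) : 0 ≤ wtNorm g :=
  integral_nonneg fun v => mul_nonneg (abs_nonneg _) (wt_pos v).le

theorem wtNorm_le {g g₁ : Vel → ℝ} (h1 : Integrable (fun v => g₁ v * wt v))
    (h : ∀ v, |g v| ≤ g₁ v) : wtNorm g ≤ ∫ v, g₁ v * wt v :=
  integral_mono_of_nonneg (Filter.Eventually.of_forall fun v => mul_nonneg (abs_nonneg _)
    (wt_pos v).le) h1 (Filter.Eventually.of_forall fun v =>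
      mul_le_mul_of_nonneg_right (h v) (wt_pos v).le)

theorem wtNorm_wallMw (hTw : ∀ i, 0 < Tw i) : ∫ v, wallMw Tw v * wt v = wtNorm (wallMw Tw) := by
  simp only [wtNorm, abs_of_nonneg (wallMw_nonneg hTw _)]

theorem wtNorm_wallSource_sub_le (hTw : ∀ i, 0 < Tw i) (V : ValidParams d τ δ₁ δ₂ δ₃)
    (s s' : ℝ × ℝ) : wtNorm (fun v => wallSource δ₁ δ₂ fL fR Tw s v -
      wallSource δ₁ δ₂ fL fR Tw s' v) ≤ ‖s - s'‖ * wtNorm (wallMw Tw) := by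
  rw [← wtNorm_wallMw hTw, ← integral_const_mul]
  have i1 := (integrable_wallMw_wt hTw).const_mul ‖s - s'‖
  simp_rw [← mul_assoc] at i1 ⊢
  exact wtNorm_le i1 (abs_wallSource_sub_le hTw V.nonneg₂ V.le_one₂ s s')

theorem wtNorm_wallSource_sub_limit_le (hTw : ∀ i, 0 < Tw i) (hP : PropP1 fL fR)
    (V : ValidParams d τ δ₁ δ₂ δ₃) (s : ℝ × ℝ) :
    wtNorm (fun v => wallSource δ₁ δ₂ fL fR Tw s v - 1 / 2 * (1 - δ₃) * wallMw Tw v) ≤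
      δ₁ * wtNorm (glue fL fR) + (‖s - (1 / 2, 1 / 2)‖ + δ₁) * wtNorm (wallMw Tw) := by
  have i1 := (integrable_abs_mul_wt hP.integrable).const_mul δ₁
  have i2 := (integrable_wallMw_wt hTw).const_mul (‖s - (1 / 2, 1 / 2)‖ + δ₁)
  have i3 := i1.add i2
  have h := wtNorm_le (g := fun v => wallSource δ₁ δ₂ fL fR Tw s v
    - 1 / 2 * (1 - δ₃) * wallMw Tw v)
    (g₁ := fun v => δ₁ * |glue fL fR v| + (‖s - (1 / 2, 1 / 2)‖ + δ₁) * wallMw Tw v)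
    (i3.congr (Filter.Eventually.of_forall fun v => by simp only [Pi.add_apply]; ring))
    (abs_wallSource_sub_limit_le hTw V.nonneg₁ V.nonneg₂ V.nonneg₃ V.sum_eq s)
  refine h.trans (le_of_eq ?_)
  rw [← wtNorm_wallMw hTw, wtNorm, ← integral_const_mul, ← integral_const_mul,
    ← integral_add i1 i2]
  congr 1; funext v; ring

theorem wtNorm_wallSource_le (hTw : ∀ i, 0 < Tw i) (hP : PropP1 fL fR)
    (V : ValidParams d τ δ₁ δ₂ δ₃) (s : ℝ × ℝ) :
    wtNorm (wallSource δ₁ δ₂ fL fR Tw s) ≤ wtNorm (glue fL fR) + ‖s‖ * wtNorm (wallMw Tw) := by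
  have i1 := (integrable_abs_mul_wt hP.integrable)
  have i2 := (integrable_wallMw_wt hTw).const_mul ‖s‖
  have i3 := i1.add i2
  have h := wtNorm_le (g := wallSource δ₁ δ₂ fL fR Tw s)
    (g₁ := fun v => |glue fL fR v| + ‖s‖ * wallMw Tw v)
    (i3.congr (Filter.Eventually.of_forall fun v => by simp only [Pi.add_apply]; ring)) ?_
  · refine h.trans (le_of_eq ?_)
    rw [← wtNorm_wallMw hTw, wtNorm, ← integral_const_mul, ← integral_add i1 i2]
    congr 1; funext v; ring
  · intro v
    have hM := wallMw_nonneg hTw v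
    rw [wallSource_eq]
    refine (abs_add_le _ _).trans (add_le_add ?_ ?_)
    · rw [abs_mul, abs_of_nonneg V.nonneg₁]
      exact mul_le_of_le_one_left (abs_nonneg _) V.le_one₁
    · rw [abs_mul, abs_mul, abs_of_nonneg V.nonneg₂, abs_of_nonneg hM]
      calc _ ≤ 1 * (‖s‖ * wallMw Tw v) := by
            gcongr
            · exact V.le_one₂
            · exact abs_ite_le_norm _ _
        _ = _ := one_mul _

/-- Absolute value of the flux through a set of velocities. -/
noncomputable def absFlux (S : Set Vel) (g : Vel → ℝ) : ℝ := abs (∫ v in S, g v * |v 0|)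

theorem absFlux_nonneg (S : Set Vel) (g : Vel → ℝ) : 0 ≤ absFlux S g := abs_nonneg _

/-- The constant in the estimates below. -/
noncomputable def estConst (fL fR : Vel → ℝ) (Tw : Fin 2 → ℝ) (d c C : ℝ) : ℝ :=
  1 + 2 * d⁻¹ * (wtNorm (glue fL fR) + wtNorm (wallMw Tw)) +
    (2 * d⁻¹ + 1) * (2 * C * singMass c) + C * gwMass c +
    absFlux negHalf fR + absFlux posHalf fL

theorem one_le_estConst (hd : 0 < d) (hC : 0 ≤ C) : 1 ≤ estConst fL fR Tw d c C := by
  have h1 := wtNorm_nonneg (glue fL fR)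
  have h2 := wtNorm_nonneg (wallMw Tw)
  have h3 := singMass_nonneg c
  have h4 := gwMass_nonneg c
  have h5 := absFlux_nonneg negHalf fR
  have h6 := absFlux_nonneg posHalf fL
  have : 0 ≤ 2 * d⁻¹ * (wtNorm (glue fL fR) + wtNorm (wallMw Tw)) +
    (2 * d⁻¹ + 1) * (2 * C * singMass c) + C * gwMass c +
    absFlux negHalf fR + absFlux posHalf fL := by positivity
  unfold estConst; linarith

/-- The moments of a solution are close to the limit moments. -/
theorem norm_moments_profile_sub_limit_le (hTw : ∀ i, 0 < Tw i) (hP : PropP1 fL fR)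
    (V : ValidParams d τ δ₁ δ₂ δ₃) (hc : 0 < c) (hC : 0 ≤ C)
    (hw : ∀ v, wallMw Tw v ≤ C * gw c v) {Q : ℝ → Vel → ℝ}
    (hQm : Measurable (Function.uncurry Q)) (hQ : ∀ y v, |Q y v| ≤ C * gw c v) (s : ℝ × ℝ)
    {x : ℝ} (hx : x ∈ Icc (0 : ℝ) 1) :
    ‖moments (profile τ δ₃ (wallSource δ₁ δ₂ fL fR Tw s) Q x) - limitMoments Tw‖ ≤
      estConst fL fR Tw d c C * (δ₁ + ‖s - (1 / 2, 1 / 2)‖ + (Real.sqrt τ)⁻¹) := by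
  have hτ := V.tau_pos
  have hd := V.d_pos
  have i1 := integrable_wallSource_wt (δ₁ := δ₁) (δ₂ := δ₂) hTw hP s
  have i2 : Integrable (fun v => 1 / 2 * (1 - δ₃) * wallMw Tw v * wt v) := by
    simp_rw [mul_assoc (1 / 2 * (1 - δ₃))]
    exact (integrable_wallMw_wt hTw).const_mul _
  have hLm : Measurable (Function.uncurry fun _ : ℝ => limitProfile δ₃ Tw) :=
    measurable_limitProfile.comp measurable_snd
  have hLb : ∀ y v, |(fun _ : ℝ => limitProfile δ₃ Tw) y v| ≤ C * gw c v :=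
    fun _ v => abs_limitProfile_le hTw V.nonneg₃ hw v
  -- The limit profile solves the transport problem with itself as source, so the difference is
  -- again a profile. Its source is not small, but enters only with the factor τ^{-1/2}.
  have e1 (v : Vel) : profile τ δ₃ (wallSource δ₁ δ₂ fL fR Tw s) Q x v - limitProfile δ₃ Tw v =
      profile τ δ₃ (fun v => wallSource δ₁ δ₂ fL fR Tw s v - 1 / 2 * (1 - δ₃) * wallMw Tw v)
        (fun y v => Q y v - limitProfile δ₃ Tw v) x v := by
    have h1 := profile_sub (τ := τ) (δ₃ := δ₃) (h := wallSource δ₁ δ₂ fL fR Tw s)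
      (h' := fun v => 1 / 2 * (1 - δ₃) * wallMw Tw v) hQm hQ hLm hLb x v
    rw [h1, profile_const hτ hd V.nonneg₃ V.le₃ (limitProfile_eq V.nonneg₃)]
  have hQb : ∀ y v, |(fun y v => Q y v - limitProfile δ₃ Tw v) y v| ≤ (2 * C) * gw c v :=
    fun y v => by
      have := (abs_sub (Q y v) (limitProfile δ₃ Tw v)).trans (add_le_add (hQ y v) (hLb y v))
      linarith
  have ih : Integrable (fun v => (wallSource δ₁ δ₂ fL fR Tw s v -
      1 / 2 * (1 - δ₃) * wallMw Tw v) * wt v) :=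
    (i1.sub i2).congr (Filter.Eventually.of_forall fun v => by simp only [Pi.sub_apply]; ring)
  have iQ := integrable_profile_wt hτ hd V.nonneg₃ V.le₃ hc hQm hQ i1 hx
  have iL := integrable_limitProfile_wt hTw V.nonneg₃
  rw [← moments_limitProfile hTw V.nonneg₃, ← moments_sub iQ iL]
  have id : Integrable (fun v => (profile τ δ₃ (wallSource δ₁ δ₂ fL fR Tw s) Q x v -
      limitProfile δ₃ Tw v) * wt v) :=
    (iQ.sub iL).congr (Filter.Eventually.of_forall fun v => by simp only [Pi.sub_apply]; ring)
  refine (norm_moments_le id).trans ?_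
  simp_rw [e1]
  refine (integral_abs_profile_wt_le hτ hd V.nonneg₃ V.le₃ hc hQb ih hx).trans ?_
  have h1 := wtNorm_wallSource_sub_limit_le hTw hP V s
  have p1 := wtNorm_nonneg (glue fL fR)
  have p2 := wtNorm_nonneg (wallMw Tw)
  have p3 := singMass_nonneg c
  have p4 := gwMass_nonneg c
  have p5 := V.nonneg₁
  set n := ‖s - (1 / 2, 1 / 2)‖
  have p6 : 0 ≤ n := norm_nonneg _
  set r := (Real.sqrt τ)⁻¹
  have p7 : 0 ≤ r := by positivity
  have h2 : 2 * d⁻¹ * wtNorm (fun v => wallSource δ₁ δ₂ fL fR Tw s v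
      - 1 / 2 * (1 - δ₃) * wallMw Tw v) ≤
      2 * d⁻¹ * (wtNorm (glue fL fR) + wtNorm (wallMw Tw)) * (δ₁ + n) := by
    rw [mul_assoc (2 * d⁻¹)]
    refine mul_le_mul_of_nonneg_left (h1.trans ?_) (by positivity)
    nlinarith [mul_nonneg p1 p6]
  calc _ ≤ 2 * d⁻¹ * (wtNorm (glue fL fR) + wtNorm (wallMw Tw)) * (δ₁ + n) +
        (2 * d⁻¹ + 1) * (2 * C * singMass c) * r := by
        have : (2 * d⁻¹ + 1) * (r * (2 * C * singMass c)) =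
          (2 * d⁻¹ + 1) * (2 * C * singMass c) * r := by ring
        rw [this]; exact add_le_add_left h2 _
    _ ≤ estConst fL fR Tw d c C * (δ₁ + n) + estConst fL fR Tw d c C * r := by
        have q1 : 0 ≤ 2 * d⁻¹ * (wtNorm (glue fL fR) + wtNorm (wallMw Tw)) := by positivity
        have q2 : 0 ≤ (2 * d⁻¹ + 1) * (2 * C * singMass c) := by positivity
        have q3 : 0 ≤ C * gwMass c := by positivity
        have q4 := absFlux_nonneg negHalf fR
        have q5 := absFlux_nonneg posHalf fL
        unfold estConst
        gcongr <;> linarith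
    _ = _ := by ring

/-- Lipschitz dependence of the moments on the source and the wall coefficients. -/
theorem norm_moments_profile_sub_le (hTw : ∀ i, 0 < Tw i) (hP : PropP1 fL fR)
    (V : ValidParams d τ δ₁ δ₂ δ₃) (hc : 0 < c) (hC : 0 ≤ C) {Q Q' : ℝ → Vel → ℝ}
    (hQm : Measurable (Function.uncurry Q)) (hQ : ∀ y v, |Q y v| ≤ C * gw c v)
    (hQm' : Measurable (Function.uncurry Q')) (hQ' : ∀ y v, |Q' y v| ≤ C * gw c v) {D : ℝ}
    (hD : 0 ≤ D) (hQQ : ∀ y v, |Q y v - Q' y v| ≤ (D * C) * gw c v) (s s' : ℝ × ℝ)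
    {x : ℝ} (hx : x ∈ Icc (0 : ℝ) 1) :
    ‖moments (profile τ δ₃ (wallSource δ₁ δ₂ fL fR Tw s) Q x) -
      moments (profile τ δ₃ (wallSource δ₁ δ₂ fL fR Tw s') Q' x)‖ ≤
      estConst fL fR Tw d c C * (‖s - s'‖ + (Real.sqrt τ)⁻¹ * D) := by
  have hτ := V.tau_pos
  have hd := V.d_pos
  have i1 := integrable_wallSource_wt (δ₁ := δ₁) (δ₂ := δ₂) hTw hP s
  have i2 := integrable_wallSource_wt (δ₁ := δ₁) (δ₂ := δ₂) hTw hP s'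
  have ih : Integrable (fun v => (wallSource δ₁ δ₂ fL fR Tw s v -
      wallSource δ₁ δ₂ fL fR Tw s' v) * wt v) :=
    (i1.sub i2).congr (Filter.Eventually.of_forall fun v => by simp only [Pi.sub_apply]; ring)
  have iQ := integrable_profile_wt hτ hd V.nonneg₃ V.le₃ hc hQm hQ i1 hx
  have iL := integrable_profile_wt hτ hd V.nonneg₃ V.le₃ hc hQm' hQ' i2 hx
  rw [← moments_sub iQ iL]
  have id : Integrable (fun v => (profile τ δ₃ (wallSource δ₁ δ₂ fL fR Tw s) Q x v -
      profile τ δ₃ (wallSource δ₁ δ₂ fL fR Tw s') Q' x v) * wt v) :=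
    (iQ.sub iL).congr (Filter.Eventually.of_forall fun v => by simp only [Pi.sub_apply]; ring)
  refine (norm_moments_le id).trans ?_
  simp_rw [← profile_sub (τ := τ) (δ₃ := δ₃) (h := wallSource δ₁ δ₂ fL fR Tw s)
      (h' := wallSource δ₁ δ₂ fL fR Tw s') hQm hQ hQm' hQ' x]
  refine (integral_abs_profile_wt_le hτ hd V.nonneg₃ V.le₃ hc hQQ ih hx).trans ?_
  have h1 := wtNorm_wallSource_sub_le (fL := fL) (fR := fR) hTw V s s'
  have p1 := wtNorm_nonneg (glue fL fR)
  have p2 := wtNorm_nonneg (wallMw Tw)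
  have p3 := singMass_nonneg c
  have p4 := gwMass_nonneg c
  set n := ‖s - s'‖
  have p6 : 0 ≤ n := norm_nonneg _
  set r := (Real.sqrt τ)⁻¹
  have p7 : 0 ≤ r := by positivity
  have h2 : 2 * d⁻¹ * wtNorm (fun v => wallSource δ₁ δ₂ fL fR Tw s v -
      wallSource δ₁ δ₂ fL fR Tw s' v) ≤
      2 * d⁻¹ * (wtNorm (glue fL fR) + wtNorm (wallMw Tw)) * n := by
    rw [mul_assoc (2 * d⁻¹)]
    refine mul_le_mul_of_nonneg_left (h1.trans ?_) (by positivity)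
    nlinarith [mul_nonneg p1 p6]
  calc _ ≤ 2 * d⁻¹ * (wtNorm (glue fL fR) + wtNorm (wallMw Tw)) * n +
        (2 * d⁻¹ + 1) * (2 * C * singMass c) * (r * D) := by
        refine add_le_add h2 ?_
        have : 0 ≤ (2 * d⁻¹ + 1) * (C * singMass c) * (r * D) := by positivity
        linarith
    _ ≤ estConst fL fR Tw d c C * n + estConst fL fR Tw d c C * (r * D) := by
        have q1 : 0 ≤ 2 * d⁻¹ * (wtNorm (glue fL fR) + wtNorm (wallMw Tw)) := by positivity
        have q2 : 0 ≤ (2 * d⁻¹ + 1) * (2 * C * singMass c) := by positivity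
        have q3 : 0 ≤ C * gwMass c := by positivity
        have q4 := absFlux_nonneg negHalf fR
        have q5 := absFlux_nonneg posHalf fL
        unfold estConst
        gcongr <;> linarith
    _ = _ := by ring

/-- Since (1 - δ₁)/(2 - δ₁) differs from 1/2 by δ₁/(2(2 - δ₁)), the deviation splits into a term of
order δ₁ and the collision term, for which τ⁻¹ ≤ τ^{-1/2} is enough. -/
theorem abs_flux_sub_half_le (V : ValidParams d τ δ₁ δ₂ δ₃) {φ b A n : ℝ} (hφ : 1 + |φ| ≤ A)
    (hb : |b| ≤ A * n) : |(1 - δ₁) / (2 - δ₁) + δ₁ / (2 - δ₁) * φ - 1 / (τ * (2 - δ₁)) * b - 1 / 2| ≤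
      A * (δ₁ + (Real.sqrt τ)⁻¹ * n) := by
  have h1 := V.nonneg₁
  have h2 : 1 ≤ 2 - δ₁ := by linarith [V.le_one₁]
  have e : (1 - δ₁) / (2 - δ₁) + δ₁ / (2 - δ₁) * φ - 1 / (τ * (2 - δ₁)) * b - 1 / 2 =
      δ₁ / (2 - δ₁) * (φ - 1 / 2) - 1 / (τ * (2 - δ₁)) * b := by
    have : 2 - δ₁ ≠ 0 := by linarith
    have hτ := V.tau_pos.ne'
    field_simp; ring
  have h3 : δ₁ / (2 - δ₁) ≤ δ₁ := div_le_self h1 h2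
  have h4 : 0 ≤ δ₁ / (2 - δ₁) := by positivity
  rw [e]
  have h5 : |φ - 1 / 2| ≤ A := by
    have := abs_sub φ (1 / 2)
    rw [abs_of_pos (by norm_num : (0 : ℝ) < 1 / 2)] at this
    linarith
  calc _ ≤ δ₁ / (2 - δ₁) * |φ - 1 / 2| + 1 / (τ * (2 - δ₁)) * |b| := by
        refine (abs_sub _ _).trans (le_of_eq ?_)
        rw [abs_mul, abs_mul, abs_of_nonneg h4, abs_of_nonneg V.coeff_nonneg]
    _ ≤ δ₁ * A + (Real.sqrt τ)⁻¹ * (A * n) := by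
        refine add_le_add (mul_le_mul h3 h5 (abs_nonneg _) h1)
          (mul_le_mul V.coeff_le hb (abs_nonneg _) (by positivity))
    _ = _ := by ring

/-- The new wall coefficients are close to one half. -/
theorem norm_newFlux_sub_half_le (hTw : ∀ i, 0 < Tw i) (hP : PropP1 fL fR)
    (V : ValidParams d τ δ₁ δ₂ δ₃) (hc : 0 < c) (hC : 0 ≤ C) {Q : ℝ → Vel → ℝ}
    (hQ : ∀ y v, |Q y v| ≤ C * gw c v) (s : ℝ × ℝ) :
    ‖newFlux τ δ₁ δ₃ fL fR (wallSource δ₁ δ₂ fL fR Tw s) Q - (1 / 2, 1 / 2)‖ ≤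
      estConst fL fR Tw d c C * (δ₁ + (Real.sqrt τ)⁻¹ * (1 + ‖s‖)) := by
  have hτ := V.tau_pos
  have hd := V.d_pos
  have i1 := integrable_wallSource_wt (δ₁ := δ₁) (δ₂ := δ₂) hTw hP s
  have h1 := wtNorm_wallSource_le hTw hP V s
  have p1 := wtNorm_nonneg (glue fL fR)
  have p2 := wtNorm_nonneg (wallMw Tw)
  have p3 := singMass_nonneg c
  have p4 := gwMass_nonneg c
  have p5 := norm_nonneg s
  have q1 : 0 ≤ 2 * d⁻¹ * (wtNorm (glue fL fR) + wtNorm (wallMw Tw)) := by positivity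
  have q2 : 0 ≤ (2 * d⁻¹ + 1) * (2 * C * singMass c) := by positivity
  have q3 : 0 ≤ C * gwMass c := by positivity
  have q4 := absFlux_nonneg negHalf fR
  have q5 := absFlux_nonneg posHalf fL
  -- The collision balance is only bounded, not small; the smallness comes from its prefactor 1/(τ(2
  -- - δ₁)).
  have hb (S : Set Vel) : |balance τ δ₃ (wallSource δ₁ δ₂ fL fR Tw s) Q S| ≤
      estConst fL fR Tw d c C * (1 + ‖s‖) := by
    refine (abs_balance_le hτ hd V.nonneg₃ V.le₃ hc hC hQ i1 S).trans ?_
    have h2 : 2 * d⁻¹ * wtNorm (wallSource δ₁ δ₂ fL fR Tw s) ≤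
        2 * d⁻¹ * (wtNorm (glue fL fR) + wtNorm (wallMw Tw)) * (1 + ‖s‖) := by
      rw [mul_assoc (2 * d⁻¹)]
      refine mul_le_mul_of_nonneg_left (h1.trans ?_) (by positivity)
      nlinarith [mul_nonneg p1 p5]
    have h3 : (2 * d⁻¹ + 1) * ((Real.sqrt τ)⁻¹ * (C * singMass c)) ≤
        (2 * d⁻¹ + 1) * (2 * C * singMass c) * (1 + ‖s‖) := by
      have e1 : (Real.sqrt τ)⁻¹ * (C * singMass c) ≤ C * singMass c :=
        mul_le_of_le_one_left (by positivity) V.inv_sqrt_le_one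
      have e2 : C * singMass c ≤ (2 * C * singMass c) * (1 + ‖s‖) := by
        have : 0 ≤ C * singMass c := by positivity
        nlinarith [mul_nonneg this p5]
      rw [mul_assoc (2 * d⁻¹ + 1)]
      exact mul_le_mul_of_nonneg_left (e1.trans e2) (by positivity)
    have h4 : C * gwMass c ≤ C * gwMass c * (1 + ‖s‖) := le_mul_of_one_le_right q3 (by linarith)
    have h5 : estConst fL fR Tw d c C * (1 + ‖s‖) =
        (1 + absFlux negHalf fR + absFlux posHalf fL) * (1 + ‖s‖) +
        2 * d⁻¹ * (wtNorm (glue fL fR) + wtNorm (wallMw Tw)) * (1 + ‖s‖) +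
        (2 * d⁻¹ + 1) * (2 * C * singMass c) * (1 + ‖s‖) + C * gwMass c * (1 + ‖s‖) := by
      unfold estConst; ring
    have h6 : 0 ≤ (1 + absFlux negHalf fR + absFlux posHalf fL)
      * (1 + ‖s‖) := by positivity
    have h7 : wtNorm (wallSource δ₁ δ₂ fL fR Tw s) =
      ∫ v, |wallSource δ₁ δ₂ fL fR Tw s v| * wt v := rfl
    rw [← h7]
    linarith
  rw [Prod.norm_def]
  refine max_le ?_ ?_
  · exact abs_flux_sub_half_le V
      (by change 1 + absFlux negHalf fR ≤ _; unfold estConst; linarith) (hb _)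
  · exact abs_flux_sub_half_le V
      (by change 1 + absFlux posHalf fL ≤ _; unfold estConst; linarith) (hb _)

/-- Lipschitz dependence of the new wall coefficients. -/
theorem norm_newFlux_sub_le (hTw : ∀ i, 0 < Tw i) (hP : PropP1 fL fR)
    (V : ValidParams d τ δ₁ δ₂ δ₃) (hc : 0 < c) (hC : 0 ≤ C) {Q Q' : ℝ → Vel → ℝ}
    (hQm : Measurable (Function.uncurry Q)) (hQ : ∀ y v, |Q y v| ≤ C * gw c v)
    (hQm' : Measurable (Function.uncurry Q')) (hQ' : ∀ y v, |Q' y v| ≤ C * gw c v) {D : ℝ}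
    (hD : 0 ≤ D) (hQQ : ∀ y v, |Q y v - Q' y v| ≤ (D * C) * gw c v) (s s' : ℝ × ℝ) :
    ‖newFlux τ δ₁ δ₃ fL fR (wallSource δ₁ δ₂ fL fR Tw s) Q -
      newFlux τ δ₁ δ₃ fL fR (wallSource δ₁ δ₂ fL fR Tw s') Q'‖ ≤
      estConst fL fR Tw d c C * ((Real.sqrt τ)⁻¹ * (‖s - s'‖ + D)) := by
  have hτ := V.tau_pos
  have hd := V.d_pos
  have i1 := integrable_wallSource_wt (δ₁ := δ₁) (δ₂ := δ₂) hTw hP s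
  have i2 := integrable_wallSource_wt (δ₁ := δ₁) (δ₂ := δ₂) hTw hP s'
  have ih : Integrable (fun v => (wallSource δ₁ δ₂ fL fR Tw s v -
      wallSource δ₁ δ₂ fL fR Tw s' v) * wt v) :=
    (i1.sub i2).congr (Filter.Eventually.of_forall fun v => by simp only [Pi.sub_apply]; ring)
  have h1 := wtNorm_wallSource_sub_le (fL := fL) (fR := fR) hTw V s s'
  have p1 := wtNorm_nonneg (glue fL fR)
  have p2 := wtNorm_nonneg (wallMw Tw)
  have p3 := singMass_nonneg c
  have p4 := gwMass_nonneg c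
  have p5 := norm_nonneg (s - s')
  have q1 : 0 ≤ 2 * d⁻¹ * (wtNorm (glue fL fR) + wtNorm (wallMw Tw)) := by positivity
  have q2 : 0 ≤ (2 * d⁻¹ + 1) * (2 * C * singMass c) := by positivity
  have q3 : 0 ≤ C * gwMass c := by positivity
  have q4 := absFlux_nonneg negHalf fR
  have q5 := absFlux_nonneg posHalf fL
  have hb (S : Set Vel) : |balance τ δ₃ (wallSource δ₁ δ₂ fL fR Tw s) Q S -
      balance τ δ₃ (wallSource δ₁ δ₂ fL fR Tw s') Q' S| ≤
      estConst fL fR Tw d c C * (‖s - s'‖ + D) := by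
    rw [← balance_sub hτ hd V.nonneg₃ V.le₃ hc hC hQm hQ i1 hQm' hQ' i2]
    refine (abs_balance_le hτ hd V.nonneg₃ V.le₃ hc (by positivity) hQQ ih S).trans ?_
    have h2 : 2 * d⁻¹ * wtNorm (fun v => wallSource δ₁ δ₂ fL fR Tw s v -
        wallSource δ₁ δ₂ fL fR Tw s' v) ≤
        2 * d⁻¹ * (wtNorm (glue fL fR) + wtNorm (wallMw Tw)) * (‖s - s'‖ + D) := by
      rw [mul_assoc (2 * d⁻¹)]
      refine mul_le_mul_of_nonneg_left (h1.trans ?_) (by positivity)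
      nlinarith [mul_nonneg p1 p5, mul_nonneg p1 hD, mul_nonneg p2 hD]
    have h3 : (2 * d⁻¹ + 1) * ((Real.sqrt τ)⁻¹ * (D * C * singMass c)) ≤
        (2 * d⁻¹ + 1) * (2 * C * singMass c) * (‖s - s'‖ + D) := by
      have e1 : (Real.sqrt τ)⁻¹ * (D * C * singMass c) ≤ D * C * singMass c :=
        mul_le_of_le_one_left (by positivity) V.inv_sqrt_le_one
      have e2 : D * C * singMass c ≤ (2 * C * singMass c) * (‖s - s'‖ + D) := by
        have : 0 ≤ C * singMass c := by positivity
        nlinarith [mul_nonneg this p5, mul_nonneg this hD]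
      rw [mul_assoc (2 * d⁻¹ + 1)]
      exact mul_le_mul_of_nonneg_left (e1.trans e2) (by positivity)
    have h4 : D * C * gwMass c ≤ C * gwMass c * (‖s - s'‖ + D) := by
      nlinarith [mul_nonneg q3 p5]
    have h5 : estConst fL fR Tw d c C * (‖s - s'‖ + D) =
        (1 + absFlux negHalf fR + absFlux posHalf fL) * (‖s - s'‖ + D) +
        2 * d⁻¹ * (wtNorm (glue fL fR) + wtNorm (wallMw Tw)) * (‖s - s'‖ + D) +
        (2 * d⁻¹ + 1) * (2 * C * singMass c) * (‖s - s'‖ + D) +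
        C * gwMass c * (‖s - s'‖ + D) := by
      unfold estConst; ring
    have h6 : 0 ≤ (1 + absFlux negHalf fR + absFlux posHalf fL)
      * (‖s - s'‖ + D) := by positivity
    have h7 : wtNorm (fun v => wallSource δ₁ δ₂ fL fR Tw s v -
      wallSource δ₁ δ₂ fL fR Tw s' v) = ∫ v, |wallSource δ₁ δ₂ fL fR Tw s v -
      wallSource δ₁ δ₂ fL fR Tw s' v| * wt v := rfl
    rw [← h7]
    linarith
  have hS (p q b b' : ℝ) (h : |b - b'| ≤ estConst fL fR Tw d c C * (‖s - s'‖ + D)) :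
      |(p + q - 1 / (τ * (2 - δ₁)) * b) - (p + q - 1 / (τ * (2 - δ₁)) * b')| ≤
      estConst fL fR Tw d c C * ((Real.sqrt τ)⁻¹ * (‖s - s'‖ + D)) := by
    have e : (p + q - 1 / (τ * (2 - δ₁)) * b) - (p + q - 1 / (τ * (2 - δ₁)) * b') =
      -(1 / (τ * (2 - δ₁)) * (b - b')) := by ring
    rw [e, abs_neg, abs_mul, abs_of_nonneg V.coeff_nonneg]
    calc _ ≤ (Real.sqrt τ)⁻¹ * (estConst fL fR Tw d c C * (‖s - s'‖ + D)) :=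
          mul_le_mul V.coeff_le h (abs_nonneg _) (by positivity)
      _ = _ := by ring
  rw [Prod.norm_def]
  exact max_le (hS _ _ _ _ (hb _)) (hS _ _ _ _ (hb _))

end

/-! ### The fixed point for moments and wall coefficients. -/

/-- The collision source of a field of moments. -/
noncomputable def fieldSource (ν a B c : ℝ) (m : C(Icc (0 : ℝ) 1, Moments)) (y : ℝ) (v : Vel) : ℝ :=
  gaussD ν a B c (IccExtend zero_le_one m y) v

/-- Moments and wall coefficients of a solution. -/
def IsSolutionPair (ν a B c τ δ₁ δ₂ δ₃ : ℝ) (fL fR : Vel → ℝ) (Tw : Fin 2 → ℝ)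
    (m : C(Icc (0 : ℝ) 1, Moments)) (s : ℝ × ℝ) : Prop :=
  s = newFlux τ δ₁ δ₃ fL fR (wallSource δ₁ δ₂ fL fR Tw s) (fieldSource ν a B c m) ∧
    ∀ x : Icc (0 : ℝ) 1, m x =
      moments (profile τ δ₃ (wallSource δ₁ δ₂ fL fR Tw s) (fieldSource ν a B c m) x)

theorem measurable_fieldSource {ν a B c : ℝ} (ha : 0 < a) (hc : 0 < c)
    (m : C(Icc (0 : ℝ) 1, Moments)) : Measurable (Function.uncurry (fieldSource ν a B c m)) := by
  have h : Continuous (IccExtend (zero_le_one (α := ℝ)) m) := m.continuous.Icc_extend'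
  have h2 : Measurable (fun p : ℝ × Vel => ((IccExtend zero_le_one m p.1, p.2) : Moments × Vel)) :=
    (h.measurable.comp measurable_fst).prodMk measurable_snd
  have h3 := (measurable_gaussD (ν := ν) (B := B) ha hc).comp h2
  have e : Function.uncurry (fieldSource ν a B c m) =
      (fun p : Moments × Vel => gaussD ν a B c p.1 p.2) ∘
        fun p : ℝ × Vel => ((IccExtend zero_le_one m p.1, p.2) : Moments × Vel) := by
    funext p; rfl
  rw [e]; exact h3

/-- Existence and uniqueness of the moments and wall coefficients for weak collisions and weak
inflow. -/
theorem exists_solutionPair {Tw : Fin 2 → ℝ} (hTw : ∀ i, 0 < Tw i) {fL fR : Vel → ℝ}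
    (hP : PropP1 fL fR) {ν a B c d η : ℝ} (ha : 0 < a) (hc : 0 < c) (hd : 0 < d) (hη : 0 < η)
    (hball : ∀ m : Moments, (∀ k l, m k l = m l k) → ‖m - limitMoments Tw‖ ≤ η →
      m ∈ admissible ν a B c) :
    ∃ K₁ > (0 : ℝ), ∃ ε > (0 : ℝ), ∀ τ δ₁ δ₂ δ₃ : ℝ, ValidParams d τ δ₁ δ₂ δ₃ → K₁ < τ → δ₁ < ε →
      (∃ (m : C(Icc (0 : ℝ) 1, Moments)) (s : ℝ × ℝ),
        IsSolutionPair ν a B c τ δ₁ δ₂ δ₃ fL fR Tw m s ∧ 0 ≤ s.1 ∧ 0 ≤ s.2 ∧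
          ∀ x, m x ∈ admissible ν a B c ∧ ‖m x - limitMoments Tw‖ ≤ η) ∧
      ∀ (m m' : C(Icc (0 : ℝ) 1, Moments)) (s s' : ℝ × ℝ),
        (∀ x, m x ∈ admissible ν a B c) → (∀ x, m' x ∈ admissible ν a B c) →
        IsSolutionPair ν a B c τ δ₁ δ₂ δ₃ fL fR Tw m s →
        IsSolutionPair ν a B c τ δ₁ δ₂ δ₃ fL fR Tw m' s' → m = m' ∧ s = s' := by
  obtain ⟨c', hc', C, hC, -, hG1, hG2, hG3⟩ := exists_gaussD_bounds hTw ν B ha hc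
  set A := estConst fL fR Tw d c' C with hA
  have hA1 : 1 ≤ A := one_le_estConst hd hC.le
  have hA0 : 0 < A := by linarith
  -- The first entry gives the contraction and keeps the wall coefficients near 1/2; the second
  -- keeps the moments within η of the limit. The square of A appears because the moments amplify by
  -- A an error in s that already carries a factor A.
  set ε := min (1 / (8 * A ^ 2)) (η / (8 * A ^ 2)) with hε
  have hε0 : 0 < ε := by positivity
  have hε1 : ε ≤ 1 / (8 * A ^ 2) := min_le_left _ _
  have hε2 : ε ≤ η / (8 * A ^ 2) := min_le_right _ _
  have hAε : A ^ 2 * ε ≤ 1 / 8 := by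
    calc _ ≤ A ^ 2 * (1 / (8 * A ^ 2)) := by gcongr
      _ = _ := by field_simp
  have hAε' : A ^ 2 * ε ≤ η / 8 := by
    calc _ ≤ A ^ 2 * (η / (8 * A ^ 2)) := by gcongr
      _ = _ := by field_simp
  -- The threshold on τ says precisely that τ^{-1/2} < ε.
  refine ⟨(1 / ε) ^ 2, by positivity, ε, hε0, fun τ δ₁ δ₂ δ₃ V hK hδ => ?_⟩
  set r := (Real.sqrt τ)⁻¹ with hr
  have hr0 : 0 ≤ r := by positivity
  have hrε : r ≤ ε := by
    have : 1 / ε ≤ Real.sqrt τ := Real.le_sqrt_of_sq_le hK.le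
    rw [hr, inv_le_comm₀ (Real.sqrt_pos.2 V.tau_pos) hε0, ← one_div]
    exact this
  have hδ0 := V.nonneg₁
  have hQm (m) := measurable_fieldSource (ν := ν) (B := B) ha hc m
  have hQb (m) : ∀ y v, |fieldSource ν a B c m y v| ≤ C * gw c' v := fun y v => hG1 _ v
  have hQQ (m m' : C(Icc (0 : ℝ) 1, Moments)) (h : ∀ x, m x ∈ admissible ν a B c)
      (h' : ∀ x, m' x ∈ admissible ν a B c) (y : ℝ) (v : Vel) :
      |fieldSource ν a B c m y v - fieldSource ν a B c m' y v| ≤ (‖m - m'‖ * C) * gw c' v := by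
    refine (hG2 _ (h _) _ (h' _) v).trans ?_
    have h1 : ‖IccExtend zero_le_one m y - IccExtend zero_le_one m' y‖ ≤ ‖m - m'‖ :=
      (m - m').norm_coe_le_norm (projIcc 0 1 zero_le_one y)
    have := gw_pos c' v
    exact mul_le_mul_of_nonneg_right (mul_le_mul_of_nonneg_right h1 hC.le) this.le
  -- The iteration is sequential: the new moments use the new wall coefficients. A simultaneous
  -- update would not obviously contract, because the moments depend on s with the large constant A.
  have hex : ∀ p : C(Icc (0 : ℝ) 1, Moments) × (ℝ × ℝ),
      ∃ p' : C(Icc (0 : ℝ) 1, Moments) × (ℝ × ℝ),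
      p'.2 = newFlux τ δ₁ δ₃ fL fR (wallSource δ₁ δ₂ fL fR Tw p.2) (fieldSource ν a B c p.1) ∧
      ∀ x, p'.1 x =
        moments (profile τ δ₃ (wallSource δ₁ δ₂ fL fR Tw p'.2) (fieldSource ν a B c p.1) x) := by
    intro p
    exact ⟨⟨⟨_, continuous_moments_profile V.tau_pos hd V.nonneg₃ V.le₃ hc' (hQm p.1) (hQb p.1)
      (integrable_wallSource_wt hTw hP (newFlux τ δ₁ δ₃ fL fR (wallSource δ₁ δ₂ fL fR Tw p.2)
        (fieldSource ν a B c p.1)))⟩, _⟩, rfl, fun x => rfl⟩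
  choose Ψ hΨ2 hΨ1 using hex
  have hfix (m : C(Icc (0 : ℝ) 1, Moments)) (s : ℝ × ℝ) :
      IsSolutionPair ν a B c τ δ₁ δ₂ δ₃ fL fR Tw m s ↔ Ψ (m, s) = (m, s) := by
    constructor
    · rintro ⟨h1, h2⟩
      have e2 : (Ψ (m, s)).2 = s := by rw [hΨ2]; exact h1.symm
      refine Prod.ext ?_ e2
      ext1 x
      rw [hΨ1, e2]; exact (h2 x).symm
    · intro h
      have e1 := hΨ1 (m, s)
      have e2 := hΨ2 (m, s)
      rw [h] at e1 e2
      exact ⟨e2, e1⟩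
  -- Only admissibility is required, with no closeness to the limit and no bound on s; this is what
  -- gives uniqueness in the full class.
  have hcontr (p p' : C(Icc (0 : ℝ) 1, Moments) × (ℝ × ℝ)) (h : ∀ x, p.1 x ∈ admissible ν a B c)
      (h' : ∀ x, p'.1 x ∈ admissible ν a B c) : dist (Ψ p) (Ψ p') ≤ 1 / 2 * dist p p' := by
    set D := dist p p' with hD
    have hD0 : 0 ≤ D := dist_nonneg
    have d1 : ‖p.1 - p'.1‖ ≤ D := by
      rw [← dist_eq_norm, hD, Prod.dist_eq]; exact le_max_left _ _
    have d2 : ‖p.2 - p'.2‖ ≤ D := by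
      rw [← dist_eq_norm, hD, Prod.dist_eq]; exact le_max_right _ _
    have s1 : dist (Ψ p).2 (Ψ p').2 ≤ A * (r * (2 * D)) := by
      rw [dist_eq_norm, hΨ2, hΨ2]
      refine (norm_newFlux_sub_le hTw hP V hc' hC.le (hQm _) (hQb _) (hQm _) (hQb _)
        (norm_nonneg _) (hQQ _ _ h h') _ _).trans ?_
      gcongr
      linarith
    have s2 : dist (Ψ p).1 (Ψ p').1 ≤ A * (A * (r * (2 * D)) + r * D) := by
      rw [ContinuousMap.dist_le (by positivity)]
      intro x
      rw [dist_eq_norm, hΨ1, hΨ1]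
      refine (norm_moments_profile_sub_le hTw hP V hc' hC.le (hQm _) (hQb _) (hQm _) (hQb _)
        (norm_nonneg _) (hQQ _ _ h h') _ _ x.2).trans ?_
      rw [dist_eq_norm] at s1
      gcongr
    have s3 : A ^ 2 * r ≤ 1 / 8 := le_trans (by gcongr) hAε
    have s4 : A * r ≤ 1 / 8 := by
      refine le_trans ?_ s3
      nlinarith [mul_nonneg hA0.le hr0]
    rw [Prod.dist_eq]
    refine max_le (s2.trans ?_) (s1.trans ?_)
    · have e : A * (A * (r * (2 * D)) + r * D) = (2 * (A ^ 2 * r) + A * r) * D := by ring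
      rw [e]
      exact mul_le_mul_of_nonneg_right (by linarith) hD0
    · have e : A * (r * (2 * D)) = (2 * (A * r)) * D := by ring
      rw [e]
      exact mul_le_mul_of_nonneg_right (by linarith) hD0
  refine ⟨?_, fun m m' s s' hm hm' hs hs' => ?_⟩
  -- Radius 1/2 around (1/2, 1/2) forces nonnegative wall coefficients, hence a nonnegative
  -- solution.
  · set S : Set (C(Icc (0 : ℝ) 1, Moments) × (ℝ × ℝ)) :=
      {p | (∀ x k l, p.1 x k l = p.1 x l k) ∧ (∀ x, ‖p.1 x - limitMoments Tw‖ ≤ η) ∧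
        ‖p.2 - (1 / 2, 1 / 2)‖ ≤ 1 / 2} with hS
    have hScl : IsClosed S := by
      have hev (x : Icc (0 : ℝ) 1) :
          Continuous (fun p : C(Icc (0 : ℝ) 1, Moments) × (ℝ × ℝ) => p.1 x) :=
        (continuous_eval_const x).comp continuous_fst
      have hev' (x : Icc (0 : ℝ) 1) (k l : Fin 4) :
          Continuous (fun p : C(Icc (0 : ℝ) 1, Moments) × (ℝ × ℝ) => p.1 x k l) :=
        (continuous_apply_apply k l).comp (hev x)
      simp only [hS, ofPred_and, ofPred_forall]
      refine IsClosed.inter ?_ (IsClosed.inter ?_ ?_)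
      · exact isClosed_iInter fun x => isClosed_iInter fun k => isClosed_iInter fun l =>
          isClosed_eq (hev' x k l) (hev' x l k)
      · exact isClosed_iInter fun x => isClosed_le ((hev x).sub continuous_const).norm
          continuous_const
      · exact isClosed_le (by fun_prop) continuous_const
    have hSadm (p) (hp : p ∈ S) (x) : p.1 x ∈ admissible ν a B c := hball _ (hp.1 x) (hp.2.1 x)
    have hmaps : MapsTo Ψ S S := by
      intro p hp
      have hs : ‖p.2‖ ≤ 1 := by
        have h1 : ‖((1 / 2, 1 / 2) : ℝ × ℝ)‖ = 1 / 2 := by simp [Prod.norm_def]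
        have h2 := norm_add_le (p.2 - (1 / 2, 1 / 2)) (1 / 2, 1 / 2)
        rw [sub_add_cancel, h1] at h2
        linarith [hp.2.2]
      have e1 : ‖(Ψ p).2 - (1 / 2, 1 / 2)‖ ≤ A * (3 * ε) := by
        rw [hΨ2]
        refine (norm_newFlux_sub_half_le hTw hP V hc' hC.le (hQb _) _).trans ?_
        have : r * (1 + ‖p.2‖) ≤ ε * 2 := mul_le_mul hrε (by linarith) (by positivity) hε0.le
        gcongr
        linarith
      have hAle : A * ε ≤ A ^ 2 * ε := by
        have : A ≤ A ^ 2 := by nlinarith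
        gcongr
      refine ⟨fun x k l => ?_, fun x => ?_, ?_⟩
      · rw [hΨ1, moments_symm]
      · rw [hΨ1]
        refine (norm_moments_profile_sub_limit_le hTw hP V hc' hC.le hG3 (hQm _) (hQb _) _
          x.2).trans ?_
        calc _ ≤ A * (ε + A * (3 * ε) + ε) := by gcongr
          _ = 2 * (A * ε) + 3 * (A ^ 2 * ε) := by ring
          _ ≤ η := by linarith
      · linarith
    have hcon : ContractingWith (1 / 2) (hmaps.restrict Ψ S S) := by
      refine ⟨by rw [← NNReal.coe_lt_coe]; norm_num, LipschitzWith.of_dist_le_mul fun p p' => ?_⟩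
      have h := hcontr p p' (hSadm p p.2) (hSadm p' p'.2)
      have h2 : ((1 / 2 : NNReal) : ℝ) = 1 / 2 := by norm_num
      rw [h2]
      exact h
    have hx0 : ((ContinuousMap.const _ (limitMoments Tw), (1 / 2, 1 / 2)) :
        C(Icc (0 : ℝ) 1, Moments) × (ℝ × ℝ)) ∈ S := by
      refine ⟨fun x k l => moments_symm _ k l, fun x => by simpa using hη.le, by simp⟩
    obtain ⟨p, hpS, hp, -⟩ := hcon.exists_fixedPoint' hScl.isComplete hmaps hx0 (edist_ne_top _ _)
    have hs := hpS.2.2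
    have h1 := (norm_fst_le _).trans hs
    have h2 := (norm_snd_le _).trans hs
    simp only [Prod.fst_sub, Prod.snd_sub, Real.norm_eq_abs, abs_le] at h1 h2
    exact ⟨p.1, p.2, (hfix _ _).2 hp, by linarith, by linarith,
      fun x => ⟨hSadm p hpS x, hpS.2.1 x⟩⟩
  · have e := (hfix m s).1 hs
    have e' := (hfix m' s').1 hs'
    have := hcontr (m, s) (m', s') hm hm'
    rw [e, e'] at this
    have h0 : dist (m, s) (m', s') = 0 := le_antisymm (by linarith [dist_nonneg (x := (m, s)) (y := (m', s'))]) dist_nonneg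
    have := dist_eq_zero.1 h0
    exact ⟨congrArg Prod.fst this, congrArg Prod.snd this⟩

/-! ### Profiles as mild solutions. -/

section profile

variable {τ δ₃ : ℝ} {h : Vel → ℝ} {Q : ℝ → Vel → ℝ}

theorem orient_of_pos {v : Vel} (hv : 0 < v 0) : orient Q v = fun y => Q y v := by
  funext y; rw [orient, if_pos hv]

theorem orient_of_neg {v : Vel} (hv : v 0 < 0) : orient Q v = fun y => Q (1 - y) v := by
  funext y; rw [orient, if_neg (not_lt.2 hv.le)]

theorem profile_of_pos {v : Vel} (hv : 0 < v 0) (x : ℝ) :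
    profile τ δ₃ h Q x v = core (rate τ v) (inflow τ δ₃ h Q v) (fun y => Q y v) x := by
  rw [profile, orient_of_pos hv, depth, if_pos hv]

theorem profile_of_neg {v : Vel} (hv : v 0 < 0) (x : ℝ) :
    profile τ δ₃ h Q x v = core (rate τ v) (inflow τ δ₃ h Q v) (fun y => Q (1 - y) v) (1 - x) := by
  rw [profile, orient_of_neg hv, depth, if_neg (not_lt.2 hv.le)]

theorem core_eq_forward (τ b : ℝ) (v : Vel) (q : ℝ → ℝ) (x : ℝ) : core (rate τ v) b q x =
    Real.exp (-(x / (τ * |v 0|))) * b + 1 / (τ * |v 0|) *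
      ∫ y in (0 : ℝ)..x, Real.exp (-((x - y) / (τ * |v 0|))) * q y := by
  simp only [core, rate, mul_one_div]

/-- Leftward characteristics are parametrized by the distance to the right wall; substituting 1 - y
restores the position variable. -/
theorem core_eq_backward (τ b : ℝ) (v : Vel) (q : ℝ → ℝ) (x : ℝ) :
    core (rate τ v) b (fun y => q (1 - y)) (1 - x) =
    Real.exp (-((1 - x) / (τ * |v 0|))) * b + 1 / (τ * |v 0|) *
      ∫ y in x..(1 : ℝ), Real.exp (-((y - x) / (τ * |v 0|))) * q y := by
  rw [core_eq_forward]
  have := intervalIntegral.integral_comp_sub_left (a := 0) (b := 1 - x)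
    (fun y => Real.exp (-((y - x) / (τ * |v 0|))) * q y) 1
  rw [sub_sub_cancel, sub_zero] at this
  rw [← this]
  congr 3
  funext y
  congr 3
  ring

theorem profile_zero_of_pos {v : Vel} (hv : 0 < v 0) :
    profile τ δ₃ h Q 0 v = inflow τ δ₃ h Q v := by rw [profile_of_pos hv, core_zero_right]

theorem profile_one_of_neg {v : Vel} (hv : v 0 < 0) :
    profile τ δ₃ h Q 1 v = inflow τ δ₃ h Q v := by rw [profile_of_neg hv, sub_self, core_zero_right]

theorem profile_one_of_pos {v : Vel} (hv : 0 < v 0) :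
    profile τ δ₃ h Q 1 v = Real.exp (-rate τ v) * inflow τ δ₃ h Q v + exitSource τ Q v := by
  rw [profile_of_pos hv, core_split, one_mul, exitSource, orient_of_pos hv]

theorem profile_zero_of_neg {v : Vel} (hv : v 0 < 0) :
    profile τ δ₃ h Q 0 v = Real.exp (-rate τ v) * inflow τ δ₃ h Q v + exitSource τ Q v := by
  rw [profile_of_neg hv, core_split, sub_zero, one_mul, exitSource, orient_of_neg hv]

theorem inflow_eq_of_pos {d : ℝ} (hτ : 0 < τ) (hd : 0 < d) (h0 : 0 ≤ δ₃) (h1 : δ₃ ≤ 1 - d) {v : Vel}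
    (hv : 0 < v 0) : inflow τ δ₃ h Q v = h v + δ₃ * profile τ δ₃ h Q 0 (reflect v) := by
  rw [inflow_eq hτ hd h0 h1, profile_zero_of_neg (by rw [reflect_apply_zero]; linarith),
    rate_reflect]

theorem inflow_eq_of_neg {d : ℝ} (hτ : 0 < τ) (hd : 0 < d) (h0 : 0 ≤ δ₃) (h1 : δ₃ ≤ 1 - d) {v : Vel}
    (hv : v 0 < 0) : inflow τ δ₃ h Q v = h v + δ₃ * profile τ δ₃ h Q 1 (reflect v) := by
  rw [inflow_eq hτ hd h0 h1, profile_one_of_pos (by rw [reflect_apply_zero]; linarith),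
    rate_reflect]

end profile

section solution

variable {Tw : Fin 2 → ℝ} {fL fR : Vel → ℝ} {δ₁ δ₂ δ₃ τ d ν a B c : ℝ}
  {m : C(Icc (0 : ℝ) 1, Moments)} {s : ℝ × ℝ}

/-- On admissible moments the truncation is inactive, so fixed points of the truncated problem solve
the original one. -/
theorem gaussianES_eq_fieldSource {g : ℝ → Vel → ℝ} (ha : 0 < a) {y : ℝ} (hy : y ∈ Icc (0 : ℝ) 1)
    (hg : Integrable (fun v => g y v * wt v)) (hm : moments (g y) = m ⟨y, hy⟩)
    (hadm : m ⟨y, hy⟩ ∈ admissible ν a B c) (v : Vel) :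
    gaussianES ν g y v = fieldSource ν a B c m y v := by
  have h0 : density g y ≠ 0 := by
    rw [density_eq, hm]; exact (ha.trans_le hadm.2.1).ne'
  rw [gaussianES_eq ν hg h0, hm, fieldSource, IccExtend_of_mem _ _ hy, gaussD,
    indicator_of_mem hadm]

theorem boundaryRelation_profile (V : ValidParams d τ δ₁ δ₂ δ₃) (Q : ℝ → Vel → ℝ) (s : ℝ × ℝ) :
    BoundaryRelation δ₁ δ₂ δ₃ fL fR Tw s.1 s.2
      (profile τ δ₃ (wallSource δ₁ δ₂ fL fR Tw s) Q) := by
  refine ⟨Filter.Eventually.of_forall fun v hv => ?_, Filter.Eventually.of_forall fun v hv => ?_⟩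
  · rw [profile_zero_of_pos hv, inflow_eq_of_pos V.tau_pos V.d_pos V.nonneg₃ V.le₃ hv, wallSource,
      glue_of_pos _ _ hv, glue_of_pos _ _ hv]
    ring
  · rw [profile_one_of_neg hv, inflow_eq_of_neg V.tau_pos V.d_pos V.nonneg₃ V.le₃ hv, wallSource,
      glue_of_neg _ _ hv, glue_of_neg _ _ hv]
    ring

theorem mildEquation_profile {h : Vel → ℝ} {g : ℝ → Vel → ℝ} {Q : ℝ → Vel → ℝ}
    (hg : ∀ x ∈ Icc (0 : ℝ) 1, ∀ v, g x v = profile τ δ₃ h Q x v)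
    (hQ : ∀ y ∈ Icc (0 : ℝ) 1, ∀ v, gaussianES ν g y v = Q y v) :
    MildEquation ν τ g := by
  refine fun x hx => Filter.Eventually.of_forall fun v => ⟨fun hv => ?_, fun hv => ?_⟩
  · rw [hg x hx, hg 0 ⟨le_rfl, zero_le_one⟩, profile_zero_of_pos hv, profile_of_pos hv,
      core_eq_forward]
    congr 2
    refine intervalIntegral.integral_congr fun y hy => ?_
    rw [uIcc_of_le hx.1] at hy
    simp only [hQ y ⟨hy.1, hy.2.trans hx.2⟩]
  · rw [hg x hx, hg 1 ⟨zero_le_one, le_rfl⟩, profile_one_of_neg hv, profile_of_neg hv,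
      core_eq_backward τ _ v (fun y => Q y v)]
    congr 2
    refine intervalIntegral.integral_congr fun y hy => ?_
    rw [uIcc_of_le hx.2] at hy
    simp only [hQ y ⟨hx.1.trans hy.1, hy.2⟩]

/-- The flux coefficients of a function which agrees with a profile. -/
theorem flux_eq_newFlux {h : Vel → ℝ} {g : ℝ → Vel → ℝ} {Q : ℝ → Vel → ℝ}
    (hg : ∀ᵐ v : Vel, ∀ᵐ y : ℝ, y ∈ Icc (0 : ℝ) 1 →
      relaxation ν g y v = Q y v - profile τ δ₃ h Q y v) :
    (fluxL ν τ δ₁ fR g, fluxR ν τ δ₁ fL g) = newFlux τ δ₁ δ₃ fL fR h Q := by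
  have e (S : Set Vel) : ∫ v in S, ∫ y in (0 : ℝ)..1, relaxation ν g y v =
      balance τ δ₃ h Q S := by
    refine integral_congr_ae (ae_restrict_of_ae (hg.mono fun v hv => ?_))
    refine intervalIntegral.integral_congr_ae (hv.mono fun y hy hyI => ?_)
    rw [uIoc_of_le zero_le_one] at hyI
    exact hy ⟨hyI.1.le, hyI.2⟩
  simp only [fluxL, fluxR, newFlux, e]

/-- Uniform integrability of the profile. -/
theorem inClass_profile {C c' : ℝ} (hTw : ∀ i, 0 < Tw i) (hP : PropP1 fL fR)
    (V : ValidParams d τ δ₁ δ₂ δ₃) (hc' : 0 < c') {Q : ℝ → Vel → ℝ}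
    (hQm : Measurable (Function.uncurry Q)) (hQ : ∀ y v, |Q y v| ≤ C * gw c' v) (s : ℝ × ℝ) :
    InClass (profile τ δ₃ (wallSource δ₁ δ₂ fL fR Tw s) Q) := by
  have i1 := integrable_wallSource_wt (δ₁ := δ₁) (δ₂ := δ₂) hTw hP s
  refine ⟨aestronglyMeasurable_profile hQm (aestronglyMeasurable_of_mul_wt i1) _, fun x hx =>
    integrable_profile_wt V.tau_pos V.d_pos V.nonneg₃ V.le₃ hc' hQm hQ i1 hx, _, fun x hx =>
    integral_abs_profile_wt_le V.tau_pos V.d_pos V.nonneg₃ V.le₃ hc' hQ i1 hx⟩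

end solution

/-! ### Flux balances and conservation of mass. -/

section fluxes

variable {Tw : Fin 2 → ℝ} {fL fR : Vel → ℝ} {δ₁ δ₂ δ₃ τ d C c' : ℝ}

theorem integrable_mul_abs_coord {g : Vel → ℝ} (hg : Integrable (fun v => g v * wt v)) :
    Integrable (fun v : Vel => g v * |v 0|) :=
  integrable_mul_of_wt hg (continuous_coord 0).measurable.abs (K := 1) fun v => by
    rw [abs_abs, one_mul]; exact abs_coord_le_wt v 0

/-- Mass balance along the characteristics from left to right. -/
theorem exit_flux_pos (hTw : ∀ i, 0 < Tw i) (hP : PropP1 fL fR)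
    (V : ValidParams d τ δ₁ δ₂ δ₃) (hc' : 0 < c') (hC : 0 ≤ C) {Q : ℝ → Vel → ℝ}
    (hQm : Measurable (Function.uncurry Q)) (hQ : ∀ y v, |Q y v| ≤ C * gw c' v)
    (hQc : ∀ v, Continuous fun y => Q y v) (s : ℝ × ℝ) :
    ∫ v in posHalf, profile τ δ₃ (wallSource δ₁ δ₂ fL fR Tw s) Q 1 v * |v 0| =
      δ₁ * (∫ v in posHalf, fL v * |v 0|) + δ₂ * s.1 +
      δ₃ * (∫ v in negHalf, profile τ δ₃ (wallSource δ₁ δ₂ fL fR Tw s) Q 0 v * |v 0|) +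
      τ⁻¹ * balance τ δ₃ (wallSource δ₁ δ₂ fL fR Tw s) Q posHalf := by
  set h := wallSource δ₁ δ₂ fL fR Tw s with hh
  have i1 : Integrable (fun v => h v * wt v) :=
    integrable_wallSource_wt (δ₁ := δ₁) (δ₂ := δ₂) hTw hP s
  have i0 := integrable_mul_abs_coord (integrable_profile_wt V.tau_pos V.d_pos V.nonneg₃ V.le₃ hc'
    hQm hQ i1 (x := 0) ⟨le_rfl, zero_le_one⟩)
  have i0' := integrable_comp_reflect i0
  have iF := integrable_mul_abs_coord hP.integrable
  have iM := integrable_wallMaxwellian_mul_abs (hTw 0)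
  have iR := integrable_relax_wt V.tau_pos V.d_pos V.nonneg₃ V.le₃ hc' hC hQm hQ i1
  have e1 : ∫ v in posHalf, profile τ δ₃ h Q 1 v * |v 0| = ∫ v in posHalf,
      (δ₁ * (glue fL fR v * |v 0|) + δ₂ * s.1 * (wallMaxwellian (Tw 0) v * |v 0|) +
        δ₃ * (profile τ δ₃ h Q 0 (reflect v) * |reflect v 0|) +
        τ⁻¹ * ∫ y in (0 : ℝ)..1, (Q y v - profile τ δ₃ h Q y v)) := by
    refine setIntegral_congr_fun measurableSet_posHalf fun v hv => ?_
    have hv : 0 < v 0 := hv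
    -- The flux weight |v₁| cancels the singular rate, so the collision term enters with the
    -- velocity-independent factor 1/τ.
    have hz : rate τ v * |v 0| = τ⁻¹ := by
      have := V.tau_pos.ne'
      have := (abs_pos.2 hv.ne').ne'
      rw [rate]; field_simp
    simp only [profile_of_pos hv]
    rw [core_balance _ _ (hQc v), inflow_eq_of_pos V.tau_pos V.d_pos V.nonneg₃ V.le₃ hv, hh,
      wallSource, glue_of_pos _ _ hv, glue_of_pos _ _ hv, reflect_apply_zero, abs_neg, ← hz]
    ring
  have ia : Integrable (fun v : Vel => δ₁ * (glue fL fR v * |v 0|) +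
      δ₂ * s.1 * (wallMaxwellian (Tw 0) v * |v 0|)) := (iF.const_mul _).add (iM.const_mul _)
  have ib : Integrable (fun v : Vel => δ₁ * (glue fL fR v * |v 0|) +
      δ₂ * s.1 * (wallMaxwellian (Tw 0) v * |v 0|) +
      δ₃ * (profile τ δ₃ h Q 0 (reflect v) * |reflect v 0|)) := ia.add (i0'.const_mul _)
  rw [e1, integral_add ib.integrableOn (iR.const_mul _).integrableOn,
    integral_add ia.integrableOn (i0'.const_mul _).integrableOn,
    integral_add (iF.const_mul _).integrableOn (iM.const_mul _).integrableOn]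
  simp only [integral_const_mul]
  rw [wallMaxwellian_flux_pos (hTw 0), setIntegral_negHalf_eq, balance, mul_one]
  congr 4
  exact setIntegral_congr_fun measurableSet_posHalf fun v hv => by
    simp only [glue_of_pos fL fR (mem_posHalf.1 hv)]

/-- Mass balance along the characteristics from right to left. -/
theorem exit_flux_neg (hTw : ∀ i, 0 < Tw i) (hP : PropP1 fL fR)
    (V : ValidParams d τ δ₁ δ₂ δ₃) (hc' : 0 < c') (hC : 0 ≤ C) {Q : ℝ → Vel → ℝ}
    (hQm : Measurable (Function.uncurry Q)) (hQ : ∀ y v, |Q y v| ≤ C * gw c' v)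
    (hQc : ∀ v, Continuous fun y => Q y v) (s : ℝ × ℝ) :
    ∫ v in negHalf, profile τ δ₃ (wallSource δ₁ δ₂ fL fR Tw s) Q 0 v * |v 0| =
      δ₁ * (∫ v in negHalf, fR v * |v 0|) + δ₂ * s.2 +
      δ₃ * (∫ v in posHalf, profile τ δ₃ (wallSource δ₁ δ₂ fL fR Tw s) Q 1 v * |v 0|) +
      τ⁻¹ * balance τ δ₃ (wallSource δ₁ δ₂ fL fR Tw s) Q negHalf := by
  set h := wallSource δ₁ δ₂ fL fR Tw s with hh
  have i1 : Integrable (fun v => h v * wt v) :=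
    integrable_wallSource_wt (δ₁ := δ₁) (δ₂ := δ₂) hTw hP s
  have i0 := integrable_mul_abs_coord (integrable_profile_wt V.tau_pos V.d_pos V.nonneg₃ V.le₃ hc'
    hQm hQ i1 (x := 1) ⟨zero_le_one, le_rfl⟩)
  have i0' := integrable_comp_reflect i0
  have iF := integrable_mul_abs_coord hP.integrable
  have iM := integrable_wallMaxwellian_mul_abs (hTw 1)
  have iR := integrable_relax_wt V.tau_pos V.d_pos V.nonneg₃ V.le₃ hc' hC hQm hQ i1
  have e1 : ∫ v in negHalf, profile τ δ₃ h Q 0 v * |v 0| = ∫ v in negHalf,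
      (δ₁ * (glue fL fR v * |v 0|) + δ₂ * s.2 * (wallMaxwellian (Tw 1) v * |v 0|) +
        δ₃ * (profile τ δ₃ h Q 1 (reflect v) * |reflect v 0|) +
        τ⁻¹ * ∫ y in (0 : ℝ)..1, (Q y v - profile τ δ₃ h Q y v)) := by
    refine setIntegral_congr_fun measurableSet_negHalf fun v hv => ?_
    have hv : v 0 < 0 := hv
    have hz : rate τ v * |v 0| = τ⁻¹ := by
      have := V.tau_pos.ne'
      have := (abs_pos.2 hv.ne).ne'
      rw [rate]; field_simp
    -- The balance along the leftward characteristic is reversed so that its integrand becomes the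
    -- relaxation term at position y.
    have hswap : ∫ y in (0 : ℝ)..1, (Q (1 - y) v - core (rate τ v) (inflow τ δ₃ h Q v)
        (fun y => Q (1 - y) v) y) = ∫ y in (0 : ℝ)..1, (Q y v - core (rate τ v)
          (inflow τ δ₃ h Q v) (fun y => Q (1 - y) v) (1 - y)) := by
      have := intervalIntegral.integral_comp_sub_left (a := 0) (b := 1)
        (fun y => Q y v - core (rate τ v) (inflow τ δ₃ h Q v) (fun y => Q (1 - y) v) (1 - y)) 1
      simpa using this
    simp only [profile_of_neg hv]
    rw [sub_zero, core_balance _ _ (q := fun y => Q (1 - y) v)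
      ((hQc v).comp (continuous_const.sub continuous_id)), hswap]
    rw [show inflow τ δ₃ h Q v + rate τ v * (∫ y in (0 : ℝ)..1, (Q y v - core (rate τ v)
          (inflow τ δ₃ h Q v) (fun y => Q (1 - y) v) (1 - y))) = h v + δ₃ * profile τ δ₃ h Q 1
          (reflect v) + rate τ v * (∫ y in (0 : ℝ)..1, (Q y v - core (rate τ v)
          (inflow τ δ₃ h Q v) (fun y => Q (1 - y) v) (1 - y))) by
        rw [← inflow_eq_of_neg V.tau_pos V.d_pos V.nonneg₃ V.le₃ hv]]
    have hhv : h v = δ₁ * glue fL fR v + δ₂ * (s.2 * wallMaxwellian (Tw 1) v) := by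
      rw [hh, wallSource, glue_of_neg (fun v => s.1 * wallMaxwellian (Tw 0) v) _ hv]
    rw [hhv, reflect_apply_zero, abs_neg, ← hz]
    ring
  have ia : Integrable (fun v : Vel => δ₁ * (glue fL fR v * |v 0|) +
      δ₂ * s.2 * (wallMaxwellian (Tw 1) v * |v 0|)) := (iF.const_mul _).add (iM.const_mul _)
  have ib : Integrable (fun v : Vel => δ₁ * (glue fL fR v * |v 0|) +
      δ₂ * s.2 * (wallMaxwellian (Tw 1) v * |v 0|) +
      δ₃ * (profile τ δ₃ h Q 1 (reflect v) * |reflect v 0|)) := ia.add (i0'.const_mul _)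
  rw [e1, integral_add ib.integrableOn (iR.const_mul _).integrableOn,
    integral_add ia.integrableOn (i0'.const_mul _).integrableOn,
    integral_add (iF.const_mul _).integrableOn (iM.const_mul _).integrableOn]
  simp only [integral_const_mul]
  rw [wallMaxwellian_flux_neg (hTw 1), setIntegral_posHalf_eq (fun v => profile τ δ₃ h Q 1 v * |v 0|),
    balance, mul_one]
  congr 4
  exact setIntegral_congr_fun measurableSet_negHalf fun v hv => by
    simp only [glue_of_neg fL fR (mem_negHalf.1 hv)]

/-- The relaxation term conserves mass. -/
theorem balance_add_balance (hTw : ∀ i, 0 < Tw i) (hP : PropP1 fL fR)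
    (V : ValidParams d τ δ₁ δ₂ δ₃) (hc' : 0 < c') (hC : 0 ≤ C) {Q : ℝ → Vel → ℝ}
    (hQm : Measurable (Function.uncurry Q)) (hQ : ∀ y v, |Q y v| ≤ C * gw c' v) (s : ℝ × ℝ)
    (hmass : ∀ y ∈ Icc (0 : ℝ) 1, ∫ v, Q y v =
      ∫ v, profile τ δ₃ (wallSource δ₁ δ₂ fL fR Tw s) Q y v) :
    balance τ δ₃ (wallSource δ₁ δ₂ fL fR Tw s) Q posHalf +
      balance τ δ₃ (wallSource δ₁ δ₂ fL fR Tw s) Q negHalf = 0 := by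
  set h := wallSource δ₁ δ₂ fL fR Tw s with hh
  have i1 : Integrable (fun v => h v * wt v) :=
    integrable_wallSource_wt (δ₁ := δ₁) (δ₂ := δ₂) hTw hP s
  have iR := integrable_relax_wt V.tau_pos V.d_pos V.nonneg₃ V.le₃ hc' hC hQm hQ i1
  rw [balance, balance, ← integral_eq_half_add_half iR]
  simp_rw [intervalIntegral.integral_of_le zero_le_one]
  have hmeas : AEStronglyMeasurable (fun p : ℝ × Vel => Q p.1 p.2 - profile τ δ₃ h Q p.1 p.2)
      ((volume.restrict (Ioc (0 : ℝ) 1)).prod volume) :=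
    hQm.aestronglyMeasurable.sub
      (aestronglyMeasurable_profile hQm (aestronglyMeasurable_of_mul_wt i1) _)
  have iMaj := (integrable_relax_majorant (τ := τ) (d := d) (K := C) hc' i1).1
  have hnn (v : Vel) : 0 ≤ C * gw c' v + majorant τ d c' C h v :=
    add_nonneg (mul_nonneg hC (gw_pos c' v).le) (majorant_nonneg V.d_pos hC v)
  have hslice (y : ℝ) (hy : y ∈ Icc (0 : ℝ) 1) (v : Vel) :
      ‖Q y v - profile τ δ₃ h Q y v‖ ≤ (C * gw c' v + majorant τ d c' C h v) * wt v :=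
    ((abs_sub _ _).trans (add_le_add (hQ y v)
      (abs_profile_le_majorant V.tau_pos V.d_pos V.nonneg₃ V.le₃ hQ hy v))).trans
      (le_mul_of_one_le_right (hnn v) (one_le_wt v))
  have hint : Integrable (fun p : ℝ × Vel => Q p.1 p.2 - profile τ δ₃ h Q p.1 p.2)
      ((volume.restrict (Ioc (0 : ℝ) 1)).prod volume) := by
    refine (iMaj.comp_snd (volume.restrict (Ioc (0 : ℝ) 1))).mono' hmeas ?_
    have : ∀ᵐ p : ℝ × Vel ∂((volume.restrict (Ioc (0 : ℝ) 1)).prod volume), p.1 ∈ Ioc (0 : ℝ) 1 :=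
      Measure.quasiMeasurePreserving_fst.ae (ae_restrict_mem measurableSet_Ioc)
    filter_upwards [this] with p hp
    exact hslice p.1 ⟨hp.1.le, hp.2⟩ p.2
  -- After Fubini the inner integral is over all velocities at one position, where source and
  -- profile have equal mass.
  have hsw := integral_integral_swap (f := fun y v => Q y v - profile τ δ₃ h Q y v) hint
  rw [← hsw]
  refine integral_eq_zero_of_ae ?_
  filter_upwards [ae_restrict_mem measurableSet_Ioc] with y hy
  have hy' : y ∈ Icc (0 : ℝ) 1 := ⟨hy.1.le, hy.2⟩
  have iQ : Integrable (fun v => Q y v) := by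
    refine integrable_of_abs_le ((integrable_gw hc').const_mul C)
      (hQm.comp (measurable_const.prodMk measurable_id)).aestronglyMeasurable
      (Filter.Eventually.of_forall fun v => hQ y v)
  have iP : Integrable (fun v => profile τ δ₃ h Q y v) := by
    have := integrable_mul_of_wt (integrable_profile_wt V.tau_pos V.d_pos V.nonneg₃ V.le₃ hc'
      hQm hQ i1 hy') (φ := fun _ => 1) measurable_const (K := 1) fun v => by
        simpa using one_le_wt v
    simpa using this
  simp only [Pi.zero_apply]
  rw [integral_sub iQ iP, hmass y hy', sub_self]

end fluxes

/-! ### Every solution with admissible moments is a profile. -/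

section representation

variable {Tw : Fin 2 → ℝ} {fL fR : Vel → ℝ} {δ₁ δ₂ δ₃ τ d ν a B c : ℝ}
  {s : ℝ × ℝ} {g : ℝ → Vel → ℝ}

/-- A solution of the mild equation is the profile of its collision source. -/
theorem ae_eq_profile (V : ValidParams d τ δ₁ δ₂ δ₃) (hME : MildEquation ν τ g)
    (hBR : BoundaryRelation δ₁ δ₂ δ₃ fL fR Tw s.1 s.2 g) {Q : ℝ → Vel → ℝ}
    (hQ : ∀ᵐ y : ℝ, y ∈ Icc (0 : ℝ) 1 → ∀ v, gaussianES ν g y v = Q y v) :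
    ∀ x ∈ Icc (0 : ℝ) 1, g x =ᵐ[volume] profile τ δ₃ (wallSource δ₁ δ₂ fL fR Tw s) Q x := by
  set h := wallSource δ₁ δ₂ fL fR Tw s with hh
  have hcore : ∀ x ∈ Icc (0 : ℝ) 1, ∀ᵐ v : Vel,
      (0 < v 0 → g x v = core (rate τ v) (g 0 v) (fun y => Q y v) x) ∧
      (v 0 < 0 → g x v = core (rate τ v) (g 1 v) (fun y => Q (1 - y) v) (1 - x)) := by
    intro x hx
    filter_upwards [hME x hx] with v hv
    refine ⟨fun hp => ?_, fun hn => ?_⟩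
    · rw [hv.1 hp, core_eq_forward]
      congr 2
      refine intervalIntegral.integral_congr_ae (hQ.mono fun y hy hyI => ?_)
      rw [uIoc_of_le hx.1] at hyI
      simp only [hy ⟨hyI.1.le, hyI.2.trans hx.2⟩]
    · rw [hv.2 hn, core_eq_backward τ _ v (fun y => Q y v)]
      congr 2
      refine intervalIntegral.integral_congr_ae (hQ.mono fun y hy hyI => ?_)
      rw [uIoc_of_le hx.2] at hyI
      simp only [hy ⟨hx.1.trans hyI.1.le, hyI.2⟩]
  have hexit : ∀ᵐ v : Vel,
      (0 < v 0 → g 1 v = Real.exp (-rate τ v) * g 0 v + exitSource τ Q v) ∧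
      (v 0 < 0 → g 0 v = Real.exp (-rate τ v) * g 1 v + exitSource τ Q v) := by
    filter_upwards [hcore 0 ⟨le_rfl, zero_le_one⟩, hcore 1 ⟨zero_le_one, le_rfl⟩] with v h0 h1
    refine ⟨fun hp => ?_, fun hn => ?_⟩
    · rw [h1.1 hp, core_split, one_mul, exitSource, orient_of_pos hp]
    · rw [h0.2 hn, core_split, sub_zero, one_mul, exitSource, orient_of_neg hn]
  have hbc : ∀ᵐ v : Vel, (0 < v 0 → g 0 v = h v + δ₃ * g 0 (reflect v)) ∧
      (v 0 < 0 → g 1 v = h v + δ₃ * g 1 (reflect v)) := by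
    filter_upwards [hBR.1, hBR.2] with v h0 h1
    refine ⟨fun hp => ?_, fun hn => ?_⟩
    · rw [h0 hp, hh, wallSource, glue_of_pos _ _ hp, glue_of_pos _ _ hp]; ring
    · rw [h1 hn, hh, wallSource, glue_of_neg _ _ hn, glue_of_neg _ _ hn]; ring
  have hin : ∀ᵐ v : Vel, (0 < v 0 → g 0 v = inflow τ δ₃ h Q v) ∧
      (v 0 < 0 → g 1 v = inflow τ δ₃ h Q v) := by
    -- The exit and reflection relations are needed at v and at its reflection simultaneously;
    -- together they close the 2×2 system for the incoming traces. Reflection preserves null sets.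
    filter_upwards [hexit, hbc, ae_comp_reflect hexit, ae_comp_reflect hbc] with v e1 e2 e3 e4
    rw [reflect_apply_zero, reflect_reflect, neg_pos, neg_lt_zero] at e4
    rw [reflect_apply_zero, rate_reflect, neg_pos, neg_lt_zero] at e3
    refine ⟨fun hp => ?_, fun hn => ?_⟩
    · refine eq_inflow V.tau_pos V.d_pos V.nonneg₃ V.le₃ (b' := g 1 (reflect v)) ?_ ?_
      · rw [e2.1 hp, e3.2 hp]
      · rw [e4.2 hp, e1.1 hp]
    · refine eq_inflow V.tau_pos V.d_pos V.nonneg₃ V.le₃ (b' := g 0 (reflect v)) ?_ ?_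
      · rw [e2.2 hn, e3.1 hn]
      · rw [e4.1 hn, e1.2 hn]
  intro x hx
  filter_upwards [hcore x hx, hin, ae_coord_ne_zero] with v e1 e2 hv
  rcases lt_or_gt_of_ne hv with hn | hp
  · rw [e1.2 hn, e2.2 hn, profile_of_neg hn]
  · rw [e1.1 hp, e2.1 hp, profile_of_pos hp]

theorem aemeasurable_moments (hg : InClass g) :
    AEMeasurable (fun y => moments (g y)) (volume.restrict (Icc (0 : ℝ) 1)) := by
  refine aemeasurable_pi_lambda _ fun k => aemeasurable_pi_lambda _ fun l => ?_
  have hm : Continuous fun p : ℝ × Vel => hat p.2 k * hat p.2 l :=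
    ((continuous_hat k).comp continuous_snd).mul ((continuous_hat l).comp continuous_snd)
  exact (AEStronglyMeasurable.integral_prod_right'
    (hg.1.mul hm.aestronglyMeasurable)).aemeasurable

/-- The moments of a solution with admissible moments are continuous, and it is the profile of the
source which they define. -/
theorem exists_moments_of_solution (hTw : ∀ i, 0 < Tw i) (hP : PropP1 fL fR)
    (V : ValidParams d τ δ₁ δ₂ δ₃) (ha : 0 < a) (hc : 0 < c) (hg : InClass g)
    (hME : MildEquation ν τ g) (hBR : BoundaryRelation δ₁ δ₂ δ₃ fL fR Tw s.1 s.2 g)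
    (hadm : ∀ x ∈ Icc (0 : ℝ) 1, moments (g x) ∈ admissible ν a B c) :
    ∃ m : C(Icc (0 : ℝ) 1, Moments), (∀ x : Icc (0 : ℝ) 1, m x = moments (g x)) ∧
      ∀ x ∈ Icc (0 : ℝ) 1, g x =ᵐ[volume]
        profile τ δ₃ (wallSource δ₁ δ₂ fL fR Tw s) (fieldSource ν a B c m) x := by
  obtain ⟨c', hc', C, hC, -, hG1, -, -⟩ := exists_gaussD_bounds hTw ν B ha hc
  have hM := aemeasurable_moments hg
  -- The moments are so far only measurable almost everywhere in x. A Borel representative already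
  -- gives a source for which the solution is a profile; this makes the moments continuous, and the
  -- representation is then repeated with the continuous field.
  obtain ⟨M, hMm, hMe⟩ := hM
  obtain ⟨Q, hQ⟩ : ∃ Q : ℝ → Vel → ℝ, ∀ y v, Q y v = gaussD ν a B c (M y) v := ⟨_, fun _ _ => rfl⟩
  have hQm : Measurable (Function.uncurry Q) := by
    have h1 : Measurable (fun p : ℝ × Vel => ((M p.1, p.2) : Moments × Vel)) :=
      (hMm.comp measurable_fst).prodMk measurable_snd
    have h2 := (measurable_gaussD (ν := ν) (B := B) ha hc).comp h1
    have e : Function.uncurry Q = (fun p : Moments × Vel => gaussD ν a B c p.1 p.2) ∘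
        fun p : ℝ × Vel => ((M p.1, p.2) : Moments × Vel) := by
      funext p; exact hQ p.1 p.2
    rw [e]; exact h2
  have hQe : ∀ᵐ y : ℝ, y ∈ Icc (0 : ℝ) 1 → ∀ v, gaussianES ν g y v = Q y v := by
    filter_upwards [(ae_restrict_iff' measurableSet_Icc).1 hMe] with y hy hyI v
    have h0 : density g y ≠ 0 := by
      rw [density_eq]; exact (ha.trans_le (hadm y hyI).2.1).ne'
    rw [gaussianES_eq ν (hg.2.1 y hyI) h0, hQ, ← hy hyI, gaussD, indicator_of_mem (hadm y hyI)]
  have hgp := ae_eq_profile V hME hBR hQe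
  obtain ⟨m, hm⟩ : ∃ m : C(Icc (0 : ℝ) 1, Moments), ∀ x : Icc (0 : ℝ) 1, m x = moments (g x) :=
    ⟨⟨_, continuous_moments_profile V.tau_pos V.d_pos V.nonneg₃ V.le₃ hc' hQm
      (fun y v => by rw [hQ]; exact hG1 _ v) (integrable_wallSource_wt hTw hP s)⟩,
      fun x => (moments_congr (hgp x x.2)).symm⟩
  refine ⟨m, hm, ae_eq_profile V hME hBR (Filter.Eventually.of_forall fun y hy v => ?_)⟩
  exact gaussianES_eq_fieldSource ha hy (hg.2.1 y hy) (hm ⟨y, hy⟩).symm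
    (by rw [hm]; exact hadm y hy) v

/-- Fubini for null sets needs a measurable coincidence set, hence the passage to strongly
measurable representatives. It turns equality for each x and almost every v into equality for almost
every v along almost all of its characteristic. -/
theorem ae_ae_comm_of_aestronglyMeasurable {μ : Measure ℝ} [SFinite μ] {F G : ℝ → Vel → ℝ}
    (hF : AEStronglyMeasurable (fun p : ℝ × Vel => F p.1 p.2) (μ.prod volume))
    (hG : AEStronglyMeasurable (fun p : ℝ × Vel => G p.1 p.2) (μ.prod volume))
    (h : ∀ᵐ y ∂μ, ∀ᵐ v, F y v = G y v) : ∀ᵐ v, ∀ᵐ y ∂μ, F y v = G y v := by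
  have h1 : ∀ᵐ p ∂(μ.prod volume), hF.mk _ p = hG.mk _ p := by
    rw [Measure.ae_prod_iff_ae_ae
      (measurableSet_eq_fun hF.stronglyMeasurable_mk.measurable hG.stronglyMeasurable_mk.measurable)]
    filter_upwards [h, Measure.ae_ae_of_ae_prod hF.ae_eq_mk,
      Measure.ae_ae_of_ae_prod hG.ae_eq_mk] with y e1 e2 e3
    filter_upwards [e1, e2, e3] with v e1 e2 e3
    rw [← e2, ← e3, e1]
  have h2 : ∀ᵐ p ∂(μ.prod volume), F p.1 p.2 = G p.1 p.2 := by
    filter_upwards [h1, hF.ae_eq_mk, hG.ae_eq_mk] with p e1 e2 e3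
    rw [e2, e3, e1]
  exact Measure.ae_ae_of_ae_prod (Measure.measurePreserving_swap.quasiMeasurePreserving.ae h2)

/-- The flux coefficients of a solution, in terms of its moments. -/
theorem fluxes_eq_newFlux (hTw : ∀ i, 0 < Tw i) (hP : PropP1 fL fR) (ha : 0 < a) (hc : 0 < c)
    (hg : InClass g) {m : C(Icc (0 : ℝ) 1, Moments)}
    (hm : ∀ x : Icc (0 : ℝ) 1, m x = moments (g x)) (hadm : ∀ x, m x ∈ admissible ν a B c)
    (hgp : ∀ x ∈ Icc (0 : ℝ) 1, g x =ᵐ[volume]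
        profile τ δ₃ (wallSource δ₁ δ₂ fL fR Tw s) (fieldSource ν a B c m) x) :
    (fluxL ν τ δ₁ fR g, fluxR ν τ δ₁ fL g) =
      newFlux τ δ₁ δ₃ fL fR (wallSource δ₁ δ₂ fL fR Tw s) (fieldSource ν a B c m) := by
  refine flux_eq_newFlux ?_
  have h1 := ae_ae_comm_of_aestronglyMeasurable hg.1
    (aestronglyMeasurable_profile (τ := τ) (δ₃ := δ₃) (measurable_fieldSource ha hc m)
      (aestronglyMeasurable_of_mul_wt (integrable_wallSource_wt (δ₁ := δ₁) (δ₂ := δ₂) hTw hP s)) _)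
    ((ae_restrict_iff' measurableSet_Icc).2 (Filter.Eventually.of_forall hgp))
  filter_upwards [h1] with v hv
  filter_upwards [(ae_restrict_iff' measurableSet_Icc).1 hv] with y hy hyI
  rw [relaxation, hy hyI, gaussianES_eq_fieldSource ha hyI (hg.2.1 y hyI) (hm ⟨y, hyI⟩).symm
    (hadm _)]

theorem IsMildSolution.isSolutionPair (hTw : ∀ i, 0 < Tw i) (hP : PropP1 fL fR)
    (V : ValidParams d τ δ₁ δ₂ δ₃) (ha : 0 < a) (hc : 0 < c)
    (hg : IsMildSolution ν τ δ₁ δ₂ δ₃ fL fR Tw g)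
    (hadm : ∀ x ∈ Icc (0 : ℝ) 1, moments (g x) ∈ admissible ν a B c) :
    ∃ (m : C(Icc (0 : ℝ) 1, Moments)) (s : ℝ × ℝ),
      IsSolutionPair ν a B c τ δ₁ δ₂ δ₃ fL fR Tw m s ∧ (∀ x, m x ∈ admissible ν a B c) ∧
      ∀ x ∈ Icc (0 : ℝ) 1, g x =ᵐ[volume]
        profile τ δ₃ (wallSource δ₁ δ₂ fL fR Tw s) (fieldSource ν a B c m) x := by
  obtain ⟨hcl, hME, hBR⟩ := hg
  obtain ⟨m, hm, hgp⟩ := exists_moments_of_solution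
    (s := (fluxL ν τ δ₁ fR g, fluxR ν τ δ₁ fL g)) hTw hP V ha hc hcl hME hBR hadm
  have hma (x : Icc (0 : ℝ) 1) : m x ∈ admissible ν a B c := by rw [hm]; exact hadm x x.2
  exact ⟨m, _, ⟨fluxes_eq_newFlux hTw hP ha hc hcl hm hma hgp, fun x => by
    rw [hm, moments_congr (hgp x x.2)]⟩, hma, hgp⟩

end representation

/-! ### Equivalence with the mixed boundary condition. -/

section mixed

variable {Tw : Fin 2 → ℝ} {fL fR : Vel → ℝ} {δ₁ δ₂ δ₃ τ d ν a B c : ℝ}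
  {m : C(Icc (0 : ℝ) 1, Moments)} {s : ℝ × ℝ}

theorem fieldSource_eq_gaussM (hm : ∀ x, m x ∈ admissible ν a B c) (y : ℝ) (v : Vel) :
    fieldSource ν a B c m y v = gaussM ν (IccExtend zero_le_one m y) v :=
  indicator_of_mem (hm (projIcc 0 1 zero_le_one y)) fun m => gaussM ν m v

theorem continuous_fieldSource (ha : 0 < a) (hc : 0 < c) (hm : ∀ x, m x ∈ admissible ν a B c)
    (v : Vel) : Continuous fun y => fieldSource ν a B c m y v := by
  simp only [fieldSource_eq_gaussM hm]
  exact (continuousOn_gaussM ha hc).comp_continuous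
    (m.continuous.Icc_extend'.prodMk continuous_const) fun y => ⟨hm _, mem_univ _⟩

theorem integral_fieldSource (hc : 0 < c) (hm : ∀ x, m x ∈ admissible ν a B c) {y : ℝ}
    (hy : y ∈ Icc (0 : ℝ) 1) : ∫ v, fieldSource ν a B c m y v = m ⟨y, hy⟩ 0 0 := by
  simp only [fieldSource_eq_gaussM hm, IccExtend_of_mem _ _ hy]
  exact integral_gaussM hc (hm _)

/-- Mass balance of a profile whose moments define its source. -/
theorem exists_flux_balance (hTw : ∀ i, 0 < Tw i) (hP : PropP1 fL fR)
    (V : ValidParams d τ δ₁ δ₂ δ₃) (ha : 0 < a) (hc : 0 < c) (hm : ∀ x, m x ∈ admissible ν a B c)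
    {h : Vel → ℝ} {Q : ℝ → Vel → ℝ} (hh : h = wallSource δ₁ δ₂ fL fR Tw s)
    (hQ : Q = fieldSource ν a B c m) (hmp : ∀ x : Icc (0 : ℝ) 1, m x = moments (profile τ δ₃ h Q x)) :
    ∃ R : ℝ, balance τ δ₃ h Q posHalf = R ∧ balance τ δ₃ h Q negHalf = -R ∧
      ∫ v in posHalf, profile τ δ₃ h Q 1 v * |v 0| =
        δ₁ * (∫ v in posHalf, fL v * |v 0|) + δ₂ * s.1 +
        δ₃ * (∫ v in negHalf, profile τ δ₃ h Q 0 v * |v 0|) + τ⁻¹ * R ∧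
      ∫ v in negHalf, profile τ δ₃ h Q 0 v * |v 0| =
        δ₁ * (∫ v in negHalf, fR v * |v 0|) + δ₂ * s.2 +
        δ₃ * (∫ v in posHalf, profile τ δ₃ h Q 1 v * |v 0|) - τ⁻¹ * R := by
  obtain ⟨c', hc', C, hC, -, hG1, -, -⟩ := exists_gaussD_bounds hTw ν B ha hc
  subst hh hQ
  have hQm := measurable_fieldSource (ν := ν) (B := B) ha hc m
  have hQb : ∀ y v, |fieldSource ν a B c m y v| ≤ C * gw c' v := fun y v => hG1 _ v
  have hQc := continuous_fieldSource ha hc hm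
  -- Mass conservation enters here: the source has mass m₀₀, which by the fixed point relation is
  -- the mass of the profile.
  have e := balance_add_balance hTw hP V hc' hC.le hQm hQb s fun y hy => by
    rw [integral_fieldSource hc hm hy, hmp ⟨y, hy⟩]
    simp [moments]
  refine ⟨_, rfl, by linarith, exit_flux_pos hTw hP V hc' hC.le hQm hQb hQc s, ?_⟩
  rw [exit_flux_neg hTw hP V hc' hC.le hQm hQb hQc s, ← neg_eq_of_add_eq_zero_right e]
  ring

/-- Under the compatibility condition, the wall coefficients are the outgoing fluxes and sum to one. -/
theorem IsSolutionPair.fluxes (hTw : ∀ i, 0 < Tw i) (hP : PropP1 fL fR)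
    (V : ValidParams d τ δ₁ δ₂ δ₃) (ha : 0 < a) (hc : 0 < c) (hm : ∀ x, m x ∈ admissible ν a B c)
    (hs : IsSolutionPair ν a B c τ δ₁ δ₂ δ₃ fL fR Tw m s) {h : Vel → ℝ} {Q : ℝ → Vel → ℝ}
    (hh : h = wallSource δ₁ δ₂ fL fR Tw s) (hQ : Q = fieldSource ν a B c m)
    (hcomp : δ₁ * ((∫ v in posHalf, fL v * |v 0|) + (∫ v in negHalf, fR v * |v 0|) - 1) = 0) :
    ∫ v in negHalf, profile τ δ₃ h Q 0 v * |v 0| = s.1 ∧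
      ∫ v in posHalf, profile τ δ₃ h Q 1 v * |v 0| = s.2 ∧ s.1 + s.2 = 1 := by
  obtain ⟨hs1, hs2⟩ := hs
  rw [← hh, ← hQ] at hs1
  simp only [← hh, ← hQ] at hs2
  obtain ⟨R, h1, h2, h3, h4⟩ := exists_flux_balance hTw hP V ha hc hm hh hQ hs2
  rw [newFlux, h1, h2] at hs1
  set N₀ := ∫ v in negHalf, profile τ δ₃ h Q 0 v * |v 0|
  set N₁ := ∫ v in posHalf, profile τ δ₃ h Q 1 v * |v 0|
  set φL := ∫ v in posHalf, fL v * |v 0|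
  set φR := ∫ v in negHalf, fR v * |v 0|
  obtain ⟨e1, e2⟩ := Prod.ext_iff.1 hs1
  have hτ := V.tau_pos.ne'
  have h2d : 2 - δ₁ ≠ 0 := by linarith [V.le_one₁]
  simp only at e1 e2
  have e1' : (2 - δ₁) * s.1 = 1 - δ₁ + δ₁ * φR - τ⁻¹ * R := by
    rw [e1]; field_simp
  have e2' : (2 - δ₁) * s.2 = 1 - δ₁ + δ₁ * φL + τ⁻¹ * R := by
    rw [e2]; field_simp; ring
  -- Adding the two formulas cancels R; the compatibility condition turns the right side into 2 -
  -- δ₁.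
  have hsum : s.1 + s.2 = 1 := by
    refine mul_left_cancel₀ h2d ?_
    linear_combination e1' + e2' + hcomp
  have h3' : (1 - δ₃) * (1 + δ₃) ≠ 0 := by
    have := V.le₃; have := V.d_pos; have := V.nonneg₃
    exact mul_ne_zero (by linarith) (by linarith)
  have hδ : δ₂ = 1 - δ₁ - δ₃ := by linarith [V.sum_eq]
  have hs1' : s.1 = 1 - s.2 := by linarith
  -- The deviations of the outgoing fluxes from the wall coefficients solve a homogeneous system
  -- with determinant 1 - δ₃² ≠ 0.
  have d1 : (N₁ - s.2) = δ₃ * (N₀ - s.1) := by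
    rw [h3, hδ]; linear_combination -e2' + (1 - δ₁) * hsum
  have d0 : (N₀ - s.1) = δ₃ * (N₁ - s.2) := by
    rw [h4, hδ]; linear_combination -e1' + (1 - δ₁) * hsum
  have z1 : N₁ - s.2 = 0 := by
    refine (mul_eq_zero.1 (?_ : (1 - δ₃) * (1 + δ₃) * (N₁ - s.2) = 0)).resolve_left h3'
    linear_combination d1 + δ₃ * d0
  have z0 : N₀ - s.1 = 0 := by rw [d0, z1, mul_zero]
  exact ⟨by linarith, by linarith, hsum⟩

/-- The mixed boundary condition with normalized flux implies the reformulated one. -/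
theorem isMildSolution_of_mixedBoundary {g : ℝ → Vel → ℝ} (hTw : ∀ i, 0 < Tw i)
    (hP : PropP1 fL fR) (V : ValidParams d τ δ₁ δ₂ δ₃) (ha : 0 < a) (hc : 0 < c) (hg : InClass g)
    (hME : MildEquation ν τ g) (hMB : MixedBoundary δ₁ δ₂ δ₃ fL fR Tw g) (hFN : FluxNormalized g)
    (hadm : ∀ x ∈ Icc (0 : ℝ) 1, moments (g x) ∈ admissible ν a B c) :
    IsMildSolution ν τ δ₁ δ₂ δ₃ fL fR Tw g := by
  refine ⟨hg, hME, ?_⟩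
  rw [MixedBoundary] at hMB
  rw [FluxNormalized] at hFN
  obtain ⟨m, hm, hgp⟩ := exists_moments_of_solution (s := (∫ v in negHalf, g 0 v * |v 0|,
    ∫ v in posHalf, g 1 v * |v 0|)) hTw hP V ha hc hg hME hMB hadm
  have hma (x : Icc (0 : ℝ) 1) : m x ∈ admissible ν a B c := by rw [hm]; exact hadm x x.2
  have hfl := fluxes_eq_newFlux hTw hP ha hc hg hm hma hgp
  obtain ⟨R, h1, h2, h3, h4⟩ := exists_flux_balance hTw hP V ha hc hma rfl rfl fun x => by
    rw [hm, moments_congr (hgp x x.2)]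
  have g0 : ∫ v in negHalf, g 0 v * |v 0| = _ := integral_congr_ae (ae_restrict_of_ae
    ((hgp 0 ⟨le_rfl, zero_le_one⟩).mono fun v hv => congrArg (· * |v 0|) hv))
  have g1 : ∫ v in posHalf, g 1 v * |v 0| = _ := integral_congr_ae (ae_restrict_of_ae
    ((hgp 1 ⟨zero_le_one, le_rfl⟩).mono fun v hv => congrArg (· * |v 0|) hv))
  simp only at g0 g1
  rw [newFlux, h1, h2] at hfl
  rw [← g0, ← g1] at h3 h4
  simp only at h3 h4
  set N₀ := ∫ v in negHalf, g 0 v * |v 0|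
  set N₁ := ∫ v in posHalf, g 1 v * |v 0|
  obtain ⟨e1, e2⟩ := Prod.ext_iff.1 hfl
  have hτ := V.tau_pos.ne'
  have h2d : 2 - δ₁ ≠ 0 := by linarith [V.le_one₁]
  simp only at e1 e2
  have hδ : δ₂ = 1 - δ₁ - δ₃ := by linarith [V.sum_eq]
  rw [hδ] at h3 h4
  -- The wall coefficients are now the fluxes themselves, so diffusive and specular parts combine to
  -- (1 - δ₁)N₁ = (1 - δ₁)(1 - N₀). Solving for N₀ gives the reformulated coefficient without the
  -- compatibility condition.
  have c1 : fluxL ν τ δ₁ fR g = N₀ := by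
    have e1' : (2 - δ₁) * fluxL ν τ δ₁ fR g =
        1 - δ₁ + δ₁ * (∫ v in negHalf, fR v * |v 0|) - τ⁻¹ * R := by rw [e1]; field_simp
    refine mul_left_cancel₀ h2d ?_
    linear_combination e1' - h4 - (1 - δ₁) * hFN
  have c2 : fluxR ν τ δ₁ fL g = N₁ := by
    have e2' : (2 - δ₁) * fluxR ν τ δ₁ fL g =
        1 - δ₁ + δ₁ * (∫ v in posHalf, fL v * |v 0|) + τ⁻¹ * R := by
      rw [e2]; field_simp; ring
    refine mul_left_cancel₀ h2d ?_
    linear_combination e2' - h3 - (1 - δ₁) * hFN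
  rw [c1, c2]
  exact hMB

end mixed

/-! ### Unique solvability from bounds near the limit. -/

/-- Unique solvability in a class of functions with admissible moments which contains the
neighbours of the limit. -/
theorem exists_uniquelySolvable {Tw : Fin 2 → ℝ} (hTw : ∀ i, 0 < Tw i) {fL fR : Vel → ℝ}
    (hP : PropP1 fL fR) {ν a B c d η : ℝ} (ha : 0 < a) (hc : 0 < c) (hd : 0 < d) (hη : 0 < η)
    (hball : ∀ m : Moments, (∀ k l, m k l = m l k) → ‖m - limitMoments Tw‖ ≤ η →
      m ∈ admissible ν a B c) (P : ℝ → (ℝ → Vel → ℝ) → Prop)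
    (hadm : ∀ δ₂, d ≤ δ₂ → ∀ g, InClass g → Nonneg g → P δ₂ g →
      ∀ x ∈ Icc (0 : ℝ) 1, moments (g x) ∈ admissible ν a B c)
    (hnear : ∀ δ₂, 0 ≤ δ₂ → δ₂ ≤ 1 → ∀ f, InClass f →
      (∀ x ∈ Icc (0 : ℝ) 1, ‖moments (f x) - limitMoments Tw‖ ≤ η) → P δ₂ f) :
    ∃ K₁ > (0 : ℝ), ∃ ε > (0 : ℝ), ∀ τ δ₁ δ₂ δ₃ : ℝ,
      0 ≤ δ₁ → 0 ≤ δ₂ → 0 ≤ δ₃ → δ₁ + δ₂ + δ₃ = 1 → d ≤ δ₂ → K₁ < τ → δ₁ < ε →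
        UniquelySolvable ν τ δ₁ δ₂ δ₃ fL fR Tw (P δ₂) := by
  obtain ⟨K, hK, ε, hε, H⟩ := exists_solutionPair hTw hP ha hc hd hη hball
  refine ⟨max K 1, lt_max_of_lt_left hK, ε, hε, fun τ δ₁ δ₂ δ₃ h1 h2 h3 hsum hd2 hτ hδ => ?_⟩
  have V : ValidParams d τ δ₁ δ₂ δ₃ :=
    ⟨hd, ((le_max_right _ _).trans_lt hτ).le, h1, h2, h3, hsum, hd2⟩
  obtain ⟨⟨m, s, hs, hs1, hs2, hm⟩, huniq⟩ := H τ δ₁ δ₂ δ₃ V ((le_max_left _ _).trans_lt hτ) hδ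
  have hma (x : Icc (0 : ℝ) 1) := (hm x).1
  obtain ⟨c', hc', C, hC, hG0, hG1, -, -⟩ := exists_gaussD_bounds hTw ν B ha hc
  set f := profile τ δ₃ (wallSource δ₁ δ₂ fL fR Tw s) (fieldSource ν a B c m) with hf
  have hcl : InClass f := inClass_profile hTw hP V hc' (measurable_fieldSource ha hc m)
    (fun y v => hG1 _ v) s
  have hgauss : ∀ y ∈ Icc (0 : ℝ) 1, ∀ v, gaussianES ν f y v = fieldSource ν a B c m y v :=
    fun y hy v => gaussianES_eq_fieldSource ha hy (hcl.2.1 y hy) (hs.2 ⟨y, hy⟩).symm (hma _) v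
  have hflux := fluxes_eq_newFlux hTw hP ha hc hcl hs.2 hma
    fun x _ => Filter.EventuallyEq.refl _ (f x)
  have hME : MildEquation ν τ f := mildEquation_profile (fun _ _ _ => rfl) hgauss
  have hBR := boundaryRelation_profile (fL := fL) (fR := fR) (Tw := Tw) V (fieldSource ν a B c m) s
  have hsol : IsMildSolution ν τ δ₁ δ₂ δ₃ fL fR Tw f := by
    obtain ⟨e1, e2⟩ := Prod.ext_iff.1 (hflux.trans hs.1.symm)
    simp only at e1 e2
    exact ⟨hcl, hME, by rw [e1, e2]; exact hBR⟩
  have hnn : Nonneg f := by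
    intro x hx
    filter_upwards [hP.1, ae_comp_reflect hP.1] with v hv hv'
    exact profile_nonneg V.tau_pos V.d_pos V.nonneg₃ V.le₃ (fun y w => hG0 _ w) hx
      (wallSource_nonneg hTw h1 h2 hs1 hs2 hv) (wallSource_nonneg hTw h1 h2 hs1 hs2 hv')
  -- Once the fixed points coincide, so do the profiles that they generate.
  have hu : ∀ g, IsMildSolution ν τ δ₁ δ₂ δ₃ fL fR Tw g →
      (∀ x ∈ Icc (0 : ℝ) 1, moments (g x) ∈ admissible ν a B c) →
      ∀ x ∈ Icc (0 : ℝ) 1, g x =ᵐ[volume] f x := by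
    intro g hg hga
    obtain ⟨m', s', hs', hma', hgp⟩ := hg.isSolutionPair hTw hP V ha hc hga
    obtain ⟨rfl, rfl⟩ := huniq m m' s s' hma hma' hs hs'
    exact hgp
  refine ⟨f, ⟨hsol, hnn, hnear δ₂ h2 V.le_one₂ f hcl fun x hx => ?_⟩,
    fun g hg hgn hgP => hu g hg (hadm δ₂ hd2 g hg.1 hgn hgP), fun hcomp => ?_,
    fun g hg hgE hgM hgF hgn hgP => ?_⟩
  · rw [← hs.2 ⟨x, hx⟩]; exact (hm _).2
  · obtain ⟨e1, e2, e3⟩ := hs.fluxes hTw hP V ha hc hma rfl rfl hcomp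
    rw [← hf] at e1 e2
    exact ⟨by rw [MixedBoundary, e1, e2]; exact hBR, by rw [FluxNormalized, e1, e2]; exact e3⟩
  · have hga := hadm δ₂ hd2 g hg hgn hgP
    exact hu g (isMildSolution_of_mixedBoundary hTw hP V ha hc hg hgE hgM hgF hga) hga

/-! ### Quadratic forms of moments. -/

section forms

variable {g : Vel → ℝ}

theorem norm_sq_eq_sum (v : Vel) : ‖v‖ ^ 2 = ∑ i : Fin 3, v i * v i := by
  rw [EuclideanSpace.norm_sq_eq]
  exact Finset.sum_congr rfl fun i _ => by rw [Real.norm_eq_abs, sq_abs, sq]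

theorem inner_sq_eq_sum (v κ : Vel) :
    inner ℝ v κ ^ 2 = ∑ i : Fin 3, ∑ j : Fin 3, κ i * κ j * (v i * v j) := by
  have h : inner ℝ v κ = ∑ i : Fin 3, κ i * v i := by simp [PiLp.inner_apply]
  rw [h, sq, Finset.sum_mul_sum]
  exact Finset.sum_congr rfl fun i _ => Finset.sum_congr rfl fun j _ => by ring

theorem abs_inner_sq_le (v : Vel) {κ : Vel} (hκ : ‖κ‖ = 1) : inner ℝ v κ ^ 2 ≤ ‖v‖ ^ 2 := by
  have h := abs_real_inner_le_norm v κ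
  rw [hκ, mul_one] at h
  exact sq_le_sq' (by linarith [neg_abs_le (inner ℝ v κ)]) ((le_abs_self _).trans h)

theorem moments_zero_zero (g : Vel → ℝ) : moments g 0 0 = ∫ v, g v := by simp [moments]

theorem sum_moments_succ (hg : Integrable (fun v => g v * wt v)) :
    ∑ i : Fin 3, moments g i.succ i.succ = ∫ v, g v * ‖v‖ ^ 2 := by
  simp only [moments]
  rw [← integral_finsetSum _ fun i _ => integrable_mul_hat hg _ _]
  simp only [hat_succ, norm_sq_eq_sum, Finset.mul_sum]

theorem integrable_of_wt (hg : Integrable (fun v => g v * wt v)) : Integrable g := by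
  simpa using integrable_mul_hat hg 0 0

theorem integrable_mul_norm_sq (hg : Integrable (fun v => g v * wt v)) :
    Integrable (fun v => g v * ‖v‖ ^ 2) :=
  integrable_mul_of_wt hg (by fun_prop) (K := 1) fun v => by
    rw [abs_of_nonneg (by positivity), one_mul, wt]; linarith

theorem integral_mul_wt (hg : Integrable (fun v => g v * wt v)) :
    ∫ v, g v * wt v = (∫ v, g v) + ∫ v, g v * ‖v‖ ^ 2 := by
  rw [← integral_add (integrable_of_wt hg) (integrable_mul_norm_sq hg)]
  simp only [wt, mul_add, mul_one]

theorem integrable_mul_inner_sq (hg : Integrable (fun v => g v * wt v)) {κ : Vel} (hκ : ‖κ‖ = 1) :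
    Integrable (fun v => g v * inner ℝ v κ ^ 2) :=
  integrable_mul_of_wt hg (by fun_prop) (K := 1) fun v => by
    rw [abs_of_nonneg (by positivity), one_mul, wt]; linarith [abs_inner_sq_le v hκ]

theorem sum_moments_quad (hg : Integrable (fun v => g v * wt v)) (κ : Vel) :
    ∑ i : Fin 3, ∑ j : Fin 3, κ i * κ j * moments g i.succ j.succ =
      ∫ v, g v * inner ℝ v κ ^ 2 := by
  have h (i j : Fin 3) : Integrable fun v => κ i * κ j * (g v * (hat v i.succ * hat v j.succ)) :=
    (integrable_mul_hat hg _ _).const_mul _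
  simp only [moments, ← integral_const_mul]
  have h2 (i : Fin 3) : ∑ j : Fin 3, ∫ v, κ i * κ j * (g v * (hat v i.succ * hat v j.succ)) =
      ∫ v, ∑ j : Fin 3, κ i * κ j * (g v * (hat v i.succ * hat v j.succ)) :=
    (integral_finsetSum _ fun j _ => h i j).symm
  simp only [h2]
  rw [← integral_finsetSum _ fun i _ => integrable_finsetSum _ fun j _ => h i j]
  refine integral_congr_ae (Filter.Eventually.of_forall fun v => ?_)
  simp only [inner_sq_eq_sum, Finset.mul_sum, hat_succ]
  exact Finset.sum_congr rfl fun i _ => Finset.sum_congr rfl fun j _ => by ring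

theorem sum_sq_eq_one {κ : Vel} (hκ : ‖κ‖ = 1) : ∑ i : Fin 3, κ i * κ i = 1 := by
  rw [← norm_sq_eq_sum, hκ, one_pow]

theorem quadForm_momTensor (ν : ℝ) (m : Moments) {κ : Vel} (hκ : ‖κ‖ = 1) :
    quadForm (momTensor ν m) κ = (1 - ν) * ((∑ i, momCov m i i) / 3) +
      ν * ∑ i : Fin 3, ∑ j : Fin 3, κ i * κ j * momCov m i j := by
  have h1 := sum_sq_eq_one hκ
  rw [quadForm_eq_sum]
  simp only [momTensor, Matrix.add_apply, Matrix.smul_apply, Matrix.of_apply, smul_eq_mul,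
    Matrix.one_apply, Fin.sum_univ_three] at h1 ⊢
  simp
  linear_combination (1 - ν) * ((momCov m 0 0 + momCov m 1 1 + momCov m 2 2) / 3) * h1

end forms

/-! ### Positivity and size of the constants. -/

section constants

variable {Tw : Fin 2 → ℝ} {fL fR : Vel → ℝ}

theorem exp_neg_inv_pos (v : Vel) : 0 < Real.exp (-(1 / |v 0|)) := Real.exp_pos _

theorem exp_neg_inv_le (v : Vel) : Real.exp (-(1 / |v 0|)) ≤ 1 := by
  rw [Real.exp_le_one_iff, neg_nonpos]; positivity

theorem exp_neg_inv_lt {v : Vel} (hv : v 0 ≠ 0) : Real.exp (-(1 / |v 0|)) < 1 := by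
  rw [Real.exp_lt_one_iff, neg_lt_zero]
  have := abs_pos.2 hv
  positivity

theorem measurable_exp_neg_inv : Measurable fun v : Vel => Real.exp (-(1 / |v 0|)) := by
  have : Measurable (fun v : Vel => v 0) := (continuous_coord 0).measurable
  fun_prop

theorem integrable_exp_mul {g : Vel → ℝ} (hg : Integrable g) :
    Integrable fun v => Real.exp (-(1 / |v 0|)) * g v :=
  hg.bdd_mul (c := 1) measurable_exp_neg_inv.aestronglyMeasurable
    (Filter.Eventually.of_forall fun v => by
      rw [Real.norm_of_nonneg (exp_neg_inv_pos v).le]; exact exp_neg_inv_le v)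

theorem integrable_exp_wallMw_wt (hTw : ∀ i, 0 < Tw i) :
    Integrable fun v => Real.exp (-(1 / |v 0|)) * wallMw Tw v * wt v :=
  (integrable_exp_mul (integrable_wallMw_wt hTw)).congr
    (Filter.Eventually.of_forall fun _ => (mul_assoc _ _ _).symm)

theorem integrable_exp_wallMaxwellian {T : ℝ} (hT : 0 < T) :
    Integrable fun v : Vel => Real.exp (-(1 / |v 0|)) * wallMaxwellian T v * |v 0| :=
  (integrable_exp_mul (integrable_wallMaxwellian_mul_abs hT)).congr
    (Filter.Eventually.of_forall fun _ => (mul_assoc _ _ _).symm)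

theorem exp_wallMaxwellian_le {T : ℝ} (hT : 0 < T) (v : Vel) :
    Real.exp (-(1 / |v 0|)) * wallMaxwellian T v * |v 0| ≤ wallMaxwellian T v * |v 0| :=
  mul_le_mul_of_nonneg_right (mul_le_of_le_one_left (wallMaxwellian_pos hT v).le
    (exp_neg_inv_le v)) (abs_nonneg _)

theorem exp_wallMaxwellian_pos {T : ℝ} (hT : 0 < T) {v : Vel} (hv : v 0 ≠ 0) :
    0 < Real.exp (-(1 / |v 0|)) * wallMaxwellian T v * |v 0| :=
  mul_pos (mul_pos (exp_neg_inv_pos v) (wallMaxwellian_pos hT v)) (abs_pos.2 hv)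

theorem constGamma_pos (hTw : ∀ i, 0 < Tw i) : 0 < constGamma Tw :=
  mul_pos (setIntegral_posHalf_pos (integrable_exp_wallMaxwellian (hTw 0))
      fun _ hv => exp_wallMaxwellian_pos (hTw 0) (mem_posHalf.1 hv).ne')
    (setIntegral_negHalf_pos (integrable_exp_wallMaxwellian (hTw 1))
      fun _ hv => exp_wallMaxwellian_pos (hTw 1) (mem_negHalf.1 hv).ne)

/-- Dropping the attenuation e^{-1/|v₁|} leaves two unit fluxes. -/
theorem constGamma_le_one (hTw : ∀ i, 0 < Tw i) : constGamma Tw ≤ 1 := by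
  have h1 : ∫ v in posHalf, Real.exp (-(1 / |v 0|)) * wallMaxwellian (Tw 0) v * |v 0| ≤ 1 := by
    refine le_of_le_of_eq ?_ (wallMaxwellian_flux_pos (hTw 0))
    exact integral_mono (integrable_exp_wallMaxwellian (hTw 0)).integrableOn
      (integrable_wallMaxwellian_mul_abs (hTw 0)).integrableOn (exp_wallMaxwellian_le (hTw 0))
  have h2 : ∫ v in negHalf, Real.exp (-(1 / |v 0|)) * wallMaxwellian (Tw 1) v * |v 0| ≤ 1 := by
    refine le_of_le_of_eq ?_ (wallMaxwellian_flux_neg (hTw 1))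
    exact integral_mono (integrable_exp_wallMaxwellian (hTw 1)).integrableOn
      (integrable_wallMaxwellian_mul_abs (hTw 1)).integrableOn (exp_wallMaxwellian_le (hTw 1))
  refine mul_le_one₀ h1 (integral_nonneg fun v => ?_) h2
  exact mul_nonneg (mul_nonneg (exp_neg_inv_pos v).le (wallMaxwellian_pos (hTw 1) v).le)
    (abs_nonneg _)

/-- A nonnegative integrable function which is positive on a nonempty open set has positive
integral. -/
theorem integral_pos_of_isOpen {g : Vel → ℝ} (hg : Integrable g) (h0 : ∀ v, 0 ≤ g v) {U : Set Vel}
    (hU : IsOpen U) (hne : U.Nonempty) (hpos : ∀ v ∈ U, 0 < g v) : 0 < ∫ v, g v := by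
  rw [integral_pos_iff_support_of_nonneg h0 hg]
  exact (hU.measure_pos volume hne).trans_le (measure_mono fun v hv => (hpos v hv).ne')

theorem posHalf_nonempty : posHalf.Nonempty := ⟨EuclideanSpace.single 0 1, by simp [posHalf]⟩

theorem constA_pos (hTw : ∀ i, 0 < Tw i) : 0 < constA Tw := by
  refine mul_pos (by norm_num) (integral_pos_of_isOpen (integrable_of_wt
    (integrable_exp_wallMw_wt hTw)) (fun v => mul_nonneg (exp_neg_inv_pos v).le
      (wallMw_nonneg hTw v)) isOpen_posHalf posHalf_nonempty fun v hv => ?_)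
  exact mul_pos (exp_neg_inv_pos v) (wallMw_pos hTw (mem_posHalf.1 hv).ne')

/-- The attenuation factor is strictly below 1 off v₁ = 0. The strict inequality is the margin of
the density bound at the limit. -/
theorem constA_lt (hTw : ∀ i, 0 < Tw i) : constA Tw < 1 / 2 * ∫ v, wallMw Tw v := by
  have i1 := integrable_of_wt (integrable_wallMw_wt hTw)
  have i2 := integrable_of_wt (integrable_exp_wallMw_wt hTw)
  have h : 0 < ∫ v, (wallMw Tw v - Real.exp (-(1 / |v 0|)) * wallMw Tw v) := by
    refine integral_pos_of_isOpen (i1.sub i2) (fun v => sub_nonneg.2 (mul_le_of_le_one_left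
      (wallMw_nonneg hTw v) (exp_neg_inv_le v))) isOpen_posHalf posHalf_nonempty fun v hv => ?_
    have hv : v 0 ≠ 0 := (mem_posHalf.1 hv).ne'
    exact sub_pos.2 (mul_lt_of_lt_one_left (wallMw_pos hTw hv) (exp_neg_inv_lt hv))
  rw [integral_sub i1 i2] at h
  rw [constA]
  linarith

theorem traceNorm_self {w g : Vel → ℝ} (h : Integrable fun v => |g v| * w v) :
    traceNorm w g g = 2 * ∫ v, |g v| * w v := by
  rw [traceNorm, integral_eq_half_add_half h]; ring

theorem le_constC (hTw : ∀ i, 0 < Tw i) (fL fR : Vel → ℝ) :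
    2 * ∫ v, wallMw Tw v * wt v ≤ constC fL fR Tw := by
  have h1 : traceNorm wt (wallMw Tw) (wallMw Tw) = 2 * ∫ v, wallMw Tw v * wt v := by
    rw [traceNorm_self (integrable_abs_mul_wt (integrable_wallMw_wt hTw))]
    simp only [abs_of_nonneg (wallMw_nonneg hTw _)]
  have h2 : 0 ≤ traceNorm (fun v => |v 0|) (glue fL fR) (glue fL fR) := by
    have (S : Set Vel) : 0 ≤ ∫ v in S, |glue fL fR v| * |v 0| :=
      integral_nonneg fun v => mul_nonneg (abs_nonneg _) (abs_nonneg _)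
    rw [traceNorm]
    exact add_nonneg (add_nonneg (this _) (this _)) (add_nonneg (this _) (this _))
  rw [← h1]
  exact le_add_of_nonneg_left h2

theorem integral_exp_wallMw_coord_sq_pos (hTw : ∀ i, 0 < Tw i) (i : Fin 3) :
    0 < moments (fun v => Real.exp (-(1 / |v 0|)) * wallMw Tw v) i.succ i.succ := by
  refine integral_pos_of_isOpen (integrable_mul_hat (integrable_exp_wallMw_wt hTw) _ _)
    (fun v => mul_nonneg (mul_nonneg (exp_neg_inv_pos v).le (wallMw_nonneg hTw v))
      (mul_self_nonneg _)) (U := {v : Vel | 0 < v 0} ∩ {v : Vel | 0 < v i})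
    ((isOpen_lt continuous_const (continuous_coord 0)).inter
      (isOpen_lt continuous_const (continuous_coord i)))
    ⟨!₂[1, 1, 1], ?_⟩ fun v hv => ?_
  · constructor
    · simp
    · fin_cases i <;> simp
  · have h0 : v 0 ≠ 0 := (show 0 < v 0 from hv.1).ne'
    have hi : 0 < v i := hv.2
    exact mul_pos (mul_pos (exp_neg_inv_pos v) (wallMw_pos hTw h0)) (mul_pos hi hi)

/-- Mixed moments of a function with two reflection symmetries vanish. -/
theorem moments_succ_eq_zero {g : Vel → ℝ} (hg : ∀ i ≠ (0 : Fin 3), ∀ v, g (flip i v) = g v)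
    {i j : Fin 3} (hij : i ≠ j) : moments g i.succ j.succ = 0 := by
  wlog hi : i ≠ 0 generalizing i j
  · rw [moments_symm]
    exact this hij.symm fun hj => hij (by rw [not_not.1 hi, hj])
  refine integral_eq_zero_of_flip i fun v => ?_
  simp only [hg i hi, hat_succ, flip_apply, if_true, if_neg hij.symm]
  ring

theorem exp_wallMw_flip {i : Fin 3} (hi : i ≠ 0) (v : Vel) :
    Real.exp (-(1 / |flip i v 0|)) * wallMw Tw (flip i v) =
      Real.exp (-(1 / |v 0|)) * wallMw Tw v := by
  rw [wallMw_flip hi, flip_apply, if_neg hi.symm]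

/-- Tangential flips kill every mixed second moment, so the form is diagonal in κ. -/
theorem integral_exp_wallMw_deficit (hTw : ∀ i, 0 < Tw i) {κ : Vel} (hκ : ‖κ‖ = 1) :
    ∫ v, Real.exp (-(1 / |v 0|)) * wallMw Tw v * (‖v‖ ^ 2 - inner ℝ v κ ^ 2) =
      ∑ i : Fin 3, (1 - κ i * κ i) *
        moments (fun v => Real.exp (-(1 / |v 0|)) * wallMw Tw v) i.succ i.succ := by
  have hg := integrable_exp_wallMw_wt hTw
  simp only [mul_sub]
  rw [integral_sub (integrable_mul_norm_sq hg) (integrable_mul_inner_sq hg hκ),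
    ← sum_moments_succ hg, ← sum_moments_quad hg, ← Finset.sum_sub_distrib]
  refine Finset.sum_congr rfl fun i _ => ?_
  rw [Finset.sum_eq_single i (fun j _ hj => by
    rw [moments_succ_eq_zero (fun i hi v => exp_wallMw_flip hi v) hj.symm, mul_zero]) (by simp)]
  ring

/-- The weights 1 - κᵢ² are nonnegative and sum to 2, so every integral is at least twice the
smallest diagonal moment, uniformly in κ. -/
theorem constACrit_pos (hTw : ∀ i, 0 < Tw i) : 0 < constACrit Tw := by
  set w : Fin 3 → ℝ := fun i =>
    moments (fun v => Real.exp (-(1 / |v 0|)) * wallMw Tw v) i.succ i.succ with hw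
  have hw0 (i : Fin 3) : 0 < w i := integral_exp_wallMw_coord_sq_pos hTw i
  set r := min (w 0) (min (w 1) (w 2)) with hr
  have hr0 : 0 < r := lt_min (hw0 0) (lt_min (hw0 1) (hw0 2))
  have hrw : ∀ i, r ≤ w i := by
    intro i; fin_cases i <;> simp [hr]
  have : Nonempty (Metric.sphere (0 : Vel) 1) :=
    (NormedSpace.sphere_nonempty.mpr zero_le_one).to_subtype
  refine (by positivity : 0 < 2 * r).trans_le (le_ciInf fun κ => ?_)
  have hκ : ‖(κ : Vel)‖ = 1 := by simp
  rw [integral_exp_wallMw_deficit hTw hκ]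
  have h1 := sum_sq_eq_one hκ
  have h2 (i : Fin 3) : 0 ≤ 1 - (κ : Vel) i * (κ : Vel) i := by
    refine sub_nonneg.2 (le_of_le_of_eq ?_ h1)
    exact Finset.single_le_sum (f := fun i => (κ : Vel) i * (κ : Vel) i)
      (fun j _ => mul_self_nonneg _) (Finset.mem_univ i)
  calc 2 * r = ∑ i : Fin 3, (1 - (κ : Vel) i * (κ : Vel) i) * r := by
        rw [← Finset.sum_mul, Finset.sum_sub_distrib, h1]; simp; left; norm_num
    _ ≤ _ := Finset.sum_le_sum fun i _ => mul_le_mul_of_nonneg_left (hrw i) (h2 i)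

theorem constACrit_le (hTw : ∀ i, 0 < Tw i) {κ : Vel} (hκ : ‖κ‖ = 1) :
    constACrit Tw ≤ ∫ v, wallMw Tw v * (‖v‖ ^ 2 - inner ℝ v κ ^ 2) := by
  have h0 {κ : Vel} (hκ : ‖κ‖ = 1) (v : Vel) : 0 ≤ ‖v‖ ^ 2 - inner ℝ v κ ^ 2 :=
    sub_nonneg.2 (abs_inner_sq_le v hκ)
  have hint {g : Vel → ℝ} (hg : Integrable fun v => g v * wt v) :
      Integrable fun v => g v * (‖v‖ ^ 2 - inner ℝ v κ ^ 2) := by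
    simp only [mul_sub]
    exact (integrable_mul_norm_sq hg).sub (integrable_mul_inner_sq hg hκ)
  refine (ciInf_le ⟨0, ?_⟩ (⟨κ, by simpa using hκ⟩ : Metric.sphere (0 : Vel) 1)).trans
    (integral_mono (hint (integrable_exp_wallMw_wt hTw)) (hint (integrable_wallMw_wt hTw))
      fun v => ?_)
  · rintro _ ⟨κ', rfl⟩
    exact integral_nonneg fun v => mul_nonneg (mul_nonneg (exp_neg_inv_pos v).le
      (wallMw_nonneg hTw v)) (h0 (by simp) v)
  · exact mul_le_mul_of_nonneg_right (mul_le_of_le_one_left (wallMw_nonneg hTw v)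
      (exp_neg_inv_le v)) (h0 hκ v)

end constants

/-! ### The temperature tensor at the limit and near it. -/

section limit

variable {Tw : Fin 2 → ℝ}

theorem integrable_half_wallMw_wt (hTw : ∀ i, 0 < Tw i) :
    Integrable fun v => 1 / 2 * wallMw Tw v * wt v := by
  simp only [mul_assoc]
  exact (integrable_wallMw_wt hTw).const_mul _

theorem limitMoments_zero_zero (Tw : Fin 2 → ℝ) :
    limitMoments Tw 0 0 = 1 / 2 * ∫ v, wallMw Tw v := by
  rw [limitMoments, moments_zero_zero, integral_const_mul]

theorem limitMoments_zero_succ (hTw : ∀ i, 0 < Tw i) (i : Fin 3) :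
    limitMoments Tw 0 i.succ = 0 := by
  simp only [limitMoments, moments, hat_zero, hat_succ, one_mul, mul_assoc]
  rw [integral_const_mul, integral_wallMw_odd hTw, mul_zero]

theorem momCov_limitMoments (hTw : ∀ i, 0 < Tw i) (i j : Fin 3) :
    momCov (limitMoments Tw) i j = limitMoments Tw i.succ j.succ / limitMoments Tw 0 0 := by
  rw [momCov, momU, limitMoments_zero_succ hTw, zero_div, zero_mul, sub_zero]

theorem integral_wallMw_pos (hTw : ∀ i, 0 < Tw i) : 0 < ∫ v, wallMw Tw v :=
  integral_pos_of_isOpen (integrable_of_wt (integrable_wallMw_wt hTw)) (wallMw_nonneg hTw)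
    isOpen_posHalf posHalf_nonempty fun _ hv => wallMw_pos hTw (mem_posHalf.1 hv).ne'

theorem quadForm_limit (hTw : ∀ i, 0 < Tw i) (ν : ℝ) {κ : Vel} (hκ : ‖κ‖ = 1) :
    quadForm (momTensor ν (limitMoments Tw)) κ =
      ((1 - ν) * ((∫ v, wallMw Tw v * ‖v‖ ^ 2) / 3) + ν * ∫ v, wallMw Tw v * inner ℝ v κ ^ 2) /
        ∫ v, wallMw Tw v := by
  have h0 := (integral_wallMw_pos hTw).ne'
  have hg := integrable_half_wallMw_wt hTw
  have e1 : ∑ i : Fin 3, limitMoments Tw i.succ i.succ = 1 / 2 * ∫ v, wallMw Tw v * ‖v‖ ^ 2 := by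
    rw [limitMoments, sum_moments_succ hg, ← integral_const_mul]
    simp only [mul_assoc]
  have e2 : ∑ i : Fin 3, ∑ j : Fin 3, κ i * κ j * limitMoments Tw i.succ j.succ =
      1 / 2 * ∫ v, wallMw Tw v * inner ℝ v κ ^ 2 := by
    rw [limitMoments, sum_moments_quad hg, ← integral_const_mul]
    simp only [mul_assoc]
  rw [quadForm_momTensor ν _ hκ]
  simp only [momCov_limitMoments hTw, ← mul_div_assoc, ← Finset.sum_div]
  rw [e1, e2, limitMoments_zero_zero]
  field_simp

/-- The temperature of the walls is bounded from below, since the flux is normalized. -/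
theorem four_le_integral_mul (hTw : ∀ i, 0 < Tw i) :
    4 ≤ (∫ v, wallMw Tw v * ‖v‖ ^ 2) * ∫ v, wallMw Tw v := by
  have h0 := integral_wallMw_pos hTw
  have hg := integrable_wallMw_wt hTw
  set w₀ := ∫ v, wallMw Tw v with hw
  have i1 := integrable_mul_abs_coord hg
  -- Cauchy–Schwarz through 2t|v₁| ≤ t² + |v|² with the optimal t = 2/w₀; the integral of M_w|v₁| is
  -- 2.
  have h1 : ∫ v, 2 * (2 / w₀) * (wallMw Tw v * |v 0|) ≤
      ∫ v, ((2 / w₀) ^ 2 * wallMw Tw v + wallMw Tw v * ‖v‖ ^ 2) := by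
    refine integral_mono (i1.const_mul _) (((integrable_of_wt hg).const_mul _).add
      (integrable_mul_norm_sq hg)) fun v => ?_
    have h2 : 2 * (2 / w₀) * |v 0| ≤ (2 / w₀) ^ 2 + ‖v‖ ^ 2 := by
      have h3 : |v 0| ^ 2 ≤ ‖v‖ ^ 2 := by gcongr; exact abs_coord_le_norm v 0
      nlinarith [sq_nonneg (2 / w₀ - |v 0|)]
    have := mul_le_mul_of_nonneg_left h2 (wallMw_nonneg hTw v)
    simp only
    linarith
  rw [integral_const_mul, integral_wallMw_mul_abs hTw,
    integral_add ((integrable_of_wt hg).const_mul _) (integrable_mul_norm_sq hg),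
    integral_const_mul, ← hw] at h1
  have e : (2 / w₀) ^ 2 * w₀ = 4 / w₀ := by field_simp; norm_num
  have h4 : 4 / w₀ ≤ ∫ v, wallMw Tw v * ‖v‖ ^ 2 := by
    rw [e] at h1
    have : 2 * (2 / w₀) * 2 = 4 / w₀ + 4 / w₀ := by ring
    linarith
  exact (div_le_iff₀ h0).1 h4

theorem integral_inner_sq_le (hTw : ∀ i, 0 < Tw i) {κ : Vel} (hκ : ‖κ‖ = 1) :
    ∫ v, wallMw Tw v * inner ℝ v κ ^ 2 ≤ ∫ v, wallMw Tw v * ‖v‖ ^ 2 :=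
  integral_mono (integrable_mul_inner_sq (integrable_wallMw_wt hTw) hκ)
    (integrable_mul_norm_sq (integrable_wallMw_wt hTw)) fun v =>
      mul_le_mul_of_nonneg_left (abs_inner_sq_le v hκ) (wallMw_nonneg hTw v)

theorem integral_inner_sq_nonneg (hTw : ∀ i, 0 < Tw i) (κ : Vel) :
    0 ≤ ∫ v, wallMw Tw v * inner ℝ v κ ^ 2 :=
  integral_nonneg fun v => mul_nonneg (wallMw_nonneg hTw v) (sq_nonneg _)

/-- The form is affine in the directional energy q, which lies between 0 and the full energy w₂. The
end points give the factors 1 - ν and 1 + 2ν in front of w₂/(3w₀). -/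
theorem quadForm_limit_bounds (hTw : ∀ i, 0 < Tw i) {ν : ℝ} {κ : Vel} (hκ : ‖κ‖ = 1) :
    min (1 - ν) (1 + 2 * ν) * ((∫ v, wallMw Tw v * ‖v‖ ^ 2) / (3 * ∫ v, wallMw Tw v)) ≤
        quadForm (momTensor ν (limitMoments Tw)) κ ∧
      quadForm (momTensor ν (limitMoments Tw)) κ ≤
        max (1 - ν) (1 + 2 * ν) * ((∫ v, wallMw Tw v * ‖v‖ ^ 2) / (3 * ∫ v, wallMw Tw v)) := by
  rw [quadForm_limit hTw ν hκ]
  have h0 := integral_wallMw_pos hTw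
  have hq := integral_inner_sq_le hTw hκ
  have hq0 := integral_inner_sq_nonneg hTw κ
  set w₀ := ∫ v, wallMw Tw v
  set w₂ := ∫ v, wallMw Tw v * ‖v‖ ^ 2
  set q := ∫ v, wallMw Tw v * inner ℝ v κ ^ 2
  have e (t : ℝ) : t * (w₂ / (3 * w₀)) = t * (w₂ / 3) / w₀ := by field_simp
  have hw : 0 ≤ w₂ / 3 := by linarith
  rw [e, e]
  constructor
  · refine div_le_div_of_nonneg_right ?_ h0.le
    rcases le_total 0 ν with h | h
    · have := mul_le_mul_of_nonneg_right (min_le_left (1 - ν) (1 + 2 * ν)) hw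
      nlinarith
    · have := mul_le_mul_of_nonneg_right (min_le_right (1 - ν) (1 + 2 * ν)) hw
      nlinarith
  · refine div_le_div_of_nonneg_right ?_ h0.le
    rcases le_total 0 ν with h | h
    · have := mul_le_mul_of_nonneg_right (le_max_right (1 - ν) (1 + 2 * ν)) hw
      nlinarith
    · have := mul_le_mul_of_nonneg_right (le_max_left (1 - ν) (1 + 2 * ν)) hw
      nlinarith

/-- Bounds with a margin at the limit hold in a neighbourhood. -/
theorem exists_bounds_near_limit (hTw : ∀ i, 0 < Tw i) (fL fR : Vel → ℝ) (ν : ℝ)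
    {lo lo' hi hi' : ℝ} (hlo : lo < lo') (hhi : hi' < hi)
    (hq : ∀ κ : Vel, ‖κ‖ = 1 → lo' ≤ quadForm (momTensor ν (limitMoments Tw)) κ ∧
      quadForm (momTensor ν (limitMoments Tw)) κ ≤ hi') :
    ∃ η > 0, ∀ m : Moments, ‖m - limitMoments Tw‖ ≤ η → constA Tw ≤ m 0 0 ∧
      (∀ k l, |m k l| ≤ 2 * constC fL fR Tw) ∧ ∑ k, m k k ≤ 2 * constC fL fR Tw ∧
      ∀ κ : Vel, ‖κ‖ = 1 → lo ≤ quadForm (momTensor ν m) κ ∧ quadForm (momTensor ν m) κ ≤ hi := by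
  set m₀ := limitMoments Tw with hm₀
  have hg := integrable_half_wallMw_wt hTw
  have h00 : constA Tw < m₀ 0 0 := by rw [hm₀, limitMoments_zero_zero]; exact constA_lt hTw
  have hne : m₀ 0 0 ≠ 0 := ((constA_pos hTw).trans h00).ne'
  have hC := le_constC hTw fL fR
  have hW : 0 < ∫ v, wallMw Tw v * wt v := by
    rw [integral_mul_wt (integrable_wallMw_wt hTw)]
    exact add_pos_of_pos_of_nonneg (integral_wallMw_pos hTw)
      (integral_nonneg fun v => mul_nonneg (wallMw_nonneg hTw v) (sq_nonneg _))
  have hhalf : ∫ v, 1 / 2 * wallMw Tw v * wt v = 1 / 2 * ∫ v, wallMw Tw v * wt v := by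
    rw [← integral_const_mul]; simp only [mul_assoc]
  have hent (k l : Fin 4) : |m₀ k l| < 2 * constC fL fR Tw := by
    have h := abs_moments_le hg k l
    have e : ∫ v, |1 / 2 * wallMw Tw v| * wt v = ∫ v, 1 / 2 * wallMw Tw v * wt v := by
      congr 1; funext v
      rw [abs_of_nonneg (mul_nonneg (by norm_num) (wallMw_nonneg hTw v))]
    rw [e, hhalf] at h
    rw [hm₀, limitMoments]
    linarith
  have hsum : ∑ k, m₀ k k < 2 * constC fL fR Tw := by
    rw [Fin.sum_univ_succ, hm₀, limitMoments, moments_zero_zero, sum_moments_succ hg,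
      ← integral_mul_wt hg, hhalf]
    linarith
  have he : ∃ e > 0, e ≤ lo' - lo ∧ e ≤ hi - hi' :=
    ⟨_, lt_min (sub_pos.2 hlo) (sub_pos.2 hhi), min_le_left _ _, min_le_right _ _⟩
  obtain ⟨e, he0, he1, he2⟩ := he
  have c1 (k l : Fin 4) : ContinuousAt (fun m : Moments => m k l) m₀ :=
    (contDiffAt_entry k l).continuousAt
  have v1 := (c1 0 0).eventually (lt_mem_nhds h00)
  have v2 : ∀ᶠ m in nhds m₀, ∀ k l : Fin 4, |m k l| < 2 * constC fL fR Tw :=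
    Filter.eventually_all.2 fun k => Filter.eventually_all.2 fun l =>
      (c1 k l).abs.eventually (gt_mem_nhds (hent k l))
  have v3 : ∀ᶠ m in nhds m₀, ∑ k, m k k < 2 * constC fL fR Tw :=
    (tendsto_finsetSum _ fun k _ => c1 k k).eventually (gt_mem_nhds hsum)
  -- Controlling the nine entries up to e/9 controls the form up to e for all unit vectors at once.
  have v4 : ∀ᶠ m in nhds m₀, ∀ i j : Fin 3, |momTensor ν m i j - momTensor ν m₀ i j| < e / 9 := by
    refine Filter.eventually_all.2 fun i => Filter.eventually_all.2 fun j => ?_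
    have := ((contDiffAt_momTensor ν hne i j).continuousAt.sub
      (continuousAt_const (y := momTensor ν m₀ i j))).abs
    refine this.eventually (gt_mem_nhds ?_)
    simpa using he0
  obtain ⟨η, hη, H⟩ := Metric.nhds_basis_closedBall.eventually_iff.1 (v1.and (v2.and (v3.and v4)))
  refine ⟨η, hη, fun m hm => ?_⟩
  obtain ⟨a1, a2, a3, a4⟩ := H (mem_closedBall_iff_norm.2 hm)
  refine ⟨a1.le, fun k l => (a2 k l).le, a3.le, fun κ hκ => ?_⟩
  have hd := quadForm_le_of_abs_le (A := momTensor ν m - momTensor ν m₀) (M := e / 9)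
    (fun i j => (a4 i j).le) κ
  have hsub : quadForm (momTensor ν m - momTensor ν m₀) κ =
      quadForm (momTensor ν m) κ - quadForm (momTensor ν m₀) κ := by
    simp only [quadForm_eq_sum, Matrix.sub_apply, mul_sub, sub_mul, Finset.sum_sub_distrib]
  rw [hsub, hκ, abs_le] at hd
  obtain ⟨q1, q2⟩ := hq κ hκ
  constructor <;> linarith [hd.1, hd.2]

end limit

/-! ### The asserted bounds near the limit. -/

section bounds

variable {Tw : Fin 2 → ℝ} {fL fR : Vel → ℝ}

theorem constC_pos (hTw : ∀ i, 0 < Tw i) : 0 < constC fL fR Tw := by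
  have h := integral_mul_wt (integrable_wallMw_wt hTw)
  have h0 := integral_wallMw_pos hTw
  have h1 : 0 ≤ ∫ v, wallMw Tw v * ‖v‖ ^ 2 :=
    integral_nonneg fun v => mul_nonneg (wallMw_nonneg hTw v) (sq_nonneg _)
  linarith [le_constC hTw fL fR]

theorem integral_wallMw_le (hTw : ∀ i, 0 < Tw i) (fL fR : Vel → ℝ) :
    (∫ v, wallMw Tw v) + ∫ v, wallMw Tw v * ‖v‖ ^ 2 ≤ constC fL fR Tw / 2 := by
  rw [← integral_mul_wt (integrable_wallMw_wt hTw)]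
  linarith [le_constC hTw fL fR]

theorem moments_mem_admissible_of_nonneg {ν a B c : ℝ} {g : Vel → ℝ}
    (hg : Integrable fun v => g v * wt v) (h0 : ∀ᵐ v, 0 ≤ g v) (ha : a ≤ ∫ v, g v)
    (hB : ∫ v, g v * wt v ≤ B)
    (hc : ∀ κ : Vel, ‖κ‖ = 1 → c ≤ quadForm (momTensor ν (moments g)) κ) :
    moments g ∈ admissible ν a B c := by
  refine ⟨moments_symm g, by rwa [moments_zero_zero], fun k l =>
    (abs_moments_le hg k l).trans (le_of_eq_of_le ?_ hB), hc⟩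
  exact integral_congr_ae (h0.mono fun v hv => by simp only [abs_of_nonneg hv])

theorem sum_moments_diag {g : Vel → ℝ} (hg : Integrable fun v => g v * wt v) :
    ∑ k, moments g k k = ∫ v, g v * wt v := by
  rw [Fin.sum_univ_succ, moments_zero_zero, sum_moments_succ hg, integral_mul_wt hg]

/-- With w₀, w₂ the mass and energy of M_w and C the constant `constC`, the limit temperature is
w₂/(3w₀). The lower margin comes from w₀w₂ ≥ 4, w₀ ≤ C/2 and `constGamma_le_one`; the upper one from
w₂ < 2C and `constA_lt`. -/
theorem exists_noncritical_bounds (hTw : ∀ i, 0 < Tw i) (fL fR : Vel → ℝ) {ν : ℝ}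
    (h1 : -1 / 2 < ν) (h2 : ν < 1) :
    ∃ η > 0, ∀ m : Moments, ‖m - limitMoments Tw‖ ≤ η → constA Tw ≤ m 0 0 ∧
      (∀ k l, |m k l| ≤ 2 * constC fL fR Tw) ∧ ∑ k, m k k ≤ 2 * constC fL fR Tw ∧
      ∀ κ : Vel, ‖κ‖ = 1 →
        min (1 - ν) (1 + 2 * ν) * (constGamma Tw / (27 * constC fL fR Tw ^ 2)) ≤
          quadForm (momTensor ν m) κ ∧
        quadForm (momTensor ν m) κ ≤
          2 / (3 * constA Tw) * max (1 - ν) (1 + 2 * ν) * constC fL fR Tw := by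
  have hmin : 0 < min (1 - ν) (1 + 2 * ν) := lt_min (by linarith) (by linarith)
  have hmax : 0 < max (1 - ν) (1 + 2 * ν) := lt_max_of_lt_left (by linarith)
  have hw0 := integral_wallMw_pos hTw
  have h4 := four_le_integral_mul hTw
  have hle := integral_wallMw_le hTw fL fR
  have hγ := constGamma_le_one hTw
  have hA := constA_lt hTw
  have hA0 := constA_pos hTw
  have hC := constC_pos (fL := fL) (fR := fR) hTw
  refine exists_bounds_near_limit hTw fL fR ν ?_ ?_ fun κ hκ => quadForm_limit_bounds hTw hκ
  · refine mul_lt_mul_of_pos_left ?_ hmin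
    have hw2 : 0 < ∫ v, wallMw Tw v * ‖v‖ ^ 2 := by
      by_contra h
      nlinarith
    set w₀ := ∫ v, wallMw Tw v
    set w₂ := ∫ v, wallMw Tw v * ‖v‖ ^ 2
    set C := constC fL fR Tw
    have hwC : w₀ ≤ C / 2 := by linarith
    rw [div_lt_div_iff₀ (by positivity) (by positivity)]
    calc constGamma Tw * (3 * w₀) ≤ 1 * (3 * w₀) := by gcongr
      _ = 3 * w₀ * 1 := by ring
      _ < 3 * w₀ * 36 := by gcongr; norm_num
      _ = 27 * (4 * w₀) := by ring
      _ ≤ 27 * ((w₂ * w₀) * w₀) := by gcongr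
      _ = w₂ * (27 * w₀ ^ 2) := by ring
      _ ≤ w₂ * (27 * C ^ 2) := by gcongr; linarith
  · rw [show 2 / (3 * constA Tw) * max (1 - ν) (1 + 2 * ν) * constC fL fR Tw =
      max (1 - ν) (1 + 2 * ν) * (2 * constC fL fR Tw / (3 * constA Tw)) by ring]
    refine mul_lt_mul_of_pos_left ?_ hmax
    set w₀ := ∫ v, wallMw Tw v
    set w₂ := ∫ v, wallMw Tw v * ‖v‖ ^ 2
    set C := constC fL fR Tw
    have hw2C : w₂ < 2 * C := by linarith
    exact div_lt_div₀ hw2C (by linarith) (by positivity) (by positivity)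

/-- For ν = -1/2 the limit form equals (w₂ - q)/(2w₀), with q the energy in direction κ. Its
numerator is the energy transverse to κ, which `constACrit` bounds from below; this replaces the
factor 1 + 2ν, which vanishes here. -/
theorem exists_critical_bounds (hTw : ∀ i, 0 < Tw i) (fL fR : Vel → ℝ) :
    ∃ η > 0, ∀ m : Moments, ‖m - limitMoments Tw‖ ≤ η → constA Tw ≤ m 0 0 ∧
      (∀ k l, |m k l| ≤ 2 * constC fL fR Tw) ∧ ∑ k, m k k ≤ 2 * constC fL fR Tw ∧
      ∀ κ : Vel, ‖κ‖ = 1 →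
        constACrit Tw / (4 * constC fL fR Tw) ≤ quadForm (momTensor (-1 / 2) m) κ ∧
        quadForm (momTensor (-1 / 2) m) κ ≤ 3 / (2 * constA Tw) * constC fL fR Tw := by
  have hw0 := integral_wallMw_pos hTw
  have hle := integral_wallMw_le hTw fL fR
  have hA := constA_lt hTw
  have hA0 := constA_pos hTw
  have hcr := constACrit_pos hTw
  have hC := constC_pos (fL := fL) (fR := fR) hTw
  have hw2 : 0 ≤ ∫ v, wallMw Tw v * ‖v‖ ^ 2 :=
    integral_nonneg fun v => mul_nonneg (wallMw_nonneg hTw v) (sq_nonneg _)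
  refine exists_bounds_near_limit hTw fL fR (-1 / 2)
    (lo' := constACrit Tw / (2 * ∫ v, wallMw Tw v))
    (hi' := (∫ v, wallMw Tw v * ‖v‖ ^ 2) / (2 * ∫ v, wallMw Tw v)) ?_ ?_ fun κ hκ => ?_
  · exact div_lt_div_of_pos_left hcr (by linarith) (by linarith)
  · rw [div_mul_eq_mul_div]
    exact div_lt_div₀ (by linarith) (by linarith) (by linarith) (by linarith)
  · have h := constACrit_le hTw hκ
    have hq0 := integral_inner_sq_nonneg hTw κ
    simp only [mul_sub] at h
    rw [integral_sub (integrable_mul_norm_sq (integrable_wallMw_wt hTw))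
      (integrable_mul_inner_sq (integrable_wallMw_wt hTw) hκ)] at h
    rw [quadForm_limit hTw _ hκ, div_le_div_iff₀ (by linarith) hw0, div_le_div_iff₀ hw0 (by linarith)]
    constructor <;> nlinarith

end bounds

/-! ### The two cases of the theorem. -/

section main

variable {Tw : Fin 2 → ℝ} {fL fR : Vel → ℝ}

/-- The macroscopic bounds of a function with moments near the limit. -/
theorem bounds_of_moments {ν lo hi : ℝ} (hTw : ∀ i, 0 < Tw i) {f : ℝ → Vel → ℝ} {x C : ℝ}
    (hf : Integrable fun v => f x v * wt v)
    (h : constA Tw ≤ moments (f x) 0 0 ∧ ∑ k, moments (f x) k k ≤ C ∧ ∀ κ : Vel, ‖κ‖ = 1 →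
      lo ≤ quadForm (momTensor ν (moments (f x))) κ ∧
        quadForm (momTensor ν (moments (f x))) κ ≤ hi) :
    constA Tw ≤ ∫ v, f x v ∧ ∫ v, f x v * (1 + ‖v‖ ^ 2) ≤ C ∧ ∀ κ : Vel, ‖κ‖ = 1 →
      lo ≤ quadForm (tempTensor ν f x) κ ∧ quadForm (tempTensor ν f x) κ ≤ hi := by
  obtain ⟨h1, h2, h3⟩ := h
  have h0 : density f x ≠ 0 := by
    rw [density_eq]; exact ((constA_pos hTw).trans_le h1).ne'
  rw [tempTensor_eq ν hf h0]
  rw [moments_zero_zero] at h1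
  rw [sum_moments_diag hf] at h2
  exact ⟨h1, h2, h3⟩

theorem tempTensor_eq_of_le (ν : ℝ) (hTw : ∀ i, 0 < Tw i) {f : ℝ → Vel → ℝ} {x : ℝ}
    (hf : Integrable fun v => f x v * wt v) (h : constA Tw ≤ ∫ v, f x v) :
    tempTensor ν f x = momTensor ν (moments (f x)) :=
  tempTensor_eq ν hf ((constA_pos hTw).trans_le h).ne'

/-- A lower bound for the temperature tensor bounds the mass by the energy. -/
theorem mul_integral_le_energy {ν c : ℝ} {g : Vel → ℝ} (hg : Integrable fun v => g v * wt v)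
    (h0 : 0 < ∫ v, g v)
    (hc : ∀ κ : Vel, ‖κ‖ = 1 → c ≤ quadForm (momTensor ν (moments g)) κ) :
    3 * c * ∫ v, g v ≤ ∫ v, g v * ‖v‖ ^ 2 := by
  -- The temperature tensor and the stress tensor have the same trace, whatever ν.
  have htr : ∑ i : Fin 3, quadForm (momTensor ν (moments g)) (EuclideanSpace.single i 1) =
      ∑ i, momCov (moments g) i i := by
    simp only [quadForm_eq_sum, momTensor, Matrix.add_apply, Matrix.smul_apply, Matrix.of_apply,
      smul_eq_mul, Matrix.one_apply, Fin.sum_univ_three]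
    simp
    ring
  have h3 : 3 * c ≤ ∑ i, momCov (moments g) i i := by
    rw [← htr]
    calc 3 * c = ∑ _i : Fin 3, c := by simp
      _ ≤ _ := Finset.sum_le_sum fun i _ => hc _ (by simp)
  have h4 : ∑ i, momCov (moments g) i i ≤ (∫ v, g v * ‖v‖ ^ 2) / ∫ v, g v := by
    rw [← sum_moments_succ hg, ← moments_zero_zero, Finset.sum_div]
    exact Finset.sum_le_sum fun i _ => sub_le_self _ (mul_self_nonneg _)
  exact (le_div_iff₀ h0).1 (h3.trans h4)

theorem exists_uniquelySolvable_noncritical (hTw : ∀ i, 0 < Tw i) (hP : PropP1 fL fR) {d : ℝ}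
    (hd : 0 < d) {ν : ℝ} (h1 : -1 / 2 < ν) (h2 : ν < 1) :
    ∃ K₁ > (0 : ℝ), ∃ ε > (0 : ℝ), ∀ τ δ₁ δ₂ δ₃ : ℝ,
      0 ≤ δ₁ → 0 ≤ δ₂ → 0 ≤ δ₃ → δ₁ + δ₂ + δ₃ = 1 → d ≤ δ₂ → K₁ < τ → δ₁ < ε →
        UniquelySolvable ν τ δ₁ δ₂ δ₃ fL fR Tw (NoncriticalBounds ν δ₂ fL fR Tw) := by
  obtain ⟨η, hη, H⟩ := exists_noncritical_bounds hTw fL fR h1 h2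
  have hmin : 0 < min (1 - ν) (1 + 2 * ν) := lt_min (by linarith) (by linarith)
  have hγ := constGamma_pos hTw
  have hC := constC_pos (fL := fL) (fR := fR) hTw
  have hd' : 0 < min d 1 := lt_min hd one_pos
  have hq : 0 < constGamma Tw / (27 * constC fL fR Tw ^ 2) := by positivity
  -- The threshold c must not depend on δ₂: it lies below the asserted bound because δ₂ ≥ d, and the
  -- cap min d 1 keeps it below the bound valid near the limit.
  refine exists_uniquelySolvable hTw hP (a := constA Tw) (B := 2 * constC fL fR Tw)
    (c := min (1 - ν) (1 + 2 * ν) * min d 1 ^ 2 * (constGamma Tw / (27 * constC fL fR Tw ^ 2)))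
    (constA_pos hTw) (by positivity) hd hη (fun m hs hm => ?_)
    (fun δ₂ => NoncriticalBounds ν δ₂ fL fR Tw) (fun δ₂ hδ g hg hn hb x hx => ?_)
    fun δ₂ hδ hδ1 f hf hm x hx => ?_
  · obtain ⟨e1, e2, -, e4⟩ := H m hm
    refine ⟨hs, e1, e2, fun κ hκ => le_trans ?_ (e4 κ hκ).1⟩
    refine mul_le_mul_of_nonneg_right (mul_le_of_le_one_right hmin.le ?_) hq.le
    exact pow_le_one₀ hd'.le (min_le_right _ _)
  · obtain ⟨b1, b2, b3⟩ := hb x hx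
    refine moments_mem_admissible_of_nonneg (hg.2.1 x hx) (hn x hx) b1 b2 fun κ hκ => ?_
    rw [← tempTensor_eq_of_le ν hTw (hg.2.1 x hx) b1]
    refine le_trans ?_ (b3 κ hκ).1
    have := (min_le_left d 1).trans hδ
    gcongr
  · obtain ⟨e1, -, e3, e4⟩ := H _ (hm x hx)
    refine bounds_of_moments hTw (hf.2.1 x hx) ⟨e1, e3, fun κ hκ => ⟨le_trans ?_ (e4 κ hκ).1,
      (e4 κ hκ).2⟩⟩
    exact mul_le_mul_of_nonneg_right (mul_le_of_le_one_right hmin.le (pow_le_one₀ hδ hδ1)) hq.le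

theorem exists_uniquelySolvable_critical (hTw : ∀ i, 0 < Tw i) (hP : PropP1 fL fR) {d : ℝ}
    (hd : 0 < d) :
    ∃ K₁ > (0 : ℝ), ∃ ε > (0 : ℝ), ∀ τ δ₁ δ₂ δ₃ : ℝ,
      0 ≤ δ₁ → 0 ≤ δ₂ → 0 ≤ δ₃ → δ₁ + δ₂ + δ₃ = 1 → d ≤ δ₂ → K₁ < τ → δ₁ < ε →
        UniquelySolvable (-1 / 2) τ δ₁ δ₂ δ₃ fL fR Tw (CriticalBounds δ₂ fL fR Tw) := by
  obtain ⟨η, hη, H⟩ := exists_critical_bounds hTw fL fR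
  have hcr := constACrit_pos hTw
  have hA := constA_pos hTw
  have hC := constC_pos (fL := fL) (fR := fR) hTw
  have hd' : 0 < min d 1 := lt_min hd one_pos
  have hq : 0 < constACrit Tw / (4 * constC fL fR Tw) := by positivity
  set c := min d 1 * (constACrit Tw / (4 * constC fL fR Tw)) with hc
  have hc0 : 0 < c := by positivity
  -- Here the class bounds the energy but not the mass from above. The first summand of B is the
  -- mass bound that `mul_integral_le_energy` extracts from the lower bound on the temperature
  -- tensor.
  refine exists_uniquelySolvable hTw hP (a := constA Tw)
    (B := 2 * constC fL fR Tw / (3 * c) + 2 * constC fL fR Tw) (c := c) hA hc0 hd hη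
    (fun m hs hm => ?_) (fun δ₂ => CriticalBounds δ₂ fL fR Tw)
    (fun δ₂ hδ g hg hn hb x hx => ?_) fun δ₂ hδ hδ1 f hf hm x hx => ?_
  · obtain ⟨e1, e2, -, e4⟩ := H m hm
    refine ⟨hs, e1, fun k l => (e2 k l).trans (le_add_of_nonneg_left (by positivity)),
      fun κ hκ => le_trans ?_ (e4 κ hκ).1⟩
    exact mul_le_of_le_one_left hq.le (min_le_right _ _)
  · obtain ⟨b1, b2, b3⟩ := hb x hx
    have hi := hg.2.1 x hx
    have hlow : ∀ κ : Vel, ‖κ‖ = 1 → c ≤ quadForm (momTensor (-1 / 2) (moments (g x))) κ := by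
      intro κ hκ
      rw [← tempTensor_eq_of_le _ hTw hi b1]
      exact (mul_le_mul_of_nonneg_right ((min_le_left d 1).trans hδ) hq.le).trans (b3 κ hκ).1
    refine moments_mem_admissible_of_nonneg hi (hn x hx) b1 ?_ hlow
    rw [integral_mul_wt hi]
    refine add_le_add ?_ b2
    rw [le_div_iff₀ (by positivity), mul_comm]
    exact (mul_integral_le_energy hi (hA.trans_le b1) hlow).trans b2
  · obtain ⟨e1, -, e3, e4⟩ := H _ (hm x hx)
    obtain ⟨b1, b2, b3⟩ := bounds_of_moments hTw (hf.2.1 x hx) ⟨e1, e3, e4⟩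
    refine ⟨b1, ?_, fun κ hκ => ⟨(mul_le_of_le_one_left hq.le hδ1).trans (b3 κ hκ).1,
      (b3 κ hκ).2⟩⟩
    have := integral_mul_wt (hf.2.1 x hx)
    simp only [wt] at this
    linarith

end main

end ESBGK

theorem theorem1p2 (fL fR : ESBGK.Vel → ℝ) (Tw : Fin 2 → ℝ) (hTw : ∀ i, 0 < Tw i)
    (hP1 : ESBGK.PropP1 fL fR) (d : ℝ) (hd : 0 < d) :
    (0 < ESBGK.constGamma Tw ∧
      ∀ ν : ℝ, -1 / 2 < ν → ν < 1 →
        ∃ K₁ > (0 : ℝ), ∃ ε > (0 : ℝ), ∀ τ δ₁ δ₂ δ₃ : ℝ,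
          0 ≤ δ₁ → 0 ≤ δ₂ → 0 ≤ δ₃ → δ₁ + δ₂ + δ₃ = 1 → d ≤ δ₂ → K₁ < τ → δ₁ < ε →
            ESBGK.UniquelySolvable ν τ δ₁ δ₂ δ₃ fL fR Tw
              (ESBGK.NoncriticalBounds ν δ₂ fL fR Tw)) ∧
    (0 < ESBGK.constACrit Tw ∧
      ∃ K₁ > (0 : ℝ), ∃ ε₁ > (0 : ℝ), ∀ τ δ₁ δ₂ δ₃ : ℝ,
        0 ≤ δ₁ → 0 ≤ δ₂ → 0 ≤ δ₃ → δ₁ + δ₂ + δ₃ = 1 → d ≤ δ₂ → K₁ < τ → δ₁ < ε₁ →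
          ESBGK.UniquelySolvable (-1 / 2) τ δ₁ δ₂ δ₃ fL fR Tw
            (ESBGK.CriticalBounds δ₂ fL fR Tw)) := by
  refine ⟨⟨ESBGK.constGamma_pos hTw, fun ν h1 h2 => ?_⟩, ESBGK.constACrit_pos hTw, ?_⟩
  · exact ESBGK.exists_uniquelySolvable_noncritical hTw hP1 hd h1 h2
  · exact ESBGK.exists_uniquelySolvable_critical hTw hP1 hd
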